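/- **Setting.** Let $1\le p<\infty$ and let $\mathcal M\subset\mathbb R^3$ be a smooth (embedded) submanifold without boundary, with tangent spaces $T_s(\mathcal M)$, $s\in\mathcal M$. Write $x=(x_\alpha,x_3)\in\mathbb R^2\times\mathbb R$, let $|\cdot|$ be the Euclidean norm on vectors and matrices, and write matrices by columns, so that $[T_s(\mathcal M)]^k\subset\mathbb R^{3\times k}$ is the set of matrices whose columns lie in $T_s(\mathcal M)$. Let $f:\mathbb R^3\times\mathbb R^{3\times3}\to\mathbb R$ be a Carathéodory function such that * (H1) $f(x_\alpha+\mathbf e_i,x_3,\xi)=f(x_\alpha,x_3,\xi)$ for all $(x_\alpha,x_3)\in\mathbb R^3$, $\xi\in\mathbb R^{3\times 3}$, $i=1,2$, where $\{\mathbf e_1,\mathbf e_2\}$ is the canonical basis of $\mathbb R^2$; * (H2) there are $\alpha,\beta>0$ with $\alpha|\xi|^p\le f(x,\xi)\le\beta(1+|\xi|^p)$ for a.e. $x\in\mathbb R^3$ and every $\xi\in\mathbb R^{3\times3}$. Let $Q'=(-\frac12,\frac12)^2$ and $(tQ')_{,1}=tQ'\times(-\frac12,\frac12)$. For a linear subspace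 $T\subseteq\mathbb R^3$ and $t>0$, let $\mathcal A_t(T)$ be the set of all $\varphi\in W^{1,\infty}((tQ')_{,1};T)$ (continuous representatives, extended continuously to the lateral boundary) with $\varphi=0$ on $\partial(tQ')\times(-\frac12,\frac12)$. Let $P_s$ be the orthogonal projection of $\mathbb R^3$ onto $T_s(\mathcal M)$ and $\mathbf P_s(\xi)=[P_s\xi_1|P_s\xi_2|P_s\xi_3]$ for $\xi=[\xi_1|\xi_2|\xi_3]$, and set $$\bar f(x,s,\xi)=f(x,\mathbf P_s(\xi))+|\xi-\mathbf P_s(\xi)|^p .$$ For $s\in\mathcal M$ and $\xi_\alpha\in\mathbb R^{3\times2}$ define $$Tf^0_{\rm hom}(s,\xi_\alpha)=\liminf_{t\to+\infty}\ \inf_{\varphi\in\mathcal A_t(T_s(\mathcal M))}\frac1{t^2}\int_{(tQ')_{,1}}f(x,\xi_\alpha+\nabla_\alpha\varphi\,|\,\nabla_3\varphi)\,dx,$$ $$\bar f^0_{\rm hom}(s,\xi_\alpha)=\lim_{t\to+\infty}\ \inf_{\varphi\in\mathcal A_t(\mathbb R^3)}\frac1{t^2}\int_{(tQ')_{,1}}\bar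 f(x,s,\xi_\alpha+\nabla_\alpha\varphi\,|\,\nabla_3\varphi)\,dx,$$ the latter whenever the limit exists. **Proposition 2.1.** Under these assumptions the following hold. (i) For every $s\in\mathcal M$ and $\xi_\alpha\in[T_s(\mathcal M)]^2$, the limit defining $\bar f^0_{\rm hom}(s,\xi_\alpha)$ exists (in $\mathbb R$), and $Tf^0_{\rm hom}(s,\xi_\alpha)=\bar f^0_{\rm hom}(s,\xi_\alpha)$. (ii) $Tf^0_{\rm hom}$ is tangentially quasiconvex in the second variable: for every $s\in\mathcal M$, $\xi_\alpha\in[T_s(\mathcal M)]^2$ and $\psi\in W^{1,\infty}_0(Q';T_s(\mathcal M))$, the function $Tf^0_{\rm hom}(s,\xi_\alpha+\nabla_\alpha\psi)$ is integrable on $Q'$ and $$Tf^0_{\rm hom}(s,\xi_\alpha)\le\int_{Q'}Tf^0_{\rm hom}(s,\xi_\alpha+\nabla_\alpha\psi)\,dx_\alpha .$$ In particular, for every $s\in\mathcal M$, $Tf^0_{\rm hom}(s,\cdot)$ is rank-one convex on $[T_s(\mathcal M)]^2$, i.e. convex along every segment in $[T_s(\mathcal M)]^2$ whose endpoints differ by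 a matrix of rank at most one. (iii) There is a constant $C>0$ such that for every $s\in\mathcal M$ and $\xi_\alpha\in[T_s(\mathcal M)]^2$ $$\frac1C|\xi_\alpha|^p\le Tf^0_{\rm hom}(s,\xi_\alpha)\le C(1+|\xi_\alpha|^p).$$ Moreover, there is a constant $C>0$ such that for every $s\in\mathcal M$ and $\xi_\alpha,\xi_\alpha'\in[T_s(\mathcal M)]^2$ $$|Tf^0_{\rm hom}(s,\xi_\alpha)-Tf^0_{\rm hom}(s,\xi'_\alpha)|\le C|\xi_\alpha-\xi_\alpha'|\,(1+|\xi_\alpha|^{p-1}+|\xi_\alpha'|^{p-1}).$$ -/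

import Mathlib

open MeasureTheory Filter Topology
open scoped ContDiff

noncomputable section

/-- The Euclidean space `ℝ^k`. -/
abbrev Euc (k : ℕ) : Type := EuclideanSpace ℝ (Fin k)

/-- The space `ℝ^{3×k}` of matrices `ξ = [ξ_1|…|ξ_k]`, given by their `k` columns in `ℝ³` and
equipped with the Euclidean (Frobenius) norm `|ξ| = (∑ᵢⱼ ξᵢⱼ²)^{1/2}`; `ξ j` is the `j`-th column. -/
abbrev Cols (k : ℕ) : Type := PiLp 2 (fun _ : Fin k => Euc 3)

/-- `M ⊆ ℝ³` is a smooth embedded submanifold of dimension `d`, without boundary: around each of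
its points a smooth diffeomorphism between open sets of `ℝ³` flattens `M` to
`{y | y_i = 0 for all i ≥ d}`. -/
def IsSmoothSubmanifold (d : ℕ) (M : Set (Euc 3)) : Prop :=
  d ≤ 3 ∧ ∀ s ∈ M, ∃ Φ : OpenPartialHomeomorph (Euc 3) (Euc 3),
    s ∈ Φ.source ∧ ContDiffOn ℝ ∞ Φ Φ.source ∧ ContDiffOn ℝ ∞ Φ.symm Φ.target ∧
      ∀ x ∈ Φ.source, (x ∈ M ↔ ∀ i : Fin 3, d ≤ (i : ℕ) → Φ x i = 0)

/-- The tangent space `T_s(M)`: the velocities at `s` of the smooth curves in `M` through `s`.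
(For a smooth submanifold these velocities already form a linear subspace; the span only
records this linear structure.) -/
def tangentSpaceAt (M : Set (Euc 3)) (s : Euc 3) : Submodule ℝ (Euc 3) :=
  Submodule.span ℝ {v | ∃ (γ : ℝ → Euc 3) (ε : ℝ), 0 < ε ∧
    ContDiffOn ℝ ∞ γ (Set.Ioo (-ε) ε) ∧ (∀ r ∈ Set.Ioo (-ε) ε, γ r ∈ M) ∧
    γ 0 = s ∧ HasDerivAt γ v 0}

/-- `ξ ∈ [T]^k`: all columns of `ξ` lie in `T`. -/
def ColsIn {k : ℕ} (T : Submodule ℝ (Euc 3)) (ξ : Cols k) : Prop := ∀ j, ξ j ∈ T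

/-- The columnwise orthogonal projection of `ℝ^{3×3}` onto `[T]^3`. -/
def colsProj (T : Submodule ℝ (Euc 3)) (ξ : Cols 3) : Cols 3 :=
  WithLp.toLp 2 (fun j => T.starProjection (ξ j))

/-- Carathéodory functions `f : ℝ³ × ℝ^{3×3} → ℝ`: Lebesgue measurable in `x` for every `ξ`,
continuous in `ξ` for a.e. `x`. -/
def IsCaratheodoryFun (f : Euc 3 → Cols 3 → ℝ) : Prop :=
  (∀ ξ, AEMeasurable (fun x => f x ξ) volume) ∧ ∀ᵐ x ∂volume, Continuous (f x)

/-- `f` is `1`-periodic in the in-plane variables `x_α = (x_1, x_2)`. -/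
def IsInPlanePeriodic (f : Euc 3 → Cols 3 → ℝ) : Prop :=
  ∀ x ξ, f (x + EuclideanSpace.single 0 1) ξ = f x ξ ∧ f (x + EuclideanSpace.single 1 1) ξ = f x ξ

/-- `p`-growth and `p`-coercivity of the integrand. -/
def HasPGrowth (p : ℝ) (f : Euc 3 → Cols 3 → ℝ) : Prop :=
  ∃ α β : ℝ, 0 < α ∧ 0 < β ∧
    ∀ᵐ x ∂volume, ∀ ξ, α * ‖ξ‖ ^ p ≤ f x ξ ∧ f x ξ ≤ β * (1 + ‖ξ‖ ^ p)

/-- `G` is the weak gradient of `φ` on `U`: the column `G_j` is the weak derivative `∂_j φ`. -/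
def IsWeakGradient {k : ℕ} (U : Set (Euc k)) (φ : Euc k → Euc 3) (G : Euc k → Cols k) : Prop :=
  ∀ η : Euc k → ℝ, ContDiff ℝ ∞ η → HasCompactSupport η → tsupport η ⊆ U →
    ∀ j : Fin k, ∫ x in U, fderiv ℝ η x (EuclideanSpace.single j 1) • φ x
      = - ∫ x in U, η x • G x j

/-- `φ ∈ W^{1,∞}(U; ℝ³)` with weak gradient `∇φ = G`. -/
def MemW1Infty {k : ℕ} (U : Set (Euc k)) (φ : Euc k → Euc 3) (G : Euc k → Cols k) : Prop :=
  MemLp φ ⊤ (volume.restrict U) ∧ MemLp G ⊤ (volume.restrict U) ∧ IsWeakGradient U φ G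

/-- `φ ∈ W^{1,∞}(U; T)` with `∇φ = G`, and `φ = 0` everywhere on the part `Γ` of the boundary of
`U`. Here `φ` is the continuous representative, extended continuously to `U ∪ Γ`. -/
def IsTestField {k : ℕ} (U Γ : Set (Euc k)) (T : Submodule ℝ (Euc 3))
    (φ : Euc k → Euc 3) (G : Euc k → Cols k) : Prop :=
  MemW1Infty U φ G ∧ (∀ x ∈ U, φ x ∈ T) ∧ ContinuousOn φ (U ∪ Γ) ∧ ∀ x ∈ Γ, φ x = 0

/-- The open square `tQ' = (-t/2, t/2)²`. -/
def square (t : ℝ) : Set (Euc 2) := {y | ∀ i, |y i| < t / 2}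

/-- The in-plane part `x_α = (x_1, x_2)` of `x = (x_α, x_3)`. -/
def inPlane (x : Euc 3) : Euc 2 := !₂[x 0, x 1]

/-- The open box `(tQ')_{,1} = tQ' × (-1/2, 1/2)`. -/
def box (t : ℝ) : Set (Euc 3) := {x | inPlane x ∈ square t ∧ |x 2| < 1 / 2}

/-- The lateral boundary `∂(tQ') × (-1/2, 1/2)`. -/
def lateralBdry (t : ℝ) : Set (Euc 3) := {x | inPlane x ∈ frontier (square t) ∧ |x 2| < 1 / 2}

/-- `(ξ_α + ∇_α φ | ∇_3 φ)`, where `G` is the value of `∇φ = [∇_α φ|∇_3 φ]`. -/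
def shiftedGradient (ξ : Cols 2) (G : Cols 3) : Cols 3 :=
  WithLp.toLp 2 ![ξ 0 + G 0, ξ 1 + G 1, G 2]

/-- The infimum of `t⁻² ∫_{(tQ')_{,1}} g(x, ξ_α + ∇_α φ | ∇_3 φ) dx` over all
`φ ∈ W^{1,∞}((tQ')_{,1}; T)` that vanish on `∂(tQ') × (-1/2, 1/2)`. -/
def cellInf (g : Euc 3 → Cols 3 → ℝ) (T : Submodule ℝ (Euc 3)) (t : ℝ) (ξ : Cols 2) : ℝ :=
  sInf {r | ∃ (φ : Euc 3 → Euc 3) (G : Euc 3 → Cols 3),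
    IsTestField (box t) (lateralBdry t) T φ G ∧
      r = 1 / t ^ 2 * ∫ x in box t, g x (shiftedGradient ξ (G x))}

/-- The tangential homogenized density `Tf⁰_hom(s, ξ_α)`. -/
def tangentialHom (f : Euc 3 → Cols 3 → ℝ) (M : Set (Euc 3)) (s : Euc 3) (ξ : Cols 2) : ℝ :=
  liminf (fun t : ℝ => cellInf f (tangentSpaceAt M s) t ξ) atTop

/-- The penalized integrand `f̄(x, s, ξ) = f(x, P_s ξ) + |ξ - P_s ξ|^p`, for fixed `s`. -/
def penalized (p : ℝ) (f : Euc 3 → Cols 3 → ℝ) (M : Set (Euc 3)) (s : Euc 3)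
    (x : Euc 3) (ξ : Cols 3) : ℝ :=
  f x (colsProj (tangentSpaceAt M s) ξ) + ‖ξ - colsProj (tangentSpaceAt M s) ξ‖ ^ p

/-- The unconstrained cell infima of `f̄(·, s, ·)` over `W^{1,∞}((tQ')_{,1}; ℝ³)`. -/
def penalizedCellInf (p : ℝ) (f : Euc 3 → Cols 3 → ℝ) (M : Set (Euc 3)) (s : Euc 3)
    (ξ : Cols 2) (t : ℝ) : ℝ :=
  cellInf (penalized p f M s) ⊤ t ξ

/-- The unconstrained 3D-2D homogenized density `f̄⁰_hom(s, ξ_α)`, the limit as `t → +∞` (a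
meaningful value only when the limit exists). -/
def penalizedHom (p : ℝ) (f : Euc 3 → Cols 3 → ℝ) (M : Set (Euc 3)) (s : Euc 3) (ξ : Cols 2) : ℝ :=
  limUnder atTop (penalizedCellInf p f M s ξ)

/-- Tangential quasiconvexity on `[T]²`: for all `ξ ∈ [T]²` and `ψ ∈ W^{1,∞}_0(Q'; T)`, the
function `h(ξ + ∇ψ)` is integrable on `Q'` and `h(ξ) ≤ ∫_{Q'} h(ξ + ∇ψ)`. -/
def IsTangentiallyQuasiconvex (T : Submodule ℝ (Euc 3)) (h : Cols 2 → ℝ) : Prop :=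
  ∀ ξ, ColsIn T ξ → ∀ (ψ : Euc 2 → Euc 3) (G : Euc 2 → Cols 2),
    IsTestField (square 1) (frontier (square 1)) T ψ G →
      IntegrableOn (fun y => h (ξ + G y)) (square 1) ∧ h ξ ≤ ∫ y in square 1, h (ξ + G y)

/-- Rank-one convexity on `[T]²`: convexity along every segment in `[T]²` whose endpoints differ
by a matrix `a ⊗ b` of rank at most one. -/
def IsRankOneConvex (T : Submodule ℝ (Euc 3)) (h : Cols 2 → ℝ) : Prop :=
  ∀ ξ ξ' : Cols 2, ColsIn T ξ → ColsIn T ξ' →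
    (∃ (a : Euc 3) (b : Euc 2), ∀ j, ξ j - ξ' j = b j • a) →
    ∀ r : ℝ, 0 ≤ r → r ≤ 1 → h (r • ξ + (1 - r) • ξ') ≤ r * h ξ + (1 - r) * h ξ'

end

/-! Everything is proved for a fixed linear subspace `T` in the role of the tangent space. All
constants depend only on `p`, `α`, `β` and an absolute cutoff constant, so the estimates are uniform
in `s`.

The penalization is harmless. The projection onto `T` commutes with the weak gradient, so projecting
a field gives an admissible tangential competitor and removes the penalty; conversely, a `T`-valued
field has gradient columns in `T` a.e. and pays no penalty. Hence the two cell infima agree for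
every `t` (`penalizedCellInf_eq`), and it remains to study `cellHom f T`.

The limit exists because `f` is periodic in the plane: integer translates of a nearly optimal field
on a square of side `t` fill any much larger square up to a small fraction of its area, where the
growth bound applies (`exists_filling`, `tendsto_cellInf`). Translating and summing fields requires
their extension by zero across the lateral boundary (`MemW1Infty.indicator`).

The central inequality is `cellHom_le_of_squares`. If a smooth compactly supported `W` has constant
gradient `η i` on disjoint squares, then after blowing up the picture one inserts nearly optimal
fields for `ξ + η i` in these squares and pays only the growth bound elsewhere. In
`cellHom_le_of_patches` an arbitrary smooth field is made affine on squares by cutoffs. Two choices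
of patches give the main results. A single square with a thin collar gives the local Lipschitz
estimate (`cellHom_sub_le`). A fine grid with first-order Taylor polynomials gives quasiconvexity
for smooth test fields (`cellHom_quasiconvex_approx`); mollification and the continuity of `cellHom`
extend it to Lipschitz test fields.

Rank-one convexity follows by testing quasiconvexity with plane waves and averaging over the phase
(`cellHom_le_cos_average`): along a rank-one line, `cellHom` lies below its averages over `x + A cos
τ`, and a continuous function with this property is convex (`le_chord_of_le_cos_average`).
Coercivity is Jensen's inequality, since the in-plane gradient of a test field has mean zero
(`IsStripField.rpow_norm_le`). -/

/-! ### Smooth cutoffs on boxes -/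

/-- A smooth function of one variable, equal to `1` on `[-b, b]` and to `0` off `(-b-d, b+d)`. -/
noncomputable def plateau (b d s : ℝ) : ℝ :=
  Real.smoothTransition ((b + d - s) / d) * Real.smoothTransition ((b + d + s) / d)

theorem plateau_contDiff (b d : ℝ) : ContDiff ℝ ∞ (plateau b d) := by
  unfold plateau
  exact (Real.smoothTransition.contDiff.comp (by fun_prop)).mul
    (Real.smoothTransition.contDiff.comp (by fun_prop))

theorem plateau_nonneg (b d s : ℝ) : 0 ≤ plateau b d s :=
  mul_nonneg (Real.smoothTransition.nonneg _) (Real.smoothTransition.nonneg _)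

theorem plateau_le_one (b d s : ℝ) : plateau b d s ≤ 1 :=
  mul_le_one₀ (Real.smoothTransition.le_one _) (Real.smoothTransition.nonneg _)
    (Real.smoothTransition.le_one _)

theorem plateau_eq_one {b d s : ℝ} (hd : 0 < d) (hs : |s| ≤ b) : plateau b d s = 1 := by
  have := abs_le.1 hs
  unfold plateau
  rw [Real.smoothTransition.one_of_one_le, Real.smoothTransition.one_of_one_le, mul_one]
  · rw [le_div_iff₀ hd]; linarith
  · rw [le_div_iff₀ hd]; linarith

theorem plateau_eq_zero {b d s : ℝ} (hd : 0 < d) (hs : b + d ≤ |s|) : plateau b d s = 0 := by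
  unfold plateau
  rcases le_abs'.1 hs with h | h
  · rw [Real.smoothTransition.zero_of_nonpos (x := (b + d + s) / d), mul_zero]
    exact div_nonpos_of_nonpos_of_nonneg (by linarith) hd.le
  · rw [Real.smoothTransition.zero_of_nonpos (x := (b + d - s) / d), zero_mul]
    exact div_nonpos_of_nonpos_of_nonneg (by linarith) hd.le

/-- At each of these points, endpoints included, the cutoff attains its global maximum `1` or its
global minimum `0`. -/
theorem deriv_plateau_eq_zero {b d s : ℝ} (hd : 0 < d) (hs : |s| ≤ b ∨ b + d ≤ |s|) :
    deriv (plateau b d) s = 0 := by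
  rcases hs with h | h
  · apply IsLocalMax.deriv_eq_zero
    exact Filter.Eventually.of_forall fun x => by
      rw [plateau_eq_one hd h]; exact plateau_le_one _ _ _
  · apply IsLocalMin.deriv_eq_zero
    exact Filter.Eventually.of_forall fun x => by
      rw [plateau_eq_zero hd h]; exact plateau_nonneg _ _ _

theorem exists_deriv_smoothTransition_bound :
    ∃ C : ℝ, 0 < C ∧ ∀ x, |deriv Real.smoothTransition x| ≤ C := by
  have hc : Continuous (deriv Real.smoothTransition) :=
    (Real.smoothTransition.contDiff (n := 1)).continuous_deriv (by simp)
  obtain ⟨C, hC⟩ := (isCompact_Icc (a := (0 : ℝ)) (b := 1)).exists_bound_of_continuousOn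
    hc.continuousOn
  refine ⟨max C 1, by positivity, fun x => ?_⟩
  by_cases hx : x ∈ Set.Icc (0 : ℝ) 1
  · exact (hC x hx).trans (le_max_left _ _)
  · have : deriv Real.smoothTransition x = 0 := by
      rw [Set.mem_Icc, not_and_or, not_le, not_le] at hx
      rcases hx with h | h
      · apply IsLocalMin.deriv_eq_zero
        exact Filter.Eventually.of_forall fun y => by
          rw [Real.smoothTransition.zero_of_nonpos h.le]; exact Real.smoothTransition.nonneg _
      · apply IsLocalMax.deriv_eq_zero
        exact Filter.Eventually.of_forall fun y => by
          rw [Real.smoothTransition.one_of_one_le h.le]; exact Real.smoothTransition.le_one _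
    rw [this, abs_zero]; positivity

/-- A single constant serves all `b` and `d`. The rate `1 / d` matters later: it is always
multiplied by the size of a field on the collar, and that size is arranged to be of order `d`. -/
theorem exists_deriv_plateau_bound :
    ∃ C : ℝ, 0 < C ∧ ∀ b d s : ℝ, 0 < d → |deriv (plateau b d) s| ≤ C / d := by
  obtain ⟨C, hC, h⟩ := exists_deriv_smoothTransition_bound
  refine ⟨2 * C, by positivity, fun b d s hd => ?_⟩
  have hσ : Differentiable ℝ Real.smoothTransition :=
    (Real.smoothTransition.contDiff (n := 1)).differentiable (by simp)
  have h1 : HasDerivAt (fun s => Real.smoothTransition ((b + d - s) / d))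
      (deriv Real.smoothTransition ((b + d - s) / d) * (-1 / d)) s :=
    (hσ _).hasDerivAt.comp s (((hasDerivAt_id s).const_sub (b + d)).div_const d)
  have h2 : HasDerivAt (fun s => Real.smoothTransition ((b + d + s) / d))
      (deriv Real.smoothTransition ((b + d + s) / d) * (1 / d)) s :=
    (hσ _).hasDerivAt.comp s (((hasDerivAt_id s).const_add (b + d)).div_const d)
  have h3 : HasDerivAt (plateau b d) _ s := h1.mul h2
  rw [h3.deriv]
  refine (abs_add_le _ _).trans ?_
  have e1 : ∀ u v : ℝ, |deriv Real.smoothTransition u * (v / d) *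
      Real.smoothTransition ((b + d + s) / d)| ≤ C * (|v| / d) := fun u v => by
    rw [abs_mul, abs_mul, abs_div, abs_of_pos hd,
      abs_of_nonneg (Real.smoothTransition.nonneg ((b + d + s) / d))]
    calc _ ≤ C * (|v| / d) * 1 := by
          gcongr
          · exact Real.smoothTransition.nonneg _
          · exact h u
          · exact Real.smoothTransition.le_one _
      _ = _ := mul_one _
  have e2 : ∀ u v : ℝ, |Real.smoothTransition ((b + d - s) / d) *
      (deriv Real.smoothTransition u * (v / d))| ≤ C * (|v| / d) := fun u v => by
    rw [abs_mul, abs_mul, abs_div, abs_of_pos hd,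
      abs_of_nonneg (Real.smoothTransition.nonneg ((b + d - s) / d))]
    calc _ ≤ 1 * (C * (|v| / d)) := by
          gcongr
          · exact Real.smoothTransition.le_one _
          · exact h u
      _ = _ := one_mul _
  refine (add_le_add (e1 _ _) (e2 _ _)).trans (le_of_eq ?_)
  simp only [abs_neg, abs_one]
  ring

/-- The product of the cutoffs `plateau (b i) (d i)` in the coordinates `i ∈ J`. -/
noncomputable def boxCutoff {k : ℕ} (J : Finset (Fin k)) (b d : Fin k → ℝ) (x : Euc k) : ℝ :=
  ∏ i ∈ J, plateau (b i) (d i) (x i)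

section boxCutoff

variable {k : ℕ} {J : Finset (Fin k)} {b d : Fin k → ℝ} {x : Euc k}

theorem boxCutoff_contDiff (J : Finset (Fin k)) (b d : Fin k → ℝ) :
    ContDiff ℝ ∞ (boxCutoff J b d) := by
  unfold boxCutoff
  refine contDiff_prod fun i _ => (plateau_contDiff _ _).comp ?_
  fun_prop

theorem boxCutoff_nonneg : 0 ≤ boxCutoff J b d x :=
  Finset.prod_nonneg fun _ _ => plateau_nonneg _ _ _

theorem boxCutoff_le_one : boxCutoff J b d x ≤ 1 :=
  Finset.prod_le_one (fun _ _ => plateau_nonneg _ _ _) fun _ _ => plateau_le_one _ _ _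

theorem boxCutoff_eq_one (hd : ∀ i, 0 < d i) (h : ∀ i ∈ J, |x i| ≤ b i) :
    boxCutoff J b d x = 1 :=
  Finset.prod_eq_one fun i hi => plateau_eq_one (hd i) (h i hi)

theorem boxCutoff_eq_zero (hd : ∀ i, 0 < d i) {i : Fin k} (hi : i ∈ J) (h : b i + d i ≤ |x i|) :
    boxCutoff J b d x = 0 :=
  Finset.prod_eq_zero hi (plateau_eq_zero (hd i) h)

theorem fderiv_boxCutoff_single (x : Euc k) (j : Fin k) :
    fderiv ℝ (boxCutoff J b d) x (EuclideanSpace.single j 1) =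
      if j ∈ J then deriv (plateau (b j) (d j)) (x j) *
        ∏ i ∈ J.erase j, plateau (b i) (d i) (x i) else 0 := by
  have hdiff : DifferentiableAt ℝ (boxCutoff J b d) x :=
    (boxCutoff_contDiff J b d).differentiable (by simp) x
  have hγ : HasDerivAt (fun s : ℝ => x + s • (EuclideanSpace.single j (1 : ℝ) : Euc k))
      (EuclideanSpace.single j (1 : ℝ)) 0 := by
    simpa using ((hasDerivAt_id (0 : ℝ)).smul_const
      (EuclideanSpace.single j (1 : ℝ) : Euc k)).const_add x
  have h1 : HasDerivAt (fun s : ℝ => boxCutoff J b d (x + s • EuclideanSpace.single j (1 : ℝ)))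
      (fderiv ℝ (boxCutoff J b d) x (EuclideanSpace.single j 1)) 0 := by
    have : HasFDerivAt (boxCutoff J b d) (fderiv ℝ (boxCutoff J b d) x)
        (x + (0 : ℝ) • (EuclideanSpace.single j (1 : ℝ) : Euc k)) := by
      simpa using hdiff.hasFDerivAt
    exact this.comp_hasDerivAt 0 hγ
  refine h1.unique ?_
  split_ifs with hj
  · have e : (fun s : ℝ => boxCutoff J b d (x + s • EuclideanSpace.single j (1 : ℝ))) =
        fun s => plateau (b j) (d j) (x j + s) * ∏ i ∈ J.erase j, plateau (b i) (d i) (x i) := by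
      funext s
      rw [boxCutoff, ← Finset.mul_prod_erase J _ hj]
      congr 1
      · simp
      · refine Finset.prod_congr rfl fun i hi => ?_
        simp [(Finset.ne_of_mem_erase hi)]
    rw [e]
    refine HasDerivAt.mul_const ?_ _
    have : HasDerivAt (plateau (b j) (d j)) (deriv (plateau (b j) (d j)) (x j)) (x j + 0) := by
      rw [add_zero]
      exact ((plateau_contDiff _ _).differentiable (by simp) _).hasDerivAt
    simpa using this.comp_const_add (x j) 0
  · have e : (fun s : ℝ => boxCutoff J b d (x + s • EuclideanSpace.single j (1 : ℝ))) =
        fun s => boxCutoff J b d x := by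
      funext s
      refine Finset.prod_congr rfl fun i hi => ?_
      have : i ≠ j := fun h => hj (h ▸ hi)
      simp [this]
    rw [e]
    exact hasDerivAt_const _ _

theorem fderiv_boxCutoff_single_eq_zero (hd : ∀ i, 0 < d i) {j : Fin k}
    (h : j ∈ J → |x j| ≤ b j ∨ b j + d j ≤ |x j|) :
    fderiv ℝ (boxCutoff J b d) x (EuclideanSpace.single j 1) = 0 := by
  rw [fderiv_boxCutoff_single]
  split_ifs with hj
  · rw [deriv_plateau_eq_zero (hd j) (h hj), zero_mul]
  · rfl

theorem exists_fderiv_boxCutoff_bound :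
    ∃ C : ℝ, 0 < C ∧ ∀ (k : ℕ) (J : Finset (Fin k)) (b d : Fin k → ℝ) (x : Euc k) (j : Fin k),
      (∀ i, 0 < d i) →
        |fderiv ℝ (boxCutoff J b d) x (EuclideanSpace.single j 1)| ≤ C / d j := by
  obtain ⟨C, hC, h⟩ := exists_deriv_plateau_bound
  refine ⟨C, hC, fun k J b d x j hd => ?_⟩
  have hdj := hd j
  rw [fderiv_boxCutoff_single]
  split_ifs with hj
  · have h0 : 0 ≤ ∏ i ∈ J.erase j, plateau (b i) (d i) (x i) :=
      Finset.prod_nonneg fun _ _ => plateau_nonneg _ _ _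
    have h1 : ∏ i ∈ J.erase j, plateau (b i) (d i) (x i) ≤ 1 :=
      Finset.prod_le_one (fun _ _ => plateau_nonneg _ _ _) fun _ _ => plateau_le_one _ _ _
    rw [abs_mul, abs_of_nonneg h0]
    calc _ ≤ C / d j * 1 := by gcongr; exact h _ _ _ hdj
      _ = _ := mul_one _
  · rw [abs_zero]; positivity

theorem tsupport_boxCutoff_subset (hd : ∀ i, 0 < d i) :
    tsupport (boxCutoff J b d) ⊆ {x : Euc k | ∀ i ∈ J, |x i| ≤ b i + d i} := by
  refine closure_minimal (fun x hx i hi => ?_) ?_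
  · by_contra! h
    exact hx (boxCutoff_eq_zero hd hi h.le)
  · have : {x : Euc k | ∀ i ∈ J, |x i| ≤ b i + d i} =
        ⋂ i ∈ J, {x : Euc k | |x i| ≤ b i + d i} := by ext; simp
    rw [this]
    exact isClosed_biInter fun i _ => isClosed_le (by fun_prop) continuous_const

end boxCutoff

theorem volume_coordSet {k : ℕ} (s : Fin k → Set ℝ) (hs : ∀ i, MeasurableSet (s i)) :
    volume {x : Euc k | ∀ i, x i ∈ s i} = ∏ i, volume (s i) := by
  rw [← volume_pi_pi, ← (PiLp.volume_preserving_toLp (Fin k)).measure_preimage]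
  · congr 1
    ext x
    simp
  · refine MeasurableSet.nullMeasurableSet ?_
    simp only [Set.ofPred_forall]
    exact MeasurableSet.iInter fun i =>
      (by fun_prop : Measurable fun x : Euc k => x i) (hs i)

/-! ### Calculus of weak gradients -/

section weakGradient

variable {k : ℕ} {U V : Set (Euc k)} {φ φ' : Euc k → Euc 3} {G G' : Euc k → Cols k}

theorem integrable_smul_of_hasCompactSupport {E : Type*} [NormedAddCommGroup E] [NormedSpace ℝ E]
    {η : Euc k → ℝ} (hη : Continuous η) (hs : HasCompactSupport η) {φ : Euc k → E}
    (hφ : MemLp φ ⊤ (volume.restrict U)) :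
    IntegrableOn (fun x => η x • φ x) U :=
  (hη.integrable_of_hasCompactSupport hs).integrableOn.smul_of_top_left hφ

theorem continuous_fderiv_apply {η : Euc k → ℝ} (hη : ContDiff ℝ ∞ η) (v : Euc k) :
    Continuous fun x => fderiv ℝ η x v :=
  (hη.continuous_fderiv (by simp)).clm_apply continuous_const

theorem hasCompactSupport_fderiv_apply {η : Euc k → ℝ} (hs : HasCompactSupport η) (v : Euc k) :
    HasCompactSupport fun x => fderiv ℝ η x v :=
  (hs.fderiv ℝ).comp_left (g := fun L : Euc k →L[ℝ] ℝ => L v) (by simp)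

theorem fderiv_apply_eq_zero_of_notMem_tsupport {E : Type*} [NormedAddCommGroup E]
    [NormedSpace ℝ E] {η : Euc k → E} {x : Euc k}
    (hx : x ∉ tsupport η) (v : Euc k) : fderiv ℝ η x v = 0 := by
  have : fderiv ℝ η x = 0 := by
    by_contra h
    exact hx (support_fderiv_subset ℝ h)
  rw [this]; rfl

theorem memLp_top_col {E : Type*} [MeasurableSpace E] {μ : Measure E} {G : E → Cols k}
    (hG : MemLp G ⊤ μ) (j : Fin k) : MemLp (fun x => G x j) ⊤ μ :=
  (PiLp.proj (𝕜 := ℝ) 2 (fun _ : Fin k => Euc 3) j).comp_memLp' hG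

theorem IsWeakGradient.mono (h : IsWeakGradient V φ G) (hUV : U ⊆ V)
    (hV : MeasurableSet V) : IsWeakGradient U φ G := by
  intro η hη hs ht j
  have e1 := setIntegral_eq_of_subset_of_forall_sdiff_eq_zero (μ := volume) hV hUV
    (f := fun x => fderiv ℝ η x (EuclideanSpace.single j 1) • φ x) fun x hx => by
      rw [fderiv_apply_eq_zero_of_notMem_tsupport (fun h => hx.2 (ht h)), zero_smul]
  have e2 := setIntegral_eq_of_subset_of_forall_sdiff_eq_zero (μ := volume) hV hUV
    (f := fun x => η x • G x j) fun x hx => by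
      rw [image_eq_zero_of_notMem_tsupport (fun h => hx.2 (ht h)), zero_smul]
  rw [← e1, ← e2]
  exact h η hη hs (ht.trans hUV) j

theorem MemW1Infty.mono (h : MemW1Infty V φ G) (hUV : U ⊆ V) (hV : MeasurableSet V) :
    MemW1Infty U φ G :=
  ⟨h.1.mono_measure (Measure.restrict_mono hUV le_rfl),
    h.2.1.mono_measure (Measure.restrict_mono hUV le_rfl), h.2.2.mono hUV hV⟩

theorem MemW1Infty.add (h : MemW1Infty U φ G) (h' : MemW1Infty U φ' G') :
    MemW1Infty U (fun x => φ x + φ' x) (fun x => G x + G' x) := by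
  refine ⟨h.1.add h'.1, h.2.1.add h'.2.1, fun η hη hs ht j => ?_⟩
  have c1 := continuous_fderiv_apply hη (EuclideanSpace.single j 1)
  have s1 := hasCompactSupport_fderiv_apply hs (EuclideanSpace.single j 1)
  simp only [smul_add, PiLp.add_apply]
  rw [integral_add (integrable_smul_of_hasCompactSupport c1 s1 h.1)
    (integrable_smul_of_hasCompactSupport c1 s1 h'.1),
    integral_add (integrable_smul_of_hasCompactSupport hη.continuous hs (memLp_top_col h.2.1 j))
    (integrable_smul_of_hasCompactSupport hη.continuous hs (memLp_top_col h'.2.1 j)),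
    h.2.2 η hη hs ht j, h'.2.2 η hη hs ht j]
  abel

theorem memW1Infty_zero : MemW1Infty U (fun _ => 0) (fun _ => 0) := by
  refine ⟨MemLp.zero', MemLp.zero', fun η hη hs ht j => ?_⟩
  simp

theorem MemW1Infty.sum {ι : Type*} (s : Finset ι) {φ : ι → Euc k → Euc 3} {G : ι → Euc k → Cols k}
    (h : ∀ i ∈ s, MemW1Infty U (φ i) (G i)) :
    MemW1Infty U (fun x => ∑ i ∈ s, φ i x) (fun x => ∑ i ∈ s, G i x) := by
  classical
  induction s using Finset.induction_on with
  | empty => simpa using memW1Infty_zero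
  | insert i s hi ih =>
    simp only [Finset.sum_insert hi]
    exact (h i (Finset.mem_insert_self _ _)).add
      (ih fun j hj => h j (Finset.mem_insert_of_mem hj))

/-- The linear map `A` applied to each column. -/
noncomputable def colsMap {k : ℕ} (A : Euc 3 →L[ℝ] Euc 3) : Cols k →L[ℝ] Cols k :=
  (PiLp.continuousLinearEquiv 2 ℝ fun _ : Fin k => Euc 3).symm.toContinuousLinearMap.comp
    (ContinuousLinearMap.pi fun j => A.comp (PiLp.proj (𝕜 := ℝ) 2 (fun _ : Fin k => Euc 3) j))

theorem colsMap_apply (A : Euc 3 →L[ℝ] Euc 3) (ξ : Cols k) (j : Fin k) :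
    colsMap A ξ j = A (ξ j) := rfl

theorem MemW1Infty.clm (h : MemW1Infty U φ G) (A : Euc 3 →L[ℝ] Euc 3) :
    MemW1Infty U (fun x => A (φ x)) (fun x => colsMap A (G x)) := by
  refine ⟨A.comp_memLp' h.1, (colsMap A).comp_memLp' h.2.1, fun η hη hs ht j => ?_⟩
  have c1 := continuous_fderiv_apply hη (EuclideanSpace.single j 1)
  have s1 := hasCompactSupport_fderiv_apply hs (EuclideanSpace.single j 1)
  simp only [colsMap_apply, ← map_smul]
  rw [A.integral_comp_comm (integrable_smul_of_hasCompactSupport c1 s1 h.1),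
    A.integral_comp_comm
      (integrable_smul_of_hasCompactSupport hη.continuous hs (memLp_top_col h.2.1 j)),
    h.2.2 η hη hs ht j, map_neg]

/-- The projection `P` onto `T` satisfies `P φ = φ` on `U`, so `G` and `P G` are both weak gradients
of `φ`. Their difference is annihilated by all test functions and vanishes a.e. -/
theorem MemW1Infty.ae_colsIn (h : MemW1Infty U φ G) (hU : IsOpen U)
    {T : Submodule ℝ (Euc 3)} (hT : ∀ x ∈ U, φ x ∈ T) :
    ∀ᵐ x ∂volume, x ∈ U → ColsIn T (G x) := by
  have hcol : ∀ j, ∀ᵐ x ∂volume, x ∈ U → G x j - T.starProjection (G x j) = 0 := fun j => by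
    have hm : MemLp (fun x => G x j - T.starProjection (G x j)) ⊤ (volume.restrict U) :=
      (memLp_top_col h.2.1 j).sub (T.starProjection.comp_memLp' (memLp_top_col h.2.1 j))
    refine hU.ae_eq_zero_of_integral_contDiff_smul_eq_zero ?_ ?_
    · rw [locallyIntegrableOn_iff hU.isLocallyClosed]
      intro K hKU hK
      have : IsFiniteMeasure (volume.restrict K) := ⟨by simpa using hK.measure_lt_top⟩
      exact (hm.mono_measure (Measure.restrict_mono hKU le_rfl)).integrable le_top
    · intro η hη hs ht
      have e : ∫ x, η x • (G x j - T.starProjection (G x j)) =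
          ∫ x in U, η x • (G x j - T.starProjection (G x j)) := by
        refine (setIntegral_eq_integral_of_forall_compl_eq_zero fun x hx => ?_).symm
        rw [image_eq_zero_of_notMem_tsupport (fun h => hx (ht h)), zero_smul]
      rw [e]
      simp only [smul_sub]
      have h2 := (h.clm T.starProjection).2.2 η hη hs ht j
      rw [integral_sub
        (integrable_smul_of_hasCompactSupport hη.continuous hs (memLp_top_col h.2.1 j))
        (integrable_smul_of_hasCompactSupport (φ := fun x => T.starProjection (G x j))
          hη.continuous hs (T.starProjection.comp_memLp' (memLp_top_col h.2.1 j)))]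
      have h3 := h.2.2 η hη hs ht j
      have h4 : ∫ x in U, fderiv ℝ η x (EuclideanSpace.single j 1) • T.starProjection (φ x) =
          ∫ x in U, fderiv ℝ η x (EuclideanSpace.single j 1) • φ x :=
        setIntegral_congr_fun hU.measurableSet fun x hx => by
          simp only [Submodule.starProjection_eq_self_iff.2 (hT x hx)]
      rw [h4, h3] at h2
      simp only [colsMap_apply] at h2
      rw [neg_inj.1 h2, sub_self]
  filter_upwards [ae_all_iff.2 hcol] with x hx hxU j
  exact Submodule.starProjection_eq_self_iff.1 (sub_eq_zero.1 (hx j hxU)).symm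

/-- The matrix of partial derivatives of `w`. -/
noncomputable def colGrad (w : Euc k → Euc 3) (x : Euc k) : Cols k :=
  WithLp.toLp 2 fun j => fderiv ℝ w x (EuclideanSpace.single j 1)

theorem colGrad_apply (w : Euc k → Euc 3) (x : Euc k) (j : Fin k) :
    colGrad w x j = fderiv ℝ w x (EuclideanSpace.single j 1) := rfl

theorem continuous_colGrad {w : Euc k → Euc 3} (hw : ContDiff ℝ 1 w) :
    Continuous (colGrad w) := by
  unfold colGrad
  refine (PiLp.continuous_toLp 2 _).comp (continuous_pi fun j => ?_)
  exact (hw.continuous_fderiv (by simp)).clm_apply continuous_const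

theorem isWeakGradient_colGrad {w : Euc k → Euc 3} (hw : ContDiff ℝ 1 w) :
    IsWeakGradient U w (colGrad w) := by
  intro η hη hs ht j
  have c1 := continuous_fderiv_apply hη (EuclideanSpace.single j 1)
  have s1 := hasCompactSupport_fderiv_apply hs (EuclideanSpace.single j 1)
  have c2 : Continuous fun x => fderiv ℝ w x (EuclideanSpace.single j 1) :=
    (hw.continuous_fderiv (by simp)).clm_apply continuous_const
  rw [setIntegral_eq_integral_of_forall_compl_eq_zero fun x hx => by
      rw [fderiv_apply_eq_zero_of_notMem_tsupport (fun h => hx (ht h)), zero_smul],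
    setIntegral_eq_integral_of_forall_compl_eq_zero fun x hx => by
      rw [image_eq_zero_of_notMem_tsupport (fun h => hx (ht h)), zero_smul]]
  have := integral_smul_fderiv_eq_neg_fderiv_smul_of_integrable (μ := (volume : Measure (Euc k)))
    (f := η) (g := w) (v := EuclideanSpace.single j 1)
    ((c1.smul hw.continuous).integrable_of_hasCompactSupport s1.smul_right)
    ((hη.continuous.smul c2).integrable_of_hasCompactSupport hs.smul_right)
    ((hη.continuous.smul hw.continuous).integrable_of_hasCompactSupport hs.smul_right)
    (fun x _ => hη.differentiable (by simp) x) (fun x _ => hw.differentiable (by simp) x)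
  simp only [colGrad_apply]
  rw [this, neg_neg]

theorem MemW1Infty.translate (h : MemW1Infty U φ G) (v : Euc k)
    (hU : ∀ x, x - v ∈ U ↔ x ∈ U) (hm : MeasurableSet U) :
    MemW1Infty U (fun x => φ (x - v)) (fun x => G (x - v)) := by
  have hmp : MeasurePreserving (fun x => x - v) (volume.restrict U) (volume.restrict U) := by
    have := (measurePreserving_sub_right (volume : Measure (Euc k)) v).restrict_preimage hm
    have e : (fun x => x - v) ⁻¹' U = U := by ext x; exact hU x
    rwa [e] at this
  have hemb : MeasurableEmbedding fun x : Euc k => x - v :=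
    (Homeomorph.subRight v).measurableEmbedding
  refine ⟨h.1.comp_measurePreserving hmp, h.2.1.comp_measurePreserving hmp,
    fun η hη hs ht j => ?_⟩
  have hη' : ContDiff ℝ ∞ fun x => η (x + v) := hη.comp (contDiff_id.add contDiff_const)
  have hs' : HasCompactSupport fun x => η (x + v) :=
    hs.comp_homeomorph (Homeomorph.addRight v)
  have ht' : tsupport (fun x => η (x + v)) ⊆ U := by
    intro x hx
    have : x + v ∈ tsupport η :=
      (Set.ext_iff.mp (tsupport_comp_eq_preimage η (Homeomorph.addRight v)) x).mp hx
    have := (hU _).2 (ht this)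
    simpa using this
  have key := h.2.2 _ hη' hs' ht' j
  have e1 := hmp.integral_comp hemb
    fun x => fderiv ℝ (fun x => η (x + v)) x (EuclideanSpace.single j 1) • φ x
  have e2 := hmp.integral_comp hemb fun x => η (x + v) • G x j
  rw [← e1, ← e2] at key
  simpa only [fderiv_comp_add_right, sub_add_cancel] using key

end weakGradient

/-! ### Extension by zero across faces of a box -/

theorem continuousOn_indicator_of_frontier {X : Type*} [TopologicalSpace X]
    {E : Type*} [TopologicalSpace E] [Zero E]
    {U V Γ : Set X} {φ : X → E} (hU : IsOpen U) (hUV : V ∩ frontier U ⊆ Γ)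
    (hc : ContinuousOn φ (U ∪ Γ)) (h0 : ∀ x ∈ Γ, φ x = 0) :
    ContinuousOn (U.indicator φ) V := by
  classical
  have : U.indicator φ = U.piecewise φ 0 := by
    ext x; simp [Set.indicator, Set.piecewise]
  rw [this]
  refine ContinuousOn.piecewise (fun a ha => by simpa using h0 a (hUV ha)) ?_ continuousOn_const
  refine hc.mono fun x hx => ?_
  by_cases hxU : x ∈ U
  · exact Or.inl hxU
  · refine Or.inr (hUV ⟨hx.1, ?_⟩)
    rw [hU.frontier_eq]
    exact ⟨hx.2, hxU⟩

/-- The part of the box `∏ (-a i, a i)` within `2δ` of the two faces orthogonal to `e_j`. -/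
def faceLayer {k : ℕ} (a : Fin k → ℝ) (j : Fin k) (δ : ℝ) : Set (Euc k) :=
  {x | ∀ i, x i ∈ if i = j then {s : ℝ | a j - 2 * δ ≤ |s| ∧ |s| < a j} else Set.Ioo (-a i) (a i)}

theorem volume_faceLayer_le {k : ℕ} {a : Fin k → ℝ} (j : Fin k) {δ : ℝ} (hδ : 0 ≤ δ) :
    volume (faceLayer a j δ) ≤
      ENNReal.ofReal (4 * δ) * ∏ i ∈ Finset.univ.erase j, ENNReal.ofReal (2 * a i) := by
  unfold faceLayer
  have hm : MeasurableSet {s : ℝ | a j - 2 * δ ≤ |s| ∧ |s| < a j} :=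
    (measurableSet_le measurable_const measurable_norm).inter
      (measurableSet_lt measurable_norm measurable_const)
  rw [volume_coordSet _ fun i => by
      split_ifs
      · exact hm
      · exact measurableSet_Ioo,
    ← Finset.mul_prod_erase _ _ (Finset.mem_univ j), if_pos rfl]
  gcongr with i hi
  · calc _ ≤ volume (Set.Icc (a j - 2 * δ) (a j) ∪ Set.Icc (-a j) (-a j + 2 * δ)) := by
          refine measure_mono fun s hs => ?_
          obtain ⟨h1, h2⟩ := hs
          rcases abs_cases s with ⟨h, _⟩ | ⟨h, _⟩ <;> rw [h] at h1 h2
          · left; constructor <;> linarith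
          · right; constructor <;> linarith
      _ ≤ _ := measure_union_le _ _
      _ = _ := by
          rw [Real.volume_Icc, Real.volume_Icc, ← ENNReal.ofReal_add (by linarith) (by linarith)]
          congr 1; ring
  · rw [if_neg (Finset.ne_of_mem_erase hi), Real.volume_Ioo]
    exact ENNReal.ofReal_le_ofReal (by linarith)

section zeroExtension

variable {k : ℕ} {J : Finset (Fin k)} {a : Fin k → ℝ}

/-- The box `{x | ∀ i ∈ J, |x i| < a i}`. -/
def openBox (J : Finset (Fin k)) (a : Fin k → ℝ) : Set (Euc k) := {x | ∀ i ∈ J, |x i| < a i}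

theorem isOpen_openBox (J : Finset (Fin k)) (a : Fin k → ℝ) : IsOpen (openBox J a) := by
  have : openBox J a = ⋂ i ∈ J, {x : Euc k | |x i| < a i} := by ext; simp [openBox]
  rw [this]
  exact isOpen_biInter_finset fun i _ => isOpen_lt (by fun_prop) continuous_const

theorem openBox_anti {J' : Finset (Fin k)} (h : J' ⊆ J) : openBox J a ⊆ openBox J' a :=
  fun _ hx i hi => hx i (h hi)

variable {φ : Euc k → Euc 3} {G : Euc k → Cols k}

/-- The points of the support of `η` where the extended field has norm at least `ε` form a compact
set. It lies in the open box, because the extension vanishes outside, and so it keeps a positive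
distance from the faces. -/
theorem boundary_smallness {η : Euc k → ℝ} (hs : HasCompactSupport η)
    (ht : tsupport η ⊆ openBox Jᶜ a)
    (hc : ContinuousOn ((openBox Finset.univ a).indicator φ) (openBox Jᶜ a))
    {ε : ℝ} (hε : 0 < ε) (j : Fin k) :
    ∃ δ₀ : ℝ, 0 < δ₀ ∧ ∀ δ, 0 < δ → δ < δ₀ → ∀ x ∈ openBox Finset.univ a, x ∈ tsupport η →
      a j - 2 * δ ≤ |x j| → ‖φ x‖ ≤ ε := by
  set K := tsupport η ∩ ((openBox Finset.univ a).indicator φ) ⁻¹' {v | ε ≤ ‖v‖} with hK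
  have hKc : IsClosed K :=
    (hc.mono ht).preimage_isClosed_of_isClosed (isClosed_tsupport η)
      (isClosed_le continuous_const continuous_norm)
  have hKK : IsCompact K := hs.isCompact.of_isClosed_subset hKc Set.inter_subset_left
  obtain ⟨δ₀, hδ₀, h⟩ := hKK.exists_forall_le' (f := fun x : Euc k => a j - |x j|) (a := 0)
    (by fun_prop) (fun x hx => by
      by_cases hxU : x ∈ openBox Finset.univ a
      · have := hxU j (Finset.mem_univ j); linarith
      · have := hx.2
        rw [Set.mem_preimage, Set.indicator_of_notMem hxU, Set.mem_ofPred_eq, norm_zero] at this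
        linarith)
  refine ⟨δ₀ / 2, by positivity, fun δ hδ hδ' x hxU hxη hxj => ?_⟩
  by_contra! hcon
  have hxK : x ∈ K := by
    refine ⟨hxη, ?_⟩
    rw [Set.mem_preimage, Set.indicator_of_mem hxU]
    exact hcon.le
  have := h x hxK
  simp only at this
  linarith

/-- A field on a box which vanishes on the faces orthogonal to `e_j`, `j ∈ J`, can be extended by
zero across these faces. -/
theorem MemW1Infty.indicator (h : MemW1Infty (openBox Finset.univ a) φ G)
    (hc : ContinuousOn ((openBox Finset.univ a).indicator φ) (openBox Jᶜ a)) :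
    MemW1Infty (openBox Jᶜ a) ((openBox Finset.univ a).indicator φ)
      ((openBox Finset.univ a).indicator G) := by
  set U : Set (Euc k) := openBox Finset.univ a with hUdef
  have hUo : IsOpen U := isOpen_openBox _ _
  have hUV : U ⊆ openBox Jᶜ a := openBox_anti (Finset.subset_univ _)
  have hr : (volume.restrict (openBox Jᶜ a)).restrict U = volume.restrict U := by
    rw [Measure.restrict_restrict hUo.measurableSet, Set.inter_eq_self_of_subset_left hUV]
  refine ⟨(memLp_indicator_iff_restrict hUo.measurableSet).2 (by rw [hr]; exact h.1),
    (memLp_indicator_iff_restrict hUo.measurableSet).2 (by rw [hr]; exact h.2.1),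
    fun η hη hs ht j => ?_⟩
  set e : Euc k := EuclideanSpace.single j 1 with he
  have c1 := continuous_fderiv_apply hη e
  have s1 := hasCompactSupport_fderiv_apply hs e
  set F : Euc k → Euc 3 := fun x => fderiv ℝ η x e • φ x + η x • G x j with hF
  have i1 := integrable_smul_of_hasCompactSupport c1 s1 h.1
  have i2 := integrable_smul_of_hasCompactSupport hη.continuous hs (memLp_top_col h.2.1 j)
  have hFi : IntegrableOn F U := i1.add i2
  -- The extended fields live on `U`, so the weak gradient identity on the larger box is the
  -- vanishing of this integral. It is not immediate, since `η` need not vanish near the faces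
  -- orthogonal to `e_i`, `i ∈ J`.
  suffices hz : ∫ x in U, F x = 0 by
    have e1 : ∀ x, fderiv ℝ η x e • U.indicator φ x =
        U.indicator (fun x => fderiv ℝ η x e • φ x) x := fun x => by
      by_cases hx : x ∈ U <;> simp [hx]
    have e2 : ∀ x, η x • U.indicator G x j = U.indicator (fun x => η x • G x j) x := fun x => by
      by_cases hx : x ∈ U <;> simp [hx]
    simp only [e1, e2]
    rw [setIntegral_indicator hUo.measurableSet, setIntegral_indicator hUo.measurableSet,
      Set.inter_eq_self_of_subset_right hUV, eq_neg_iff_add_eq_zero, ← integral_add i1 i2]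
    exact hz
  obtain ⟨C, hC, hCb⟩ := exists_fderiv_boxCutoff_bound
  obtain ⟨B, hB⟩ := hη.continuous.bounded_above_of_compact_support hs
  have hB0 : 0 ≤ B := (norm_nonneg _).trans (hB 0)
  set P : ℝ := (∏ i ∈ Finset.univ.erase j, ENNReal.ofReal (2 * a i)).toReal with hP
  have hPfin : ∏ i ∈ Finset.univ.erase j, ENNReal.ofReal (2 * a i) ≠ ⊤ :=
    ENNReal.prod_ne_top fun _ _ => ENNReal.ofReal_ne_top
  -- This cutoff is supported in `|x i| ≤ a i - δ` for `i ∈ J`; in the other directions the support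
  -- of `η` is already inside. Hence `χ δ * η` is an admissible test function on `U`.
  set χ : ℝ → Euc k → ℝ := fun δ => boxCutoff J (fun i => a i - 2 * δ) fun _ => δ with hχ
  have hχs : ∀ δ, ContDiff ℝ ∞ (χ δ) := fun δ => boxCutoff_contDiff _ _ _
  -- the weak gradient identity, tested with `χ δ * η`
  have key : ∀ δ, 0 < δ → ∫ x in U, χ δ x • F x =
      - ∫ x in U, (η x * fderiv ℝ (χ δ) x e) • φ x := by
    intro δ hδ
    have hd : ∀ x, fderiv ℝ (fun x => χ δ x * η x) x e =
        χ δ x * fderiv ℝ η x e + η x * fderiv ℝ (χ δ) x e := fun x => by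
      rw [fderiv_fun_mul ((hχs δ).differentiable (by simp) x) (hη.differentiable (by simp) x)]
      simp
    have ht' : tsupport (fun x => χ δ x * η x) ⊆ U := by
      intro x hx i _
      by_cases hi : i ∈ J
      · have h1 := tsupport_boxCutoff_subset (fun _ => hδ) (tsupport_mul_subset_left hx) i hi
        dsimp only at h1
        linarith
      · exact ht (tsupport_mul_subset_right hx) i (by simpa using hi)
    have hw := h.2.2 (fun x => χ δ x * η x) ((hχs δ).mul hη) hs.mul_left ht' j
    rw [← he] at hw
    simp only [hd, add_smul, mul_smul] at hw
    have j1 : IntegrableOn (fun x => χ δ x • fderiv ℝ η x e • φ x) U := by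
      simp only [← mul_smul]
      exact integrable_smul_of_hasCompactSupport ((hχs δ).continuous.mul c1) s1.mul_left h.1
    have j2 : IntegrableOn (fun x => η x • fderiv ℝ (χ δ) x e • φ x) U := by
      simp only [← mul_smul]
      exact integrable_smul_of_hasCompactSupport
        (hη.continuous.mul (continuous_fderiv_apply (hχs δ) e)) hs.mul_right h.1
    have j3 : IntegrableOn (fun x => χ δ x • η x • G x j) U := by
      simp only [← mul_smul]
      exact integrable_smul_of_hasCompactSupport ((hχs δ).continuous.mul hη.continuous)
        hs.mul_left (memLp_top_col h.2.1 j)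
    rw [integral_add j1 j2] at hw
    simp only [hF, smul_add, mul_smul]
    rw [integral_add j1 j3, eq_neg_iff_add_eq_zero, add_right_comm, hw, neg_add_cancel]
  set δ : ℕ → ℝ := fun n => 1 / ((n : ℝ) + 1) with hδdef
  have hδpos : ∀ n, 0 < δ n := fun n => Nat.one_div_pos_of_nat
  have hδlim : Tendsto δ atTop (𝓝 0) := tendsto_one_div_add_atTop_nhds_zero_nat
  have hlim : Tendsto (fun n => ∫ x in U, χ (δ n) x • F x) atTop (𝓝 (∫ x in U, F x)) := by
    refine tendsto_integral_of_dominated_convergence (fun x => ‖F x‖) (fun n => ?_) hFi.norm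
      (fun n => Eventually.of_forall fun x => ?_) ?_
    · exact (hχs _).continuous.aestronglyMeasurable.smul hFi.aestronglyMeasurable
    · rw [norm_smul, Real.norm_eq_abs, abs_of_nonneg boxCutoff_nonneg]
      exact mul_le_of_le_one_left (norm_nonneg _) boxCutoff_le_one
    · refine (ae_restrict_iff' hUo.measurableSet).2 (Eventually.of_forall fun x hx => ?_)
      refine tendsto_const_nhds.congr' ?_
      have : ∀ i, ∀ᶠ n in atTop, |x i| ≤ a i - 2 * δ n := fun i => by
        have h0 : Tendsto (fun n => a i - 2 * δ n) atTop (𝓝 (a i - 2 * 0)) :=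
          tendsto_const_nhds.sub (hδlim.const_mul 2)
        have h1 : |x i| < a i - 2 * 0 := by simpa using hx i (Finset.mem_univ i)
        exact (h0.eventually_const_lt h1).mono fun n hn => hn.le
      filter_upwards [eventually_all.2 this] with n hn
      rw [hχ]
      dsimp only
      rw [boxCutoff_eq_one (fun _ => hδpos n) fun i _ => hn i, one_smul]
  -- The derivative of `χ δ` has size `C / δ` and is concentrated in a layer of volume at most `4 *
  -- δ * P`, where `φ` is at most `ε` on the support of `η`. The powers of `δ` cancel and a multiple
  -- of `ε` remains.
  have hsmall : ∀ ε : ℝ, 0 < ε → ‖∫ x in U, F x‖ ≤ B * C * (4 * P) * ε := by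
    intro ε hε
    obtain ⟨δ₀, hδ₀, hb⟩ := boundary_smallness hs ht hc hε j
    refine le_of_tendsto hlim.norm ?_
    filter_upwards [hδlim.eventually_lt_const hδ₀] with n hn
    rw [key _ (hδpos n), norm_neg]
    set S := faceLayer a j (δ n)
    have hvol : volume S ≤ ENNReal.ofReal (4 * δ n) *
      ∏ i ∈ Finset.univ.erase j, ENNReal.ofReal (2 * a i) := volume_faceLayer_le j (hδpos n).le
    have hfin : ENNReal.ofReal (4 * δ n) *
        ∏ i ∈ Finset.univ.erase j, ENNReal.ofReal (2 * a i) ≠ ⊤ :=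
      ENNReal.mul_ne_top ENNReal.ofReal_ne_top hPfin
    have hz : ∀ x ∈ U \ (U ∩ S), (η x * fderiv ℝ (χ (δ n)) x e) • φ x = 0 := by
      intro x hx
      have : fderiv ℝ (χ (δ n)) x e = 0 := by
        refine fderiv_boxCutoff_single_eq_zero (fun _ => hδpos n) fun _ => Or.inl ?_
        by_contra! hlt
        refine hx.2 ⟨hx.1, fun i => ?_⟩
        split_ifs with hij
        · subst hij
          exact ⟨hlt.le, hx.1 i (Finset.mem_univ i)⟩
        · exact abs_lt.1 (hx.1 i (Finset.mem_univ i))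
      rw [this, mul_zero, zero_smul]
    rw [setIntegral_eq_of_subset_of_forall_sdiff_eq_zero hUo.measurableSet
      Set.inter_subset_left hz]
    have hbound : ∀ x ∈ U ∩ S,
        ‖(η x * fderiv ℝ (χ (δ n)) x e) • φ x‖ ≤ B * (C / δ n) * ε := by
      intro x hx
      by_cases hxη : x ∈ tsupport η
      · have h1 : ‖φ x‖ ≤ ε := by
          refine hb (δ n) (hδpos n) hn x hx.1 hxη ?_
          have := hx.2 j
          rw [if_pos rfl] at this
          exact this.1
        rw [norm_smul, norm_mul]
        have h2 : ‖fderiv ℝ (χ (δ n)) x e‖ ≤ C / δ n := hCb _ _ _ _ x j fun _ => hδpos n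
        have := hδpos n
        gcongr
        exact hB x
      · rw [image_eq_zero_of_notMem_tsupport hxη, zero_mul, zero_smul, norm_zero]
        have := hδpos n
        positivity
    have hUS : volume (U ∩ S) ≤ _ := (measure_mono Set.inter_subset_right).trans hvol
    refine (norm_setIntegral_le_of_norm_le_const (hUS.trans_lt hfin.lt_top) hbound).trans ?_
    have hreal : volume.real (U ∩ S) ≤ 4 * δ n * P := by
      refine (ENNReal.toReal_mono hfin hUS).trans (le_of_eq ?_)
      rw [ENNReal.toReal_mul, ENNReal.toReal_ofReal (by have := hδpos n; positivity)]
    calc _ ≤ B * (C / δ n) * ε * (4 * δ n * P) := by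
          have := hδpos n
          gcongr
      _ = B * C * (4 * P) * ε := by
          have := (hδpos n).ne'
          field_simp
  have hP0 : 0 ≤ P := ENNReal.toReal_nonneg
  have : ‖∫ x in U, F x‖ ≤ 0 := by
    refine le_of_forall_pos_le_add fun ε hε => ?_
    have hM : 0 ≤ B * C * (4 * P) := by positivity
    refine (hsmall (ε / (B * C * (4 * P) + 1)) (by positivity)).trans ?_
    rw [zero_add, mul_div_assoc', div_le_iff₀ (by positivity)]
    nlinarith
  exact norm_le_zero_iff.1 this

end zeroExtension

/-! ### Squares and prisms -/

section geometry

/-- The infinite layer `ℝ² × (-1/2, 1/2)`. -/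
def layer : Set (Euc 3) := {x | |x 2| < 1 / 2}

/-- The open square with centre `c` and side `l`. -/
def sqAt (c : Euc 2) (l : ℝ) : Set (Euc 2) := {y | ∀ i, |y i - c i| < l / 2}

/-- The prism `B × (-1/2, 1/2)`. -/
def prism (B : Set (Euc 2)) : Set (Euc 3) := {x | inPlane x ∈ B ∧ |x 2| < 1 / 2}

theorem square_eq_sqAt (t : ℝ) : square t = sqAt 0 t := by
  ext y; simp [square, sqAt]

theorem box_eq_prism (t : ℝ) : box t = prism (sqAt 0 t) := by
  rw [← square_eq_sqAt]; rfl

theorem inPlane_zero (x : Euc 3) : inPlane x 0 = x 0 := rfl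

theorem inPlane_one (x : Euc 3) : inPlane x 1 = x 1 := rfl

/-- The map `x ↦ x_α` as a continuous linear map. -/
noncomputable def inPlaneL : Euc 3 →L[ℝ] Euc 2 :=
  LinearMap.toContinuousLinearMap
    { toFun := inPlane
      map_add' := fun x y => by ext i; fin_cases i <;> rfl
      map_smul' := fun c x => by ext i; fin_cases i <;> rfl }

theorem inPlaneL_apply (x : Euc 3) : inPlaneL x = inPlane x := rfl

theorem continuous_inPlane : Continuous inPlane := inPlaneL.continuous

theorem isOpen_sqAt (c : Euc 2) (l : ℝ) : IsOpen (sqAt c l) := by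
  simp only [sqAt, Set.ofPred_forall]
  exact isOpen_iInter_of_finite fun i => isOpen_lt (by fun_prop) continuous_const

theorem isOpen_layer : IsOpen layer := isOpen_lt (by fun_prop) continuous_const

theorem isOpen_prism {B : Set (Euc 2)} (hB : IsOpen B) : IsOpen (prism B) :=
  (hB.preimage continuous_inPlane).inter isOpen_layer

theorem prism_subset_layer (B : Set (Euc 2)) : prism B ⊆ layer := fun _ hx => hx.2

theorem prism_mono {B B' : Set (Euc 2)} (h : B ⊆ B') : prism B ⊆ prism B' :=
  fun _ hx => ⟨h hx.1, hx.2⟩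

theorem volume_sqAt (c : Euc 2) {l : ℝ} (hl : 0 ≤ l) : volume (sqAt c l) = ENNReal.ofReal (l ^ 2) := by
  have : sqAt c l = {y : Euc 2 | ∀ i, y i ∈ Set.Ioo (c i - l / 2) (c i + l / 2)} := by
    ext y
    refine forall_congr' fun i => ?_
    rw [abs_lt, Set.mem_Ioo]
    constructor <;> rintro ⟨h1, h2⟩ <;> constructor <;> linarith
  rw [this, volume_coordSet _ fun _ => measurableSet_Ioo, Fin.prod_univ_two, Real.volume_Ioo,
    Real.volume_Ioo, ← ENNReal.ofReal_mul (by linarith)]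
  congr 1; ring

theorem volume_prism_sqAt (c : Euc 2) {l : ℝ} (hl : 0 ≤ l) :
    volume (prism (sqAt c l)) = ENNReal.ofReal (l ^ 2) := by
  have : prism (sqAt c l) = {x : Euc 3 | ∀ i, x i ∈
      (![Set.Ioo (c 0 - l / 2) (c 0 + l / 2), Set.Ioo (c 1 - l / 2) (c 1 + l / 2),
        Set.Ioo (-(1 / 2)) (1 / 2)] : Fin 3 → Set ℝ) i} := by
    ext x
    simp only [prism, sqAt, Set.mem_ofPred_eq, Fin.forall_fin_succ, inPlane_zero, abs_lt]
    simp only [Fin.isValue, Matrix.cons_val_zero, Set.mem_Ioo, Fin.succ_zero_eq_one,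
      inPlane_one,
      Matrix.cons_val_one, Fin.succ_one_eq_two, Matrix.cons_val, IsEmpty.forall_iff, and_true]
    constructor
    · rintro ⟨⟨⟨h1, h2⟩, h3, h4⟩, h5, h6⟩
      refine ⟨⟨?_, ?_⟩, ⟨?_, ?_⟩, ?_, ?_⟩ <;> linarith
    · rintro ⟨⟨h1, h2⟩, ⟨h3, h4⟩, h5, h6⟩
      refine ⟨⟨⟨?_, ?_⟩, ?_, ?_⟩, ?_, ?_⟩ <;> linarith
  rw [this, volume_coordSet _ fun i => by fin_cases i <;> exact measurableSet_Ioo,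
    Fin.prod_univ_three]
  simp only [Matrix.cons_val_zero, Matrix.cons_val_one, Matrix.cons_val, Real.volume_Ioo]
  rw [← ENNReal.ofReal_mul (by linarith), ← ENNReal.ofReal_mul (by nlinarith)]
  congr 1; ring

end geometry

/-! ### Matrices by columns -/

section columns

/-- Adding a planar field with gradient `η` turns the cell problem at `ξ` into the one at `ξ + η`.
This is the algebra behind all gluing arguments. -/
theorem shiftedGradient_add (ξ η : Cols 2) (G : Cols 3) :
    shiftedGradient ξ (shiftedGradient η 0 + G) = shiftedGradient (ξ + η) G := by
  ext j : 1
  fin_cases j <;> simp [shiftedGradient, add_assoc]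

theorem shiftedGradient_eq (ξ : Cols 2) (G : Cols 3) :
    shiftedGradient ξ G = shiftedGradient ξ 0 + G := by
  ext j : 1
  fin_cases j <;> simp [shiftedGradient]

theorem norm_shiftedGradient_zero (ξ : Cols 2) : ‖shiftedGradient ξ 0‖ = ‖ξ‖ := by
  rw [PiLp.norm_eq_of_L2, PiLp.norm_eq_of_L2, Fin.sum_univ_three, Fin.sum_univ_two]
  simp [shiftedGradient]

theorem continuous_shiftedGradient_zero : Continuous fun ξ : Cols 2 => shiftedGradient ξ 0 := by
  unfold shiftedGradient
  refine (PiLp.continuous_toLp 2 _).comp (continuous_pi fun j => ?_)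
  fin_cases j
  · simp; fun_prop
  · simp; fun_prop
  · simp; fun_prop

theorem colGrad_comp_inPlane {w : Euc 2 → Euc 3} (hw : ContDiff ℝ 1 w) (x : Euc 3) :
    colGrad (fun x => w (inPlane x)) x = shiftedGradient (colGrad w (inPlane x)) 0 := by
  have hd : HasFDerivAt (fun x => w (inPlane x))
      ((fderiv ℝ w (inPlane x)).comp inPlaneL) x :=
    (hw.differentiable (by simp) _).hasFDerivAt.comp x (inPlaneL.hasFDerivAt (x := x))
  have e0 : inPlane (EuclideanSpace.single 0 1) = EuclideanSpace.single 0 1 := by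
    ext i; fin_cases i <;> simp [inPlane]
  have e1 : inPlane (EuclideanSpace.single 1 1) = EuclideanSpace.single 1 1 := by
    ext i; fin_cases i <;> simp [inPlane]
  have e2 : inPlane (EuclideanSpace.single 2 1) = 0 := by
    ext i; fin_cases i <;> simp [inPlane]
  ext j : 1
  rw [colGrad_apply, hd.fderiv]
  fin_cases j
  · simp [shiftedGradient, inPlaneL_apply, e0, colGrad_apply]
  · simp [shiftedGradient, inPlaneL_apply, e1, colGrad_apply]
  · simp [shiftedGradient, inPlaneL_apply, e2]

end columns

/-! ### Measurability and integrability of the integrand -/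

section integrand

/-- The standing assumptions on the integrand, with explicit growth constants. -/
structure IsIntegrand (p α β : ℝ) (f : Euc 3 → Cols 3 → ℝ) : Prop where
  one_le : 1 ≤ p
  alpha_pos : 0 < α
  beta_pos : 0 < β
  cara : IsCaratheodoryFun f
  periodic : IsInPlanePeriodic f
  growth : ∀ᵐ x ∂volume, ∀ ξ, α * ‖ξ‖ ^ p ≤ f x ξ ∧ f x ξ ≤ β * (1 + ‖ξ‖ ^ p)

/-- For a simple function in place of `G` the composition is a finite sum of the functions `f · v`
restricted to measurable sets. Continuity of `f x` for a.e. `x` carries measurability over to the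
pointwise limit. -/
theorem IsCaratheodoryFun.aemeasurable_comp {f : Euc 3 → Cols 3 → ℝ} (hf : IsCaratheodoryFun f)
    {S : Set (Euc 3)} {G : Euc 3 → Cols 3}
    (hG : AEStronglyMeasurable G (volume.restrict S)) :
    AEMeasurable (fun x => f x (G x)) (volume.restrict S) := by
  obtain ⟨G', hG', hGG'⟩ := hG
  have hc : ∀ᵐ x ∂volume.restrict S, Continuous (f x) := ae_restrict_of_ae hf.2
  have h1 : AEMeasurable (fun x => f x (G' x)) (volume.restrict S) := by
    refine aemeasurable_of_tendsto_metrizable_ae atTop (f := fun n x => f x (hG'.approx n x))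
      (fun n => ?_) ?_
    · have e : (fun x => f x (hG'.approx n x)) = fun x => ∑ v ∈ (hG'.approx n).range,
          ((hG'.approx n) ⁻¹' {v}).indicator (fun x => f x v) x := by
        funext x
        rw [Finset.sum_eq_single (hG'.approx n x)]
        · simp
        · intro v _ hv
          rw [Set.indicator_of_notMem]
          simpa using hv.symm
        · simp
      rw [e]
      refine Finset.aemeasurable_fun_sum _ fun v _ => ?_
      exact (hf.1 v).restrict.indicator ((hG'.approx n).measurableSet_fiber v)
    · filter_upwards [hc] with x hx
      exact (hx.tendsto _).comp (hG'.tendsto_approx x)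
  refine h1.congr ?_
  filter_upwards [hGG'] with x hx
  rw [hx]

theorem integrableOn_of_growth {p α β : ℝ} {f : Euc 3 → Cols 3 → ℝ} (hf : IsIntegrand p α β f)
    {S : Set (Euc 3)} (hS : volume S ≠ ⊤) {G : Euc 3 → Cols 3}
    (hG : MemLp G ⊤ (volume.restrict S)) : IntegrableOn (fun x => f x (G x)) S := by
  have : IsFiniteMeasure (volume.restrict S) := ⟨by simpa using hS.lt_top⟩
  have hm := (hf.cara.aemeasurable_comp hG.1).aestronglyMeasurable
  have hp : 0 ≤ p := zero_le_one.trans hf.one_le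
  obtain ⟨K, hK⟩ : ∃ K : ℝ, ∀ᵐ x ∂volume.restrict S, ‖G x‖ ≤ K :=
    ⟨_, ae_le_lpNorm_exponent_top hG⟩
  refine Integrable.of_bound hm (β * (1 + K ^ p)) ?_
  filter_upwards [ae_restrict_of_ae hf.growth, hK] with x hx hxK
  have h0 : 0 ≤ f x (G x) :=
    (mul_nonneg hf.alpha_pos.le (Real.rpow_nonneg (norm_nonneg _) _)).trans (hx (G x)).1
  rw [Real.norm_eq_abs, abs_of_nonneg h0]
  refine (hx (G x)).2.trans ?_
  have := hf.beta_pos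
  gcongr

end integrand

/-! ### Fields on the whole layer -/

section stripField

/-- A `W^{1,∞}` field on the layer `ℝ² × (-1/2, 1/2)` with values in `T` which is continuous and
vanishes off `B × (-1/2, 1/2)`. -/
structure IsStripField (T : Submodule ℝ (Euc 3)) (B : Set (Euc 2)) (φ : Euc 3 → Euc 3)
    (G : Euc 3 → Cols 3) : Prop where
  memW1Infty : MemW1Infty layer φ G
  mem : ∀ x ∈ layer, φ x ∈ T
  cont : ContinuousOn φ layer
  eq_zero : ∀ x, inPlane x ∉ B → φ x = 0
  grad_eq_zero : ∀ x, inPlane x ∉ B → G x = 0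

variable {T : Submodule ℝ (Euc 3)} {B B' : Set (Euc 2)} {φ φ' : Euc 3 → Euc 3}
  {G G' : Euc 3 → Cols 3}

theorem IsStripField.mono (h : IsStripField T B φ G) (hB : B ⊆ B') : IsStripField T B' φ G :=
  ⟨h.1, h.2, h.3, fun x hx => h.4 x fun h => hx (hB h), fun x hx => h.5 x fun h => hx (hB h)⟩

theorem IsStripField.add (h : IsStripField T B φ G) (h' : IsStripField T B φ' G') :
    IsStripField T B (fun x => φ x + φ' x) (fun x => G x + G' x) where
  memW1Infty := h.1.add h'.1
  mem x hx := T.add_mem (h.2 x hx) (h'.2 x hx)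
  cont := h.3.add h'.3
  eq_zero x hx := by rw [h.4 x hx, h'.4 x hx, add_zero]
  grad_eq_zero x hx := by rw [h.5 x hx, h'.5 x hx, add_zero]

theorem IsStripField.sum {ι : Type*} (s : Finset ι) {φ : ι → Euc 3 → Euc 3}
    {G : ι → Euc 3 → Cols 3} (h : ∀ i ∈ s, IsStripField T B (φ i) (G i)) :
    IsStripField T B (fun x => ∑ i ∈ s, φ i x) (fun x => ∑ i ∈ s, G i x) where
  memW1Infty := MemW1Infty.sum s fun i hi => (h i hi).1
  mem x hx := T.sum_mem fun i hi => (h i hi).2 x hx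
  cont := continuousOn_finsetSum _ fun i hi => (h i hi).3
  eq_zero x hx := Finset.sum_eq_zero fun i hi => (h i hi).4 x hx
  grad_eq_zero x hx := Finset.sum_eq_zero fun i hi => (h i hi).5 x hx

theorem IsStripField.of_smooth {w : Euc 2 → Euc 3} (hw : ContDiff ℝ ∞ w)
    (hs : HasCompactSupport w) (hB : tsupport w ⊆ B) (hT : ∀ y, w y ∈ T) :
    IsStripField T B (fun x => w (inPlane x))
      (fun x => shiftedGradient (colGrad w (inPlane x)) 0) where
  memW1Infty := by
    have hw1 : ContDiff ℝ 1 w := hw.of_le (by exact_mod_cast le_top)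
    have hcg := continuous_colGrad hw1
    have hcs : HasCompactSupport (colGrad w) := by
      refine hs.mono' fun y hy => ?_
      by_contra h
      refine hy ?_
      ext j : 1
      exact fderiv_apply_eq_zero_of_notMem_tsupport h _
    obtain ⟨a, ha⟩ := hw.continuous.bounded_above_of_compact_support hs
    obtain ⟨b, hb⟩ := hcg.bounded_above_of_compact_support hcs
    refine ⟨memLp_top_of_bound (hw.continuous.comp continuous_inPlane).aestronglyMeasurable a
      (Eventually.of_forall fun x => ha _), memLp_top_of_bound
      (continuous_shiftedGradient_zero.comp (hcg.comp continuous_inPlane)).aestronglyMeasurable b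
      (Eventually.of_forall fun x => ?_), ?_⟩
    · rw [norm_shiftedGradient_zero]
      exact hb _
    · have := isWeakGradient_colGrad (U := layer) (w := fun x => w (inPlane x))
        (hw1.comp inPlaneL.contDiff)
      convert this using 2 with x
      exact (colGrad_comp_inPlane hw1 _).symm
  mem x _ := hT _
  cont := (hw.continuous.comp continuous_inPlane).continuousOn
  eq_zero x hx := image_eq_zero_of_notMem_tsupport fun h => hx (hB h)
  grad_eq_zero x hx := by
    have : colGrad w (inPlane x) = 0 := by
      ext j : 1
      exact fderiv_apply_eq_zero_of_notMem_tsupport (fun h => hx (hB h)) _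
    rw [this]
    ext j : 1
    fin_cases j <;> simp [shiftedGradient]

theorem IsStripField.translate (h : IsStripField T B φ G) (v : Euc 3) (hv : v 2 = 0) :
    IsStripField T {y | y - inPlane v ∈ B} (fun x => φ (x - v)) (fun x => G (x - v)) := by
  have hl : ∀ x, x - v ∈ layer ↔ x ∈ layer := fun x => by simp [layer, hv]
  have hi : ∀ x, inPlane (x - v) = inPlane x - inPlane v := fun x => inPlaneL.map_sub x v
  refine ⟨h.1.translate v hl isOpen_layer.measurableSet, fun x hx => h.2 _ ((hl x).2 hx),
    h.3.comp (by fun_prop) fun x hx => (hl x).2 hx, fun x hx => h.4 _ ?_, fun x hx => h.5 _ ?_⟩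
  · rw [hi]; exact hx
  · rw [hi]; exact hx

theorem IsStripField.isTestField {t : ℝ} (h : IsStripField T (square t) φ G) :
    IsTestField (box t) (lateralBdry t) T φ G := by
  have hs : IsOpen (square t) := by rw [square_eq_sqAt]; exact isOpen_sqAt _ _
  refine ⟨h.1.mono (prism_subset_layer _) isOpen_layer.measurableSet,
    fun x hx => h.2 x hx.2, h.3.mono ?_, fun x hx => h.4 x ?_⟩
  · rintro x (hx | hx) <;> exact hx.2
  · have := hx.1
    rw [hs.frontier_eq] at this
    exact this.2

/-- Zero extension moves a test field from its cell to the whole layer, a common domain on which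
fields can be translated and summed. -/
theorem IsTestField.isStripField {t : ℝ} (h : IsTestField (box t) (lateralBdry t) T φ G) :
    IsStripField T (square t) ((box t).indicator φ) ((box t).indicator G) := by
  have hs : IsOpen (square t) := by rw [square_eq_sqAt]; exact isOpen_sqAt _ _
  have hb : IsOpen (box t) := isOpen_prism hs
  have hc : ContinuousOn ((box t).indicator φ) layer := by
    refine continuousOn_indicator_of_frontier hb ?_ h.2.2.1 h.2.2.2
    rintro x ⟨hx, hxf⟩
    rw [hb.frontier_eq] at hxf
    refine ⟨?_, hx⟩
    rw [hs.frontier_eq]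
    exact ⟨map_mem_closure continuous_inPlane hxf.1 fun y hy => hy.1, fun h => hxf.2 ⟨h, hx⟩⟩
  -- Only the faces in directions `0` and `1` are crossed: the field need not vanish at `x_3 =
  -- ±1/2`, so the extended field lives on the layer and not on all of space.
  have e1 : openBox Finset.univ ![t / 2, t / 2, 1 / 2] = box t := by
    ext x
    simp [openBox, box, square, Fin.forall_fin_succ, inPlane, and_assoc]
  have e2 : openBox ({0, 1} : Finset (Fin 3))ᶜ ![t / 2, t / 2, 1 / 2] = layer := by
    ext x
    simp [openBox, layer, Fin.forall_fin_succ]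
  have hW := MemW1Infty.indicator (J := {0, 1}) (a := ![t / 2, t / 2, 1 / 2]) (φ := φ) (G := G)
  rw [e1, e2] at hW
  refine ⟨hW h.1 hc, fun x _ => ?_, hc, fun x hx => ?_, fun x hx => ?_⟩
  · by_cases hx : x ∈ box t
    · rw [Set.indicator_of_mem hx]; exact h.2.1 x hx
    · rw [Set.indicator_of_notMem hx]; exact T.zero_mem
  · exact Set.indicator_of_notMem (fun h => hx h.1) _
  · exact Set.indicator_of_notMem (fun h => hx h.1) _

end stripField

/-! ### Cell infima and gluing of fields -/

section cellInf

variable {p α β : ℝ} {f : Euc 3 → Cols 3 → ℝ} {T : Submodule ℝ (Euc 3)}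

theorem memLp_shiftedGradient {S : Set (Euc 3)} (hS : volume S ≠ ⊤) (ξ : Cols 2)
    {G : Euc 3 → Cols 3} (hG : MemLp G ⊤ (volume.restrict S)) :
    MemLp (fun x => shiftedGradient ξ (G x)) ⊤ (volume.restrict S) := by
  have : IsFiniteMeasure (volume.restrict S) := ⟨by simpa using hS.lt_top⟩
  have h1 : MemLp (fun _ : Euc 3 => shiftedGradient ξ 0) ⊤ (volume.restrict S) := memLp_const _
  rw [funext fun x => shiftedGradient_eq ξ (G x)]
  exact h1.add hG

theorem volume_prism_sqAt_ne_top (c : Euc 2) (l : ℝ) : volume (prism (sqAt c l)) ≠ ⊤ := by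
  rcases le_or_gt 0 l with hl | hl
  · rw [volume_prism_sqAt c hl]; exact ENNReal.ofReal_ne_top
  · have : prism (sqAt c l) = ∅ := by
      ext x
      simp only [Set.mem_empty_iff_false, iff_false]
      intro hx
      have := (abs_nonneg _).trans_lt (hx.1 0)
      linarith
    rw [this]; simp

theorem IsStripField.memLp_grad {B : Set (Euc 2)} {φ : Euc 3 → Euc 3} {G : Euc 3 → Cols 3}
    (h : IsStripField T B φ G) (B' : Set (Euc 2)) :
    MemLp G ⊤ (volume.restrict (prism B')) :=
  h.1.2.1.mono_measure (Measure.restrict_mono (prism_subset_layer _) le_rfl)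

theorem IsIntegrand.integrableOn (hf : IsIntegrand p α β f) (ξ : Cols 2) {B : Set (Euc 2)}
    {φ : Euc 3 → Euc 3} {G : Euc 3 → Cols 3} (h : IsStripField T B φ G) (c : Euc 2) (l : ℝ) :
    IntegrableOn (fun x => f x (shiftedGradient ξ (G x))) (prism (sqAt c l)) :=
  integrableOn_of_growth hf (volume_prism_sqAt_ne_top c l)
    (memLp_shiftedGradient (volume_prism_sqAt_ne_top c l) ξ (h.memLp_grad _))

theorem IsIntegrand.ae_nonneg (hf : IsIntegrand p α β f) : ∀ᵐ x ∂volume, ∀ ξ, 0 ≤ f x ξ := by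
  filter_upwards [hf.growth] with x hx ξ
  exact (mul_nonneg hf.alpha_pos.le (Real.rpow_nonneg (norm_nonneg _) _)).trans (hx ξ).1

theorem IsIntegrand.setIntegral_nonneg (hf : IsIntegrand p α β f) (S : Set (Euc 3))
    (G : Euc 3 → Cols 3) : 0 ≤ ∫ x in S, f x (G x) := by
  refine integral_nonneg_of_ae (ae_restrict_of_ae ?_)
  filter_upwards [hf.ae_nonneg] with x hx using hx _

theorem cellInf_bddBelow (hf : IsIntegrand p α β f) (t : ℝ) (ξ : Cols 2) :
    BddBelow {r | ∃ (φ : Euc 3 → Euc 3) (G : Euc 3 → Cols 3),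
      IsTestField (box t) (lateralBdry t) T φ G ∧
        r = 1 / t ^ 2 * ∫ x in box t, f x (shiftedGradient ξ (G x))} := by
  refine ⟨0, ?_⟩
  rintro r ⟨φ, G, -, rfl⟩
  exact mul_nonneg (by positivity) (hf.setIntegral_nonneg _ _)

theorem cellInf_le (hf : IsIntegrand p α β f) {t : ℝ} {ξ : Cols 2}
    {φ : Euc 3 → Euc 3} {G : Euc 3 → Cols 3} (h : IsStripField T (sqAt 0 t) φ G) :
    cellInf f T t ξ ≤ 1 / t ^ 2 * ∫ x in prism (sqAt 0 t), f x (shiftedGradient ξ (G x)) := by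
  rw [← box_eq_prism]
  rw [← square_eq_sqAt] at h
  exact csInf_le (cellInf_bddBelow hf t ξ) ⟨φ, G, h.isTestField, rfl⟩

theorem isStripField_zero (B : Set (Euc 2)) : IsStripField T B (fun _ => 0) fun _ => 0 :=
  ⟨memW1Infty_zero, fun _ _ => T.zero_mem, continuousOn_const, fun _ _ => rfl, fun _ _ => rfl⟩

theorem exists_field_lt {t r : ℝ} {ξ : Cols 2} (hr : cellInf f T t ξ < r) :
    ∃ (φ : Euc 3 → Euc 3) (G : Euc 3 → Cols 3), IsStripField T (sqAt 0 t) φ G ∧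
      1 / t ^ 2 * ∫ x in prism (sqAt 0 t), f x (shiftedGradient ξ (G x)) < r := by
  obtain ⟨_, ⟨φ, G, h, rfl⟩, hlt⟩ := exists_lt_of_csInf_lt
    (by exact ⟨_, _, _, (isStripField_zero (square t)).isTestField, rfl⟩) hr
  refine ⟨_, _, by rw [← square_eq_sqAt]; exact h.isStripField, ?_⟩
  rw [← box_eq_prism]
  have hb : MeasurableSet (box t) := by
    rw [box_eq_prism]; exact (isOpen_prism (isOpen_sqAt _ _)).measurableSet
  rwa [setIntegral_congr_fun hb
    (g := fun x => f x (shiftedGradient ξ (G x))) fun x hx => by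
      simp only [Set.indicator_of_mem hx]]

theorem cellInf_nonneg (hf : IsIntegrand p α β f) (t : ℝ) (ξ : Cols 2) :
    0 ≤ cellInf f T t ξ := by
  refine Real.sInf_nonneg ?_
  rintro r ⟨φ, G, -, rfl⟩
  exact mul_nonneg (by positivity) (hf.setIntegral_nonneg _ _)

theorem setIntegral_le_of_norm_le (hf : IsIntegrand p α β f) {S : Set (Euc 3)}
    (hS : volume S ≠ ⊤) {G : Euc 3 → Cols 3} (hG : MemLp G ⊤ (volume.restrict S)) {K : ℝ}
    (hSm : MeasurableSet S) (hK : ∀ x ∈ S, ‖G x‖ ≤ K) :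
    ∫ x in S, f x (G x) ≤ β * (1 + K ^ p) * volume.real S := by
  have hp : 0 ≤ p := zero_le_one.trans hf.one_le
  have hβ := hf.beta_pos
  calc _ ≤ ∫ x in S, β * (1 + K ^ p) := by
        refine setIntegral_mono_on_ae (integrableOn_of_growth hf hS hG)
          (integrableOn_const hS) hSm ?_
        filter_upwards [hf.growth] with x hx hxS
        have := hK x hxS
        refine (hx _).2.trans ?_
        gcongr
    _ = _ := by rw [setIntegral_const, smul_eq_mul, mul_comm]

/-- Strip fields on disjoint squares, on each of which the gradient of a smooth field `w` is
constant, are glued to `w`. -/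
theorem exists_glued_field (hf : IsIntegrand p α β f) {c : Euc 2} {t : ℝ} (ht : 0 ≤ t)
    {ξ : Cols 2} {w : Euc 2 → Euc 3} (hw : ContDiff ℝ ∞ w) (hws : HasCompactSupport w)
    (hwt : tsupport w ⊆ sqAt c t) (hwT : ∀ y, w y ∈ T) {ι : Type*} [Fintype ι]
    {ctr : ι → Euc 2} {l : ι → ℝ} (hl : ∀ i, 0 ≤ l i)
    (hsub : ∀ i, sqAt (ctr i) (l i) ⊆ sqAt c t)
    (hdisj : Pairwise (Function.onFun Disjoint fun i => sqAt (ctr i) (l i)))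
    {η : ι → Cols 2} (hη : ∀ i, ∀ y ∈ sqAt (ctr i) (l i), colGrad w y = η i)
    {φ : ι → Euc 3 → Euc 3} {G : ι → Euc 3 → Cols 3}
    (hφ : ∀ i, IsStripField T (sqAt (ctr i) (l i)) (φ i) (G i))
    {K : ℝ} (hK : ∀ y, ‖ξ + colGrad w y‖ ≤ K) :
    ∃ (Φ : Euc 3 → Euc 3) (H : Euc 3 → Cols 3), IsStripField T (sqAt c t) Φ H ∧
      ∫ x in prism (sqAt c t), f x (shiftedGradient ξ (H x)) ≤
        ∑ i, (∫ x in prism (sqAt (ctr i) (l i)), f x (shiftedGradient (ξ + η i) (G i x))) +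
          β * (1 + K ^ p) * (t ^ 2 - ∑ i, l i ^ 2) := by
  set H : Euc 3 → Cols 3 := fun x => shiftedGradient (colGrad w (inPlane x)) 0 + ∑ i, G i x with hH
  have hfield : IsStripField T (sqAt c t) (fun x => w (inPlane x) + ∑ i, φ i x) H :=
    (IsStripField.of_smooth hw hws hwt hwT).add
      (IsStripField.sum _ fun i _ => (hφ i).mono (hsub i))
  refine ⟨_, H, hfield, ?_⟩
  set S := prism (sqAt c t)
  set U : Set (Euc 3) := ⋃ i, prism (sqAt (ctr i) (l i))
  have hSm : MeasurableSet S := (isOpen_prism (isOpen_sqAt _ _)).measurableSet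
  have hSi : ∀ i, MeasurableSet (prism (sqAt (ctr i) (l i))) :=
    fun i => (isOpen_prism (isOpen_sqAt _ _)).measurableSet
  have hUm : MeasurableSet U := MeasurableSet.iUnion hSi
  have hUS : U ⊆ S := Set.iUnion_subset fun i => prism_mono (hsub i)
  have hSfin : volume S ≠ ⊤ := volume_prism_sqAt_ne_top c t
  have hdisj' : Pairwise (Function.onFun Disjoint fun i => prism (sqAt (ctr i) (l i))) :=
    fun i j hij => Set.disjoint_left.2 fun x hx hx' =>
      Set.disjoint_left.1 (hdisj hij) hx.1 hx'.1
  have hint := hf.integrableOn ξ hfield c t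
  have hvol : volume.real (S \ U) = t ^ 2 - ∑ i, l i ^ 2 := by
    have hU : volume.real U = ∑ i, l i ^ 2 := by
      rw [measureReal_iUnion_fintype hdisj' hSi fun i => volume_prism_sqAt_ne_top _ _]
      refine Finset.sum_congr rfl fun i _ => ?_
      rw [measureReal_def, volume_prism_sqAt _ (hl i), ENNReal.toReal_ofReal (sq_nonneg _)]
    rw [measureReal_sdiff hUS hUm hSfin, hU, measureReal_def, volume_prism_sqAt c ht,
      ENNReal.toReal_ofReal (sq_nonneg _)]
  -- On the small square `i` only `G i` survives and the gradient of `w` equals `η i`, which gives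
  -- the energy at `ξ + η i`. Off all small squares only `w` remains, and the growth bound applies.
  rw [← integral_inter_add_sdiff hUm hint, Set.inter_eq_self_of_subset_right hUS, ← hvol]
  refine add_le_add (le_of_eq ?_) ?_
  · rw [integral_iUnion_fintype hSi hdisj'
      fun i => hint.mono_set ((Set.subset_iUnion (fun i => prism (sqAt (ctr i) (l i))) i).trans hUS)]
    refine Finset.sum_congr rfl fun i _ => setIntegral_congr_fun (hSi i) fun x hx => ?_
    have e : ∑ j, G j x = G i x := by
      refine Finset.sum_eq_single i (fun j _ hj => (hφ j).grad_eq_zero x fun hxj => ?_)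
        (by simp)
      exact Set.disjoint_left.1 (hdisj hj) hxj hx.1
    simp only [hH, e, hη i _ hx.1, shiftedGradient_add]
  · have hfin : volume (S \ U) ≠ ⊤ := measure_ne_top_of_subset Set.sdiff_subset hSfin
    refine setIntegral_le_of_norm_le hf hfin
      (memLp_shiftedGradient hfin ξ ((hfield.memLp_grad _).mono_measure
        (Measure.restrict_mono Set.sdiff_subset le_rfl))) (hSm.diff hUm) fun x hx => ?_
    have e : ∑ j, G j x = 0 := Finset.sum_eq_zero fun j _ => (hφ j).grad_eq_zero x fun hxj =>
      hx.2 (Set.mem_iUnion.2 ⟨j, hxj, hx.1.2⟩)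
    have e2 : H x = shiftedGradient (colGrad w (inPlane x)) 0 + 0 := by rw [hH]; simp only [e]
    rw [e2, shiftedGradient_add, norm_shiftedGradient_zero]
    exact hK _

theorem cellInf_le_growth (hf : IsIntegrand p α β f) {t : ℝ} (ht : 0 < t) (ξ : Cols 2) :
    cellInf f T t ξ ≤ β * (1 + ‖ξ‖ ^ p) := by
  have h0 : IsStripField T (sqAt 0 t) (fun _ => 0) (fun _ => 0) := isStripField_zero _
  refine (cellInf_le hf h0).trans ?_
  have h := setIntegral_le_of_norm_le hf (volume_prism_sqAt_ne_top 0 t)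
    (memLp_shiftedGradient (volume_prism_sqAt_ne_top 0 t) ξ (h0.memLp_grad _))
    (isOpen_prism (isOpen_sqAt _ _)).measurableSet (K := ‖ξ‖)
    fun x _ => (norm_shiftedGradient_zero ξ).le
  rw [measureReal_def, volume_prism_sqAt _ ht.le, ENNReal.toReal_ofReal (sq_nonneg _)] at h
  rw [one_div, inv_mul_le_iff₀ (by positivity)]
  linarith

end cellInf

/-! ### Existence of the limit and the central upper bound -/

section homogenization

variable {p α β : ℝ} {f : Euc 3 → Cols 3 → ℝ} {T : Submodule ℝ (Euc 3)}

/-- The vector `(m k_1, m k_2, 0)` for integers `k_1`, `k_2` and a natural number `m`. -/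
noncomputable def latticeVec (m : ℕ) (k : Fin 2 → ℤ) : Euc 3 :=
  ((m : ℤ) * k 0) • EuclideanSpace.single 0 (1 : ℝ) + ((m : ℤ) * k 1) • EuclideanSpace.single 1 (1 : ℝ)

theorem latticeVec_two (m : ℕ) (k : Fin 2 → ℤ) : latticeVec m k 2 = 0 := by
  simp [latticeVec]

theorem inPlane_latticeVec (m : ℕ) (k : Fin 2 → ℤ) (j : Fin 2) :
    inPlane (latticeVec m k) j = m * k j := by
  fin_cases j <;> simp [latticeVec, inPlane]

theorem IsInPlanePeriodic.sub_latticeVec (hf : IsInPlanePeriodic f) (m : ℕ) (k : Fin 2 → ℤ)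
    (x : Euc 3) (ξ : Cols 3) : f (x - latticeVec m k) ξ = f x ξ := by
  have h0 : Function.Periodic (fun x => f x ξ) (EuclideanSpace.single 0 (1 : ℝ)) :=
    fun x => (hf x ξ).1
  have h1 : Function.Periodic (fun x => f x ξ) (EuclideanSpace.single 1 (1 : ℝ)) :=
    fun x => (hf x ξ).2
  exact ((h0.zsmul _).add_period (h1.zsmul _)).sub_eq x

theorem setIntegral_translate (hf : IsInPlanePeriodic f) (m : ℕ) (k : Fin 2 → ℤ) (l : ℝ)
    (ξ : Cols 2) (G : Euc 3 → Cols 3) :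
    ∫ x in prism (sqAt (inPlane (latticeVec m k)) l),
        f x (shiftedGradient ξ (G (x - latticeVec m k))) =
      ∫ x in prism (sqAt 0 l), f x (shiftedGradient ξ (G x)) := by
  set v := latticeVec m k with hv
  have hm : MeasurableSet (prism (sqAt 0 l)) := (isOpen_prism (isOpen_sqAt _ _)).measurableSet
  have hmp := (measurePreserving_sub_right (volume : Measure (Euc 3)) v).restrict_preimage hm
  have e : (fun x => x - v) ⁻¹' prism (sqAt 0 l) = prism (sqAt (inPlane v) l) := by
    ext x
    have hi : inPlane (x - v) = inPlane x - inPlane v := inPlaneL.map_sub x v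
    have h2 : v 2 = 0 := latticeVec_two m k
    simp [prism, sqAt, hi, h2]
  rw [e] at hmp
  have := hmp.integral_comp (Homeomorph.subRight v).measurableEmbedding
    fun x => f x (shiftedGradient ξ (G x))
  rw [← this]
  refine integral_congr_ae (Eventually.of_forall fun x => ?_)
  exact (hf.sub_latticeVec m k x _).symm

theorem colGrad_zero (y : Euc 2) : colGrad (fun _ => (0 : Euc 3)) y = 0 := by
  ext j : 1
  simp [colGrad_apply]

/-- A square of side `l` is filled by translates by lattice vectors of a field in a square of
side `t`, leaving a proportion of the area that is small when `1 ≪ t ≪ l`. -/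
theorem exists_filling_of_field (hf : IsIntegrand p α β f) {ξ : Cols 2} {t e : ℝ} (ht : 0 < t)
    {φ : Euc 3 → Euc 3} {G : Euc 3 → Cols 3} (h : IsStripField T (sqAt 0 t) φ G)
    (he : ∫ x in prism (sqAt 0 t), f x (shiftedGradient ξ (G x)) ≤ t ^ 2 * e)
    {l : ℝ} (hl : 2 * (t + 1) ≤ l) (c : Euc 2) :
    ∃ (Φ : Euc 3 → Euc 3) (H : Euc 3 → Cols 3), IsStripField T (sqAt c l) Φ H ∧
      ∫ x in prism (sqAt c l), f x (shiftedGradient ξ (H x)) ≤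
        l ^ 2 * e + β * (1 + ‖ξ‖ ^ p) * (2 * l * (l / t + 2 * t)) := by
  have hβ := hf.beta_pos
  have he0 : 0 ≤ e := by
    have := (hf.setIntegral_nonneg (prism (sqAt 0 t)) (fun x => shiftedGradient ξ (G x))).trans he
    exact nonneg_of_mul_nonneg_right this (by positivity)
  -- The spacing is the least integer that is at least `t`: translations by its multiples are
  -- periods of `f`, and the translated squares of side `t` do not overlap.
  set m : ℕ := ⌈t⌉₊ with hmdef
  have hmt : t ≤ m := Nat.le_ceil t
  have hmt' : (m : ℝ) < t + 1 := Nat.ceil_lt_add_one ht.le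
  have hm0 : (0 : ℝ) < m := ht.trans_le hmt
  have hl0 : 0 < l := by linarith
  -- The centres must be multiples of `m` in an interval of length `l - m` around `c j`. Such an
  -- interval contains at least `⌊l / m⌋ - 1` of them, wherever `c j` lies.
  set n : ℕ := ⌊l / m⌋₊ - 1 with hn
  have hfl : 1 ≤ ⌊l / m⌋₊ := by
    rw [Nat.one_le_floor_iff, le_div_iff₀ hm0]; linarith
  have hnR : (n : ℝ) = ⌊l / m⌋₊ - 1 := by rw [hn]; push_cast [hfl]; rfl
  have hn1 : (n : ℝ) ≤ l / m - 1 := by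
    rw [hnR]; linarith [Nat.floor_le (show 0 ≤ l / m by positivity)]
  have hn2 : l / m - 2 ≤ n := by
    rw [hnR]; linarith [Nat.lt_floor_add_one (l / m)]
  -- The index of the first admissible multiple of `m` in each coordinate.
  set a : Fin 2 → ℤ := fun j => ⌈(c j - (l - m) / 2) / m⌉ with ha
  set k : (Fin 2 → Fin n) → Fin 2 → ℤ := fun i j => a j + (i j : ℤ) with hk
  have hkb : ∀ i j, |(m : ℝ) * k i j - c j| ≤ (l - m) / 2 := by
    intro i j
    have h1 : (c j - (l - m) / 2) / m ≤ a j := Int.le_ceil _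
    have h2 : (a j : ℝ) < (c j - (l - m) / 2) / m + 1 := Int.ceil_lt_add_one _
    have h3 : ((i j : ℕ) : ℝ) ≤ n - 1 := by
      have : (i j : ℕ) + 1 ≤ n := (i j).2
      have : (((i j : ℕ) + 1 : ℕ) : ℝ) ≤ n := by exact_mod_cast this
      push_cast at this
      linarith
    have h4 : (0 : ℝ) ≤ (i j : ℕ) := Nat.cast_nonneg _
    have h5 : ((k i j : ℤ) : ℝ) = a j + ((i j : ℕ) : ℝ) := by simp [hk]
    rw [h5]
    rw [div_le_iff₀ hm0] at h1
    have h6 : (a j : ℝ) + ((i j : ℕ) : ℝ) ≤ (c j - (l - m) / 2) / m + l / m - 1 := by linarith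
    have h7 : (m : ℝ) * (a j + ((i j : ℕ) : ℝ)) ≤ c j - (l - m) / 2 + l - m := by
      calc _ ≤ (m : ℝ) * ((c j - (l - m) / 2) / m + l / m - 1) := by gcongr
        _ = _ := by field_simp
    rw [abs_le]
    constructor <;> nlinarith
  set ctr : (Fin 2 → Fin n) → Euc 2 := fun i => inPlane (latticeVec m (k i)) with hctr
  have hctrj : ∀ i j, ctr i j = m * k i j := fun i j => inPlane_latticeVec _ _ _
  obtain ⟨Φ, H, hΦ, hE⟩ := exists_glued_field (T := T) (ξ := ξ) hf (c := c) hl0.le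
    (w := fun _ => 0) contDiff_const HasCompactSupport.zero
    (by rw [show tsupport (fun _ : Euc 2 => (0 : Euc 3)) = ∅ from tsupport_eq_empty_iff.2 rfl]
        exact Set.empty_subset _)
    (fun _ => T.zero_mem) (ctr := ctr) (l := fun _ => t) (fun _ => ht.le)
    (fun i y hy j => by
      have h1 := hy j
      rw [hctrj] at h1
      have h2 := hkb i j
      calc |y j - c j| = |(y j - m * k i j) + (m * k i j - c j)| := by ring_nf
        _ ≤ _ := abs_add_le _ _
        _ < t / 2 + (l - m) / 2 := add_lt_add_of_lt_of_le h1 h2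
        _ ≤ l / 2 := by linarith)
    (fun i i' hii => Set.disjoint_left.2 fun y hy hy' => by
      obtain ⟨j, hj⟩ := Function.ne_iff.1 hii
      have h1 := hy j
      have h2 := hy' j
      rw [hctrj, abs_lt] at h1 h2
      have h3 : k i j ≠ k i' j := fun h => hj (by
        have : ((i j : ℕ) : ℤ) = (i' j : ℕ) := by simpa [hk] using h
        exact Fin.ext (by exact_mod_cast this))
      have h4 : (m : ℝ) * |((k i j - k i' j : ℤ) : ℝ)| < t := by
        rw [show (m : ℝ) * |((k i j - k i' j : ℤ) : ℝ)| = |(m : ℝ) * ((k i j - k i' j : ℤ) : ℝ)| by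
          rw [abs_mul, abs_of_pos hm0], abs_lt]
        push_cast
        constructor <;> nlinarith
      have h5 : (1 : ℝ) ≤ |((k i j - k i' j : ℤ) : ℝ)| := by
        rw [← Int.cast_abs]
        exact_mod_cast Int.one_le_abs (sub_ne_zero.2 h3)
      nlinarith)
    (η := fun _ => 0) (fun _ y _ => colGrad_zero y)
    (φ := fun i x => φ (x - latticeVec m (k i))) (G := fun i x => G (x - latticeVec m (k i)))
    (fun i => (h.translate _ (latticeVec_two _ _)).mono fun y hy j => by simpa using hy j)
    (K := ‖ξ‖) (fun y => by rw [colGrad_zero, add_zero])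
  refine ⟨Φ, H, hΦ, hE.trans ?_⟩
  simp only [add_zero, hctr, setIntegral_translate hf.periodic, Finset.sum_const,
    Finset.card_univ, Fintype.card_pi, Fintype.card_fin, Finset.prod_const, nsmul_eq_mul]
  push_cast
  have hnt : n * t ≤ l := by
    calc n * t ≤ (l / m) * m := by
          have : (n : ℝ) ≤ l / m := by linarith
          gcongr
      _ = l := by field_simp
  have hnt0 : 0 ≤ n * t := by positivity
  -- The term `l / t` comes from rounding `t` up to `m`, a loss of at most `1` per period; the term
  -- `2 * t` comes from the incomplete cells at the ends, through `n ≥ l / m - 2`.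
  have h1 : l - n * t ≤ l / t + 2 * t := by
    have h2 : (l / m - 2) * t ≤ n * t := by gcongr
    have h3 : l - l / m * t ≤ l / t := by
      have : l - l / m * t = l / m * (m - t) := by field_simp
      rw [this]
      calc l / m * (m - t) ≤ l / m * 1 := by gcongr; linarith
        _ ≤ l / t := by rw [mul_one]; gcongr
    linarith
  refine add_le_add ?_ ?_
  · calc _ ≤ (n : ℝ) ^ 2 * (t ^ 2 * e) := by gcongr
      _ = (n * t) ^ 2 * e := by ring
      _ ≤ l ^ 2 * e := by gcongr
  · gcongr
    calc l ^ 2 - (n : ℝ) ^ 2 * t ^ 2 = (l + n * t) * (l - n * t) := by ring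
      _ ≤ (2 * l) * (l / t + 2 * t) := by
        gcongr
        linarith

/-- One good scale `t`, found arbitrarily far out, controls every sufficiently large scale and every
position of the square. This is what upgrades a liminf to a limit. -/
theorem exists_filling (hf : IsIntegrand p α β f) {ξ : Cols 2} {L : ℝ}
    (hL : ∃ᶠ t in atTop, cellInf f T t ξ < L) {ε : ℝ} (hε : 0 < ε) :
    ∃ l₀ : ℝ, 0 < l₀ ∧ ∀ l, l₀ ≤ l → ∀ c : Euc 2,
      ∃ (Φ : Euc 3 → Euc 3) (H : Euc 3 → Cols 3), IsStripField T (sqAt c l) Φ H ∧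
        ∫ x in prism (sqAt c l), f x (shiftedGradient ξ (H x)) ≤ l ^ 2 * (L + ε) := by
  set B : ℝ := β * (1 + ‖ξ‖ ^ p) with hB
  have hB0 : 0 < B := by
    have := hf.beta_pos
    positivity
  -- With `t ≥ 4 * B / ε` the loss due to rounding, `B * (2 * l * (l / t))`, is at most `l ^ 2 * (ε
  -- / 2)`.
  obtain ⟨t, htL, ht⟩ := (hL.and_eventually (eventually_ge_atTop (4 * B / ε))).exists
  have ht0 : 0 < t := lt_of_lt_of_le (by positivity) ht
  obtain ⟨φ, G, h, hlt⟩ := exists_field_lt htL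
  have he : ∫ x in prism (sqAt 0 t), f x (shiftedGradient ξ (G x)) ≤ t ^ 2 * L := by
    rw [one_div, inv_mul_lt_iff₀ (by positivity)] at hlt
    exact hlt.le
  -- The second threshold makes the loss at the ends, `B * (2 * l * (2 * t))`, at most `l ^ 2 * (ε /
  -- 2)`.
  refine ⟨max (2 * (t + 1)) (8 * B * t / ε), by positivity, fun l hl c => ?_⟩
  have hl1 := (le_max_left _ _).trans hl
  have hl2 := (le_max_right _ _).trans hl
  have hl0 : 0 < l := by linarith
  obtain ⟨Φ, H, hΦ, hE⟩ := exists_filling_of_field hf ht0 h he hl1 c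
  refine ⟨Φ, H, hΦ, hE.trans ?_⟩
  rw [div_le_iff₀ hε] at ht hl2
  have h1 : B * (2 * l * (l / t)) ≤ l ^ 2 * (ε / 2) := by
    rw [mul_div_assoc', mul_div_assoc', div_le_iff₀ ht0]
    nlinarith [sq_nonneg l]
  have h2 : B * (2 * l * (2 * t)) ≤ l ^ 2 * (ε / 2) := by nlinarith
  calc l ^ 2 * L + B * (2 * l * (l / t + 2 * t)) =
      l ^ 2 * L + (B * (2 * l * (l / t)) + B * (2 * l * (2 * t))) := by ring
    _ ≤ l ^ 2 * L + (l ^ 2 * (ε / 2) + l ^ 2 * (ε / 2)) := by gcongr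
    _ = _ := by ring

/-- The homogenized density for fields with values in `T`. -/
noncomputable def cellHom (f : Euc 3 → Cols 3 → ℝ) (T : Submodule ℝ (Euc 3)) (ξ : Cols 2) : ℝ :=
  liminf (fun t : ℝ => cellInf f T t ξ) atTop

theorem isBoundedUnder_ge_cellInf (hf : IsIntegrand p α β f) (ξ : Cols 2) :
    IsBoundedUnder (· ≥ ·) atTop fun t => cellInf f T t ξ :=
  isBoundedUnder_of ⟨0, fun t => cellInf_nonneg hf t ξ⟩

theorem isBoundedUnder_le_cellInf (hf : IsIntegrand p α β f) (ξ : Cols 2) :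
    IsBoundedUnder (· ≤ ·) atTop fun t => cellInf f T t ξ :=
  isBoundedUnder_of_eventually_le (a := β * (1 + ‖ξ‖ ^ p)) (by
    filter_upwards [eventually_gt_atTop 0] with t ht using cellInf_le_growth hf ht ξ)

theorem frequently_cellInf_lt (hf : IsIntegrand p α β f) (ξ : Cols 2) {ε : ℝ} (hε : 0 < ε) :
    ∃ᶠ t in atTop, cellInf f T t ξ < cellHom f T ξ + ε :=
  frequently_lt_of_liminf_lt (isBoundedUnder_le_cellInf hf ξ).isCoboundedUnder_ge
    (by unfold cellHom; linarith)

/-- The lower bound is the definition of the liminf. For the upper bound, the filling of a large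
square has mean energy at most `cellHom f T ξ + 2 * ε`. -/
theorem tendsto_cellInf (hf : IsIntegrand p α β f) (ξ : Cols 2) :
    Tendsto (fun t => cellInf f T t ξ) atTop (𝓝 (cellHom f T ξ)) := by
  refine tendsto_order.2 ⟨fun b hb => eventually_lt_of_lt_liminf hb
    (isBoundedUnder_ge_cellInf hf ξ), fun b hb => ?_⟩
  have hε : 0 < (b - cellHom f T ξ) / 3 := by linarith
  obtain ⟨l₀, hl₀, h⟩ := exists_filling hf (frequently_cellInf_lt (T := T) hf ξ hε) hε
  filter_upwards [eventually_ge_atTop l₀] with l hl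
  obtain ⟨Φ, H, hΦ, hE⟩ := h l hl 0
  have hl0 := hl₀.trans_le hl
  refine (cellInf_le hf hΦ).trans_lt ?_
  rw [one_div, inv_mul_lt_iff₀ (by positivity)]
  refine hE.trans_lt ?_
  have : 0 < l ^ 2 := by positivity
  gcongr
  linarith

theorem cellHom_nonneg (hf : IsIntegrand p α β f) (ξ : Cols 2) : 0 ≤ cellHom f T ξ :=
  ge_of_tendsto' (tendsto_cellInf hf ξ) fun t => cellInf_nonneg hf t ξ

theorem cellHom_le (hf : IsIntegrand p α β f) (ξ : Cols 2) :
    cellHom f T ξ ≤ β * (1 + ‖ξ‖ ^ p) :=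
  le_of_tendsto (tendsto_cellInf hf ξ) (by
    filter_upwards [eventually_gt_atTop 0] with t ht using cellInf_le_growth hf ht ξ)

theorem mem_sqAt_smul {t : ℝ} (ht : 0 < t) {c y : Euc 2} {l : ℝ} :
    y ∈ sqAt (t • c) (t * l) ↔ t⁻¹ • y ∈ sqAt c l := by
  refine forall_congr' fun i => ?_
  have : |y i - (t • c) i| = t * |(t⁻¹ • y) i - c i| := by
    rw [← abs_of_pos ht, ← abs_mul, abs_of_pos ht]
    simp only [PiLp.smul_apply, smul_eq_mul]
    congr 1
    field_simp
  rw [this, mul_div_assoc, mul_lt_mul_iff_right₀ ht]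

/-- This scaling enlarges the squares without changing the values of the gradient, so the
configuration can be blown up while the matrices `η i` stay fixed. -/
theorem colGrad_rescale {W : Euc 2 → Euc 3} (hW : Differentiable ℝ W) {t : ℝ} (ht : t ≠ 0)
    (y : Euc 2) : colGrad (fun y => t • W (t⁻¹ • y)) y = colGrad W (t⁻¹ • y) := by
  have h1 : HasFDerivAt (fun y : Euc 2 => t⁻¹ • y) (t⁻¹ • ContinuousLinearMap.id ℝ (Euc 2)) y :=
    (hasFDerivAt_id y).const_smul t⁻¹
  have h2 := ((hW _).hasFDerivAt.comp y h1).const_smul t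
  ext j : 1
  rw [colGrad_apply, colGrad_apply]
  have h3 : fderiv ℝ (fun y => t • W (t⁻¹ • y)) y = _ := h2.fderiv
  rw [h3]
  simp [smul_smul, ht]

/-- The homogenized density at `ξ` is bounded by the energy of a compactly supported perturbation
that is affine on finitely many disjoint squares. -/
theorem cellHom_le_of_squares (hf : IsIntegrand p α β f) {ξ : Cols 2} {R : ℝ} (hR : 0 < R)
    {W : Euc 2 → Euc 3} (hW : ContDiff ℝ ∞ W) (hWs : HasCompactSupport W)
    (hWt : tsupport W ⊆ sqAt 0 R) (hWT : ∀ y, W y ∈ T) {ι : Type*} [Fintype ι]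
    {ctr : ι → Euc 2} {l : ι → ℝ} (hl : ∀ i, 0 < l i)
    (hsub : ∀ i, sqAt (ctr i) (l i) ⊆ sqAt 0 R)
    (hdisj : Pairwise (Function.onFun Disjoint fun i => sqAt (ctr i) (l i)))
    {η : ι → Cols 2} (hη : ∀ i, ∀ y ∈ sqAt (ctr i) (l i), colGrad W y = η i)
    {K : ℝ} (hK : ∀ y, ‖ξ + colGrad W y‖ ≤ K) :
    R ^ 2 * cellHom f T ξ ≤ ∑ i, l i ^ 2 * cellHom f T (ξ + η i) +
      β * (1 + K ^ p) * (R ^ 2 - ∑ i, l i ^ 2) := by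
  have step : ∀ ε : ℝ, 0 < ε → R ^ 2 * cellHom f T ξ ≤
      ∑ i, l i ^ 2 * (cellHom f T (ξ + η i) + ε) + β * (1 + K ^ p) * (R ^ 2 - ∑ i, l i ^ 2) := by
    intro ε hε
    -- Once `t * l i` exceeds the threshold for `ξ + η i`, the `i`-th blown-up square is filled by a
    -- nearly optimal field. All areas carry the factor `t ^ 2`, which cancels at the end.
    have hfill := fun i => exists_filling hf
      (frequently_cellInf_lt (T := T) hf (ξ + η i) (half_pos hε)) (half_pos hε)
    choose l₀ hl₀ hfill using hfill
    have hlim : Tendsto (fun t : ℝ => R ^ 2 * cellInf f T (t * R) ξ) atTop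
        (𝓝 (R ^ 2 * cellHom f T ξ)) :=
      ((tendsto_cellInf hf ξ).comp (tendsto_id.atTop_mul_const hR)).const_mul _
    refine le_of_tendsto hlim ?_
    have hev : ∀ i, ∀ᶠ t : ℝ in atTop, l₀ i ≤ t * l i := fun i =>
      (tendsto_id.atTop_mul_const (hl i)).eventually_ge_atTop _
    filter_upwards [eventually_gt_atTop 0, eventually_all.2 hev] with t ht htl
    choose φ G hφ hE using fun i => hfill i (t * l i) (htl i) (t • ctr i)
    have hWd : Differentiable ℝ W := hW.differentiable (by simp)
    have hwt : tsupport (fun y => t • W (t⁻¹ • y)) ⊆ (fun y => t⁻¹ • y) ⁻¹' tsupport W :=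
      (tsupport_smul_subset_right (fun _ => t) _).trans
        (tsupport_comp_eq_preimage W (Homeomorph.smulOfNeZero t⁻¹ (inv_ne_zero ht.ne'))).le
    set w : Euc 2 → Euc 3 := fun y => t • W (t⁻¹ • y) with hw
    have hwc : ContDiff ℝ ∞ w := (hW.comp (contDiff_id.const_smul t⁻¹)).const_smul t
    have hws : HasCompactSupport w :=
      (hWs.comp_homeomorph (Homeomorph.smulOfNeZero t⁻¹ (inv_ne_zero ht.ne'))).smul_left
        (f := fun _ => t)
    have hgrad : ∀ y, colGrad w y = colGrad W (t⁻¹ • y) := colGrad_rescale hWd ht.ne'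
    obtain ⟨Φ, H, hΦ, hEn⟩ := exists_glued_field (T := T) (ξ := ξ) hf (c := t • (0 : Euc 2))
      (t := t * R) (by positivity) hwc hws
      (fun y hy => (mem_sqAt_smul ht).2 (hWt (hwt hy)))
      (fun y => T.smul_mem _ (hWT _)) (ctr := fun i => t • ctr i) (l := fun i => t * l i)
      (fun i => (mul_pos ht (hl i)).le)
      (fun i y hy => (mem_sqAt_smul ht).2 (hsub i ((mem_sqAt_smul ht).1 hy)))
      (fun i j hij => Set.disjoint_left.2 fun y hy hy' => Set.disjoint_left.1 (hdisj hij)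
        ((mem_sqAt_smul ht).1 hy) ((mem_sqAt_smul ht).1 hy'))
      (η := η) (fun i y hy => by
        rw [hgrad]
        exact hη i _ ((mem_sqAt_smul ht).1 hy)) hφ
      (K := K) (fun y => by rw [hgrad]; exact hK _)
    rw [smul_zero] at hΦ hEn
    have h1 := cellInf_le hf (ξ := ξ) hΦ
    rw [one_div, le_inv_mul_iff₀ (by positivity)] at h1
    have h2 : (t * R) ^ 2 * cellInf f T (t * R) ξ ≤
        ∑ i, (t * l i) ^ 2 * (cellHom f T (ξ + η i) + ε / 2 + ε / 2) +
          β * (1 + K ^ p) * ((t * R) ^ 2 - ∑ i, (t * l i) ^ 2) :=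
      h1.trans (hEn.trans (add_le_add (Finset.sum_le_sum fun i _ => hE i) le_rfl))
    have ht2 : 0 < t ^ 2 := by positivity
    refine le_of_mul_le_mul_left ?_ ht2
    calc t ^ 2 * (R ^ 2 * cellInf f T (t * R) ξ) = (t * R) ^ 2 * cellInf f T (t * R) ξ := by ring
      _ ≤ _ := h2
      _ = _ := by
        have e1 : ∑ i, (t * l i) ^ 2 = t ^ 2 * ∑ i, l i ^ 2 := by
          rw [Finset.mul_sum]
          exact Finset.sum_congr rfl fun i _ => by ring
        have e2 : ∑ i, (t * l i) ^ 2 * (cellHom f T (ξ + η i) + ε / 2 + ε / 2) =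
            t ^ 2 * ∑ i, l i ^ 2 * (cellHom f T (ξ + η i) + ε) := by
          rw [Finset.mul_sum]
          exact Finset.sum_congr rfl fun i _ => by ring
        rw [e1, e2]
        ring
  refine le_of_forall_pos_le_add fun ε hε => ?_
  have hS : 0 ≤ ∑ i, l i ^ 2 := Finset.sum_nonneg fun i _ => sq_nonneg _
  have h := step (ε / (∑ i, l i ^ 2 + 1)) (by positivity)
  simp only [mul_add, Finset.sum_add_distrib] at h ⊢
  rw [← Finset.sum_mul] at h
  have h2 : (∑ i, l i ^ 2) * (ε / (∑ i, l i ^ 2 + 1)) ≤ ε := by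
    rw [mul_div_assoc', div_le_iff₀ (by positivity)]
    nlinarith
  linarith

end homogenization

/-! ### Replacing a smooth field by affine ones on squares -/

section patch

/-- The constant in the bound for the derivatives of the cutoffs `boxCutoff`. -/
noncomputable def cutoffConst : ℝ := Classical.choose exists_fderiv_boxCutoff_bound

theorem cutoffConst_pos : 0 < cutoffConst :=
  (Classical.choose_spec exists_fderiv_boxCutoff_bound).1

/-- A cutoff equal to `1` on `sqAt c r` and supported in `sqAt c (r + 4 * d)`. -/
noncomputable def squareCutoff (c : Euc 2) (r d : ℝ) (y : Euc 2) : ℝ :=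
  boxCutoff Finset.univ (fun _ => r / 2) (fun _ => d) (y - c)

variable {c y : Euc 2} {r d : ℝ}

theorem squareCutoff_contDiff (c : Euc 2) (r d : ℝ) : ContDiff ℝ ∞ (squareCutoff c r d) :=
  (boxCutoff_contDiff _ _ _).comp (contDiff_id.sub contDiff_const)

theorem fderiv_squareCutoff (c : Euc 2) (r d : ℝ) (y : Euc 2) :
    fderiv ℝ (squareCutoff c r d) y =
      fderiv ℝ (boxCutoff Finset.univ (fun _ => r / 2) fun _ => d) (y - c) := by
  unfold squareCutoff
  rw [fderiv_comp_sub]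

theorem abs_fderiv_squareCutoff_le (hd : 0 < d) (j : Fin 2) :
    |fderiv ℝ (squareCutoff c r d) y (EuclideanSpace.single j 1)| ≤ cutoffConst / d := by
  rw [fderiv_squareCutoff]
  exact (Classical.choose_spec exists_fderiv_boxCutoff_bound).2 2 _ _ _ _ j fun _ => hd

theorem squareCutoff_eq_one (hd : 0 < d) (hy : y ∈ sqAt c r) : squareCutoff c r d y = 1 :=
  boxCutoff_eq_one (fun _ => hd) fun i _ => (hy i).le

theorem fderiv_squareCutoff_eq_zero (hd : 0 < d) (hy : y ∈ sqAt c r) (j : Fin 2) :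
    fderiv ℝ (squareCutoff c r d) y (EuclideanSpace.single j 1) = 0 := by
  rw [fderiv_squareCutoff]
  exact fderiv_boxCutoff_single_eq_zero (fun _ => hd) fun _ => Or.inl (hy j).le

/-- The cutoff ends at half-side `r / 2 + d`. The half-side `r / 2 + 2 * d` leaves room for the
closed support to lie in an open square. -/
theorem tsupport_squareCutoff_subset (hd : 0 < d) :
    tsupport (squareCutoff c r d) ⊆ sqAt c (r + 4 * d) := by
  intro y hy i
  have h1 : tsupport (squareCutoff c r d) ⊆ (fun y => y - c) ⁻¹' _ :=
    (tsupport_comp_eq_preimage _ (Homeomorph.subRight c)).le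
  have h2 := tsupport_boxCutoff_subset (fun _ => hd) (h1 hy) i (Finset.mem_univ i)
  simp only [PiLp.sub_apply] at h2
  linarith

theorem norm_sub_le_of_mem_sqAt {l : ℝ} (hy : y ∈ sqAt c l) : ‖y - c‖ ≤ l := by
  have h0 := hy 0
  have h1 := hy 1
  have hl : 0 ≤ l := by linarith [abs_nonneg (y 0 - c 0)]
  rw [EuclideanSpace.norm_eq, Fin.sum_univ_two, Real.sqrt_le_left hl]
  simp only [PiLp.sub_apply, Real.norm_eq_abs]
  nlinarith [abs_nonneg (y 0 - c 0), abs_nonneg (y 1 - c 1)]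

theorem hasCompactSupport_of_tsupport_subset {E : Type*} [Zero E] {w : Euc 2 → E} {c : Euc 2}
    {l : ℝ} (h : tsupport w ⊆ sqAt c l) : HasCompactSupport w :=
  (isCompact_closedBall c l).of_isClosed_subset (isClosed_tsupport w) fun y hy => by
    rw [mem_closedBall_iff_norm]
    exact norm_sub_le_of_mem_sqAt (h hy)

/-- The matrix of a linear map, by columns. -/
noncomputable def linCols {k : ℕ} (A : Euc k →L[ℝ] Euc 3) : Cols k :=
  WithLp.toLp 2 fun j => A (EuclideanSpace.single j 1)

theorem norm_cols_le {A : Cols 2} {a : ℝ} (h : ∀ j, ‖A j‖ ≤ a) : ‖A‖ ≤ 2 * a := by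
  have ha : 0 ≤ a := (norm_nonneg _).trans (h 0)
  rw [PiLp.norm_eq_of_L2, Real.sqrt_le_left (by positivity), Fin.sum_univ_two]
  nlinarith [h 0, h 1, norm_nonneg (A 0), norm_nonneg (A 1)]

theorem norm_col_le {k : ℕ} (A : Cols k) (j : Fin k) : ‖A j‖ ≤ ‖A‖ := PiLp.norm_apply_le A j

variable {p α β : ℝ} {f : Euc 3 → Cols 3 → ℝ} {T : Submodule ℝ (Euc 3)}

theorem colGrad_add_sum_smul {ι : Type*} [Fintype ι] {ψ : Euc 2 → Euc 3} (hψ : ContDiff ℝ ∞ ψ)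
    {χ : ι → Euc 2 → ℝ} (hχ : ∀ i, ContDiff ℝ ∞ (χ i)) {ctr : ι → Euc 2} {b : ι → Euc 3}
    (A : ι → Euc 2 →L[ℝ] Euc 3) (y : Euc 2) (j : Fin 2) :
    colGrad (fun y => ψ y + ∑ i, χ i y • (b i + A i (y - ctr i) - ψ y)) y j = colGrad ψ y j +
      ∑ i, (fderiv ℝ (χ i) y (EuclideanSpace.single j 1) • (b i + A i (y - ctr i) - ψ y) +
        χ i y • ((A i - fderiv ℝ ψ y) (EuclideanSpace.single j 1))) := by
  have h1 : ∀ i, HasFDerivAt (fun y => b i + A i (y - ctr i) - ψ y) (A i - fderiv ℝ ψ y) y :=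
    fun i => by
      have e1 : HasFDerivAt (fun y => b i + A i (y - ctr i)) (A i) y := by
        have := ((A i).hasFDerivAt (x := y - ctr i)).comp y
          ((hasFDerivAt_id y).sub_const (ctr i))
        exact this.const_add (b i)
      exact e1.sub (hψ.differentiable (by simp) y).hasFDerivAt
  have h2 := (hψ.differentiable (by simp) y).hasFDerivAt.fun_add
      (HasFDerivAt.fun_sum fun i (_ : i ∈ Finset.univ) =>
        ((hχ i).differentiable (by simp) y).hasFDerivAt.fun_smul (h1 i))
  rw [colGrad_apply, h2.fderiv, add_apply, sum_apply,
    colGrad_apply]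
  congr 1
  refine Finset.sum_congr rfl fun i _ => ?_
  rw [add_apply, smul_apply,
    ContinuousLinearMap.smulRight_apply, add_comm]

/-- Upper bound for the homogenized density by replacing a smooth field `ψ` by affine functions
on disjoint squares. -/
theorem cellHom_le_of_patches (hf : IsIntegrand p α β f) {ξ : Cols 2} {R : ℝ} (hR : 0 < R)
    {ψ : Euc 2 → Euc 3} (hψ : ContDiff ℝ ∞ ψ) (hψs : tsupport ψ ⊆ sqAt 0 R)
    (hψT : ∀ y, ψ y ∈ T) {ι : Type*} [Fintype ι] {ctr : ι → Euc 2}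
    {r d : ℝ} (hr : 0 < r) (hd : 0 < d)
    (hsub : ∀ i, sqAt (ctr i) (r + 4 * d) ⊆ sqAt 0 R)
    (hdisj : Pairwise (Function.onFun Disjoint fun i => sqAt (ctr i) (r + 4 * d)))
    {A : ι → Euc 2 →L[ℝ] Euc 3} (hA : ∀ i v, A i v ∈ T)
    {b : ι → Euc 3} (hb : ∀ i, b i ∈ T) {κ μ L : ℝ} (hκ0 : 0 ≤ κ) (hμ0 : 0 ≤ μ)
    (hκ : ∀ i, ∀ y ∈ sqAt (ctr i) (r + 4 * d), ‖b i + A i (y - ctr i) - ψ y‖ ≤ κ)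
    (hμ : ∀ i, ∀ y ∈ sqAt (ctr i) (r + 4 * d), ‖A i - fderiv ℝ ψ y‖ ≤ μ)
    (hL : ∀ y, ‖ξ + colGrad ψ y‖ ≤ L) :
    R ^ 2 * cellHom f T ξ ≤ ∑ i, r ^ 2 * cellHom f T (ξ + linCols (A i)) +
      β * (1 + (L + 2 * (μ + cutoffConst / d * κ)) ^ p) * (R ^ 2 - Fintype.card ι * r ^ 2) := by
  have hC := cutoffConst_pos
  set χ : ι → Euc 2 → ℝ := fun i => squareCutoff (ctr i) r d with hχ
  have hχs : ∀ i, ContDiff ℝ ∞ (χ i) := fun i => squareCutoff_contDiff _ _ _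
  set g : ι → Euc 2 → Euc 3 := fun i y => b i + A i (y - ctr i) - ψ y with hg
  have hgs : ∀ i, ContDiff ℝ ∞ (g i) := fun i =>
    (contDiff_const.add ((A i).contDiff.comp (contDiff_id.sub contDiff_const))).sub hψ
  -- `W` is `ψ` away from the patches and the affine function `b i + A i (y - ctr i)` on the inner
  -- square of the `i`-th patch; `χ i` interpolates in the collar.
  set W : Euc 2 → Euc 3 := fun y => ψ y + ∑ i, χ i y • g i y with hWdef
  have hWs : ContDiff ℝ ∞ W := hψ.add (ContDiff.sum fun i _ => (hχs i).smul (hgs i))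
  have hout : ∀ i y, y ∉ sqAt (ctr i) (r + 4 * d) → y ∉ tsupport (χ i) :=
    fun i y hy h => hy (tsupport_squareCutoff_subset hd h)
  have hgrad : ∀ y j, colGrad W y j = colGrad ψ y j +
      ∑ i, (fderiv ℝ (χ i) y (EuclideanSpace.single j 1) • g i y +
        χ i y • ((A i - fderiv ℝ ψ y) (EuclideanSpace.single j 1))) := by
    intro y j
    exact colGrad_add_sum_smul hψ hχs A y j
  have hterm0 : ∀ i y j, y ∉ sqAt (ctr i) (r + 4 * d) →
      fderiv ℝ (χ i) y (EuclideanSpace.single j 1) • g i y +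
        χ i y • ((A i - fderiv ℝ ψ y) (EuclideanSpace.single j 1)) = 0 := fun i y j hy => by
    rw [fderiv_apply_eq_zero_of_notMem_tsupport (hout i y hy),
      image_eq_zero_of_notMem_tsupport (hout i y hy), zero_smul, zero_smul, add_zero]
  have hsingle : ∀ i y j, y ∈ sqAt (ctr i) (r + 4 * d) → colGrad W y j = colGrad ψ y j +
      (fderiv ℝ (χ i) y (EuclideanSpace.single j 1) • g i y +
        χ i y • ((A i - fderiv ℝ ψ y) (EuclideanSpace.single j 1))) := fun i y j hy => by
    rw [hgrad, Finset.sum_eq_single i (fun i' _ hi' => hterm0 i' y j fun hy' =>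
      Set.disjoint_left.1 (hdisj hi') hy' hy) (by simp)]
  have hsq : ∀ i, sqAt (ctr i) r ⊆ sqAt (ctr i) (r + 4 * d) := fun i y hy j =>
    (hy j).trans (by linarith)
  have hK : ∀ y, ‖ξ + colGrad W y‖ ≤ L + 2 * (μ + cutoffConst / d * κ) := by
    intro y
    -- Per column, interpolating the gradients costs `μ` and differentiating the cutoff costs
    -- `cutoffConst / d * κ`. The factor `2` passes from columns to the matrix norm.
    have hdiff : ‖colGrad W y - colGrad ψ y‖ ≤ 2 * (μ + cutoffConst / d * κ) := by
      refine norm_cols_le fun j => ?_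
      rw [PiLp.sub_apply]
      by_cases hy : ∃ i, y ∈ sqAt (ctr i) (r + 4 * d)
      · obtain ⟨i, hi⟩ := hy
        rw [hsingle i y j hi, add_sub_cancel_left]
        refine (norm_add_le _ _).trans ?_
        rw [add_comm, norm_smul, norm_smul]
        have h1 : ‖χ i y‖ ≤ 1 := by
          rw [Real.norm_eq_abs, abs_le]
          exact ⟨by linarith [show 0 ≤ χ i y from boxCutoff_nonneg], boxCutoff_le_one⟩
        have h2 : ‖(A i - fderiv ℝ ψ y) (EuclideanSpace.single j 1)‖ ≤ μ := by
          refine ((A i - fderiv ℝ ψ y).le_opNorm _).trans ?_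
          simpa using hμ i y hi
        refine add_le_add ?_ ?_
        · calc _ ≤ 1 * μ := by gcongr
            _ = μ := one_mul μ
        · have h3 := abs_fderiv_squareCutoff_le (c := ctr i) (y := y) (r := r) hd j
          have h4 := hκ i y hi
          rw [Real.norm_eq_abs]
          gcongr
      · push Not at hy
        rw [hgrad, Finset.sum_eq_zero fun i _ => hterm0 i y j (hy i), add_zero, sub_self, norm_zero]
        positivity
    calc ‖ξ + colGrad W y‖ = ‖(ξ + colGrad ψ y) + (colGrad W y - colGrad ψ y)‖ := by
          congr 1; abel
      _ ≤ _ := (norm_add_le _ _).trans (add_le_add (hL y) hdiff)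
  have hWt : tsupport W ⊆ sqAt 0 R := by
    have hcl : IsClosed (tsupport ψ ∪ ⋃ i, tsupport (χ i)) :=
      (isClosed_tsupport _).union (isClosed_iUnion_of_finite fun i => isClosed_tsupport _)
    refine (closure_minimal (fun y hy => ?_) hcl).trans (Set.union_subset hψs
      (Set.iUnion_subset fun i => (tsupport_squareCutoff_subset hd).trans (hsub i)))
    by_contra hcon
    simp only [Set.mem_union, Set.mem_iUnion, not_or, not_exists] at hcon
    refine hy ?_
    simp only [hWdef]
    rw [image_eq_zero_of_notMem_tsupport hcon.1, zero_add]
    exact Finset.sum_eq_zero fun i _ => by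
      rw [image_eq_zero_of_notMem_tsupport (hcon.2 i), zero_smul]
  have := cellHom_le_of_squares (T := T) hf (ξ := ξ) hR hWs
    (hasCompactSupport_of_tsupport_subset hWt) hWt
    (fun y => T.add_mem (hψT y) (T.sum_mem fun i _ => T.smul_mem _
      (T.sub_mem (T.add_mem (hb i) (hA i _)) (hψT y))))
    (ctr := ctr) (l := fun _ => r) (fun _ => hr) (fun i => (hsq i).trans (hsub i))
    (fun i j hij => (hdisj hij).mono (hsq i) (hsq j)) (η := fun i => linCols (A i))
    (fun i y hy => by
      ext j : 1
      rw [hsingle i y j (hsq i hy), fderiv_squareCutoff_eq_zero hd hy j,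
        show χ i y = 1 from squareCutoff_eq_one hd hy, zero_smul, zero_add, one_smul,
        colGrad_apply]
      simp [linCols])
    (K := L + 2 * (μ + cutoffConst / d * κ)) hK
  simpa using this

end patch

/-! ### The local Lipschitz estimate and continuity -/

section regularity

variable {p α β : ℝ} {f : Euc 3 → Cols 3 → ℝ} {T : Submodule ℝ (Euc 3)}

/-- The linear map with the given columns. -/
noncomputable def colsLin (ξ : Cols 2) : Euc 2 →L[ℝ] Euc 3 :=
  ∑ j, (EuclideanSpace.proj (𝕜 := ℝ) j : Euc 2 →L[ℝ] ℝ).smulRight (ξ j)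

theorem colsLin_apply (ξ : Cols 2) (v : Euc 2) : colsLin ξ v = ∑ j, v j • ξ j := by
  simp [colsLin]

theorem linCols_colsLin (ξ : Cols 2) : linCols (colsLin ξ) = ξ := by
  ext j : 1
  simp only [linCols, colsLin_apply]
  fin_cases j <;> simp

theorem norm_colsLin_le (ξ : Cols 2) : ‖colsLin ξ‖ ≤ 2 * ‖ξ‖ := by
  refine ContinuousLinearMap.opNorm_le_bound _ (by positivity) fun v => ?_
  rw [colsLin_apply, Fin.sum_univ_two]
  refine (norm_add_le _ _).trans ?_
  rw [norm_smul, norm_smul]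
  have h : ∀ j, ‖v j‖ * ‖ξ j‖ ≤ ‖v‖ * ‖ξ‖ := fun j =>
    mul_le_mul (PiLp.norm_apply_le v j) (norm_col_le ξ j) (norm_nonneg _) (norm_nonneg _)
  linarith [h 0, h 1]

/-- A field with gradient `ξ' - ξ` on the unit square is cut off to zero inside the square of side
`1 + δ`. The energy is that of `ξ'` on the unit square plus the growth bound on a collar of area at
most `3 * δ`. -/
theorem cellHom_le_add (hf : IsIntegrand p α β f) {ξ ξ' : Cols 2} (h : ColsIn T ξ)
    (h' : ColsIn T ξ') {δ : ℝ} (hδ : 0 < δ) (hδ1 : δ ≤ 1) :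
    cellHom f T ξ ≤ cellHom f T ξ' +
      β * (1 + (‖ξ‖ + 2 * (2 * ‖ξ' - ξ‖ + cutoffConst / (δ / 4) * (4 * ‖ξ' - ξ‖))) ^ p) *
        (3 * δ) := by
  have hC := cutoffConst_pos
  have hβ := hf.beta_pos
  set A := colsLin (ξ' - ξ) with hA
  have hAn : ‖A‖ ≤ 2 * ‖ξ' - ξ‖ := norm_colsLin_le _
  have e : (1 : ℝ) + 4 * (δ / 4) = 1 + δ := by ring
  -- The choice `d = δ / 4` makes the patch the whole square of side `1 + δ`. The bound `κ = 4 * ‖ξ'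
  -- - ξ‖` combines `‖A‖ ≤ 2 * ‖ξ' - ξ‖` with `‖y‖ ≤ 1 + δ ≤ 2`.
  have key := cellHom_le_of_patches (T := T) hf (ξ := ξ) (R := 1 + δ) (by linarith)
    (ψ := fun _ => 0) contDiff_const
    (by rw [show tsupport (fun _ : Euc 2 => (0 : Euc 3)) = ∅ from tsupport_eq_empty_iff.2 rfl]
        exact Set.empty_subset _)
    (fun _ => T.zero_mem) (ι := Unit) (ctr := fun _ => 0) one_pos (d := δ / 4) (by linarith)
    (fun _ => by rw [e]) (fun i j hij => (hij rfl).elim) (A := fun _ => A)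
    (fun _ v => by
      rw [hA, colsLin_apply]
      exact T.sum_mem fun j _ => T.smul_mem _ (T.sub_mem (h' j) (h j)))
    (b := fun _ => 0) (fun _ => T.zero_mem) (κ := 4 * ‖ξ' - ξ‖) (μ := 2 * ‖ξ' - ξ‖) (L := ‖ξ‖)
    (by positivity) (by positivity)
    (fun _ y hy => by
      rw [e] at hy
      have h1 := norm_sub_le_of_mem_sqAt hy
      rw [zero_add, sub_zero]
      calc ‖A (y - 0)‖ ≤ ‖A‖ * ‖y - 0‖ := A.le_opNorm _
        _ ≤ (2 * ‖ξ' - ξ‖) * 2 := by gcongr; linarith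
        _ = _ := by ring)
    (fun _ y _ => by simpa using hAn)
    (fun y => by rw [colGrad_zero, add_zero])
  simp only [Finset.univ_unique, Finset.sum_singleton, Fintype.card_unit, hA, linCols_colsLin,
    add_sub_cancel, one_pow, one_mul, Nat.cast_one] at key
  have hn := cellHom_nonneg (T := T) hf ξ
  have h1 : cellHom f T ξ ≤ (1 + δ) ^ 2 * cellHom f T ξ :=
    le_mul_of_one_le_left hn (by nlinarith)
  refine h1.trans (key.trans ?_)
  gcongr
  nlinarith

theorem add_three_rpow_le {q a b : ℝ} (hq : 0 ≤ q) (ha : 0 ≤ a) (hb : 0 ≤ b) :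
    (1 + a + b) ^ q ≤ 3 ^ q * (1 + a ^ q + b ^ q) := by
  have key : ∀ m : ℝ, 0 ≤ m → 1 ≤ m → a ≤ m → b ≤ m → m ^ q ≤ 1 + a ^ q + b ^ q →
      (1 + a + b) ^ q ≤ 3 ^ q * (1 + a ^ q + b ^ q) := fun m hm h1 h2 h3 h4 => by
    calc (1 + a + b) ^ q ≤ (3 * m) ^ q := by gcongr; linarith
      _ = 3 ^ q * m ^ q := Real.mul_rpow (by norm_num) hm
      _ ≤ _ := by gcongr
  have ha' := Real.rpow_nonneg ha q
  have hb' := Real.rpow_nonneg hb q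
  rcases le_total a b with hab | hab
  · rcases le_total 1 b with h | h
    · exact key b hb h hab le_rfl (by linarith)
    · exact key 1 zero_le_one le_rfl (hab.trans h) h (by rw [Real.one_rpow]; linarith)
  · rcases le_total 1 a with h | h
    · exact key a ha h le_rfl hab (by linarith)
    · exact key 1 zero_le_one le_rfl h (hab.trans h) (by rw [Real.one_rpow]; linarith)

/-- The constant of the local Lipschitz estimate of the homogenized density. -/
noncomputable def lipConst (p β : ℝ) : ℝ :=
  3 * β * (1 + (1 + 2 * (2 + 16 * cutoffConst)) ^ p) * 3 ^ (p - 1)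

theorem lipConst_pos {p β : ℝ} (hβ : 0 < β) : 0 < lipConst p β := by
  have := cutoffConst_pos
  unfold lipConst
  positivity

/-- With `a = ‖ξ - ξ'‖` and `m = 1 + ‖ξ‖ + ‖ξ'‖`, the collar width `δ = a / m` keeps the gradient in
the collar of order `a / δ = m`. The collar then costs a multiple of `m ^ p * (a / m) = a * m ^ (p -
1)`, which is the claimed form. -/
theorem cellHom_sub_le (hf : IsIntegrand p α β f) {ξ ξ' : Cols 2} (h : ColsIn T ξ)
    (h' : ColsIn T ξ') : cellHom f T ξ - cellHom f T ξ' ≤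
      lipConst p β * ‖ξ - ξ'‖ * (1 + ‖ξ‖ ^ (p - 1) + ‖ξ'‖ ^ (p - 1)) := by
  have hp := hf.one_le
  have hβ := hf.beta_pos
  have hC := cutoffConst_pos
  rcases eq_or_ne ξ ξ' with rfl | hne
  · simp
  set m := 1 + ‖ξ‖ + ‖ξ'‖ with hm
  have hm1 : 1 ≤ m := by linarith [norm_nonneg ξ, norm_nonneg ξ']
  have hm0 : 0 < m := by linarith
  set a := ‖ξ - ξ'‖ with ha
  have ha0 : 0 < a := norm_pos_iff.2 (sub_ne_zero.2 hne)
  have ham : a ≤ m := (norm_sub_le _ _).trans (by linarith)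
  have h1 := cellHom_le_add (T := T) hf h h' (δ := a / m) (by positivity) (by
    rw [div_le_one hm0]; exact ham)
  rw [norm_sub_rev, ← ha] at h1
  have h2 : ‖ξ‖ + 2 * (2 * a + cutoffConst / (a / m / 4) * (4 * a)) ≤
      (1 + 2 * (2 + 16 * cutoffConst)) * m := by
    have : cutoffConst / (a / m / 4) * (4 * a) = 16 * cutoffConst * m := by field_simp; ring
    rw [this]
    nlinarith [norm_nonneg ξ']
  have h3 : (‖ξ‖ + 2 * (2 * a + cutoffConst / (a / m / 4) * (4 * a))) ^ p ≤
      (1 + 2 * (2 + 16 * cutoffConst)) ^ p * m ^ p := by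
    rw [← Real.mul_rpow (by positivity) hm0.le]
    exact Real.rpow_le_rpow (by positivity) h2 (by linarith)
  have h4 : 1 ≤ m ^ p := Real.one_le_rpow hm1 (by linarith)
  have h5 : m ^ p = m ^ (p - 1) * m := by
    rw [Real.rpow_sub_one hm0.ne']; field_simp
  have h6 := add_three_rpow_le (q := p - 1) (by linarith) (norm_nonneg ξ) (norm_nonneg ξ')
  calc cellHom f T ξ - cellHom f T ξ' ≤ β * (1 + (‖ξ‖ + 2 * (2 * a +
        cutoffConst / (a / m / 4) * (4 * a))) ^ p) * (3 * (a / m)) := by linarith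
    _ ≤ β * (m ^ p + (1 + 2 * (2 + 16 * cutoffConst)) ^ p * m ^ p) * (3 * (a / m)) := by
        gcongr
    _ = 3 * β * (1 + (1 + 2 * (2 + 16 * cutoffConst)) ^ p) * a * m ^ (p - 1) := by
        rw [h5]; field_simp
    _ ≤ 3 * β * (1 + (1 + 2 * (2 + 16 * cutoffConst)) ^ p) * a *
        (3 ^ (p - 1) * (1 + ‖ξ‖ ^ (p - 1) + ‖ξ'‖ ^ (p - 1))) := by gcongr
    _ = _ := by unfold lipConst; ring

theorem abs_cellHom_sub_le (hf : IsIntegrand p α β f) {ξ ξ' : Cols 2} (h : ColsIn T ξ)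
    (h' : ColsIn T ξ') : |cellHom f T ξ - cellHom f T ξ'| ≤
      lipConst p β * ‖ξ - ξ'‖ * (1 + ‖ξ‖ ^ (p - 1) + ‖ξ'‖ ^ (p - 1)) := by
  refine abs_sub_le_iff.2 ⟨cellHom_sub_le hf h h', ?_⟩
  have := cellHom_sub_le hf h' h
  rw [norm_sub_rev] at this
  linarith

theorem colsIn_colsMap_starProjection (ξ : Cols 2) : ColsIn T (colsMap T.starProjection ξ) :=
  fun j => by rw [colsMap_apply]; exact T.starProjection_apply_mem _

theorem colsMap_starProjection_eq {k : ℕ} {ξ : Cols k} (h : ColsIn T ξ) :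
    colsMap T.starProjection ξ = ξ := by
  ext j : 1
  rw [colsMap_apply]
  exact Submodule.starProjection_eq_self_iff.2 (h j)

/-- The Lipschitz estimate is available only on `[T]²`. Composing with the projection yields a
function continuous on all matrices, as measurability and limit arguments need. -/
theorem continuous_cellHom_proj (hf : IsIntegrand p α β f) :
    Continuous fun ξ => cellHom f T (colsMap T.starProjection ξ) := by
  have hp := hf.one_le
  refine continuous_iff_continuousAt.2 fun ξ₀ => ?_
  rw [ContinuousAt, tendsto_iff_dist_tendsto_zero]
  set P := colsMap (k := 2) T.starProjection
  have hc : Continuous fun ξ => lipConst p β * ‖P ξ - P ξ₀‖ *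
      (1 + ‖P ξ‖ ^ (p - 1) + ‖P ξ₀‖ ^ (p - 1)) := by
    have h1 : Continuous fun ξ => ‖P ξ‖ ^ (p - 1) :=
      P.continuous.norm.rpow_const fun _ => Or.inr (by linarith)
    exact (continuous_const.mul (P.continuous.sub continuous_const).norm).mul
      ((continuous_const.add h1).add continuous_const)
  have h0 := hc.tendsto ξ₀
  simp only [sub_self, norm_zero, mul_zero, zero_mul] at h0
  exact squeeze_zero (fun _ => dist_nonneg) (fun ξ => abs_cellHom_sub_le hf
    (colsIn_colsMap_starProjection _) (colsIn_colsMap_starProjection _)) h0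

theorem fderiv_apply_mem {ψ : Euc 2 → Euc 3} (hψ : Differentiable ℝ ψ) (hT : ∀ y, ψ y ∈ T)
    (y v : Euc 2) : fderiv ℝ ψ y v ∈ T := by
  have h1 : (fun y => T.starProjection (ψ y)) = ψ :=
    funext fun y => Submodule.starProjection_eq_self_iff.2 (hT y)
  have h2 := T.starProjection.hasFDerivAt.comp y (hψ y).hasFDerivAt
  have h3 : fderiv ℝ (fun y => T.starProjection (ψ y)) y = _ := h2.fderiv
  rw [h1] at h3
  rw [h3]
  exact T.starProjection_apply_mem _

theorem colsIn_colGrad {ψ : Euc 2 → Euc 3} (hψ : Differentiable ℝ ψ) (hT : ∀ y, ψ y ∈ T)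
    (y : Euc 2) : ColsIn T (colGrad ψ y) := fun _ => fderiv_apply_mem hψ hT y _

theorem continuous_cellHom_colGrad (hf : IsIntegrand p α β f) {ξ : Cols 2} (hξ : ColsIn T ξ)
    {ψ : Euc 2 → Euc 3} (hψ : ContDiff ℝ ∞ ψ) (hT : ∀ y, ψ y ∈ T) :
    Continuous fun y => cellHom f T (ξ + colGrad ψ y) := by
  have hc := continuous_colGrad (hψ.of_le (by exact_mod_cast le_top : (1 : WithTop ℕ∞) ≤ ∞))
  have : (fun y => cellHom f T (ξ + colGrad ψ y)) =
      fun y => cellHom f T (colsMap T.starProjection (ξ + colGrad ψ y)) := by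
    funext y
    rw [colsMap_starProjection_eq fun j => T.add_mem (hξ j)
      (colsIn_colGrad (hψ.differentiable (by simp)) hT y j)]
  rw [this]
  exact (continuous_cellHom_proj hf).comp (continuous_const.add hc)

end regularity

/-! ### Quasiconvexity for smooth test fields -/

section smoothQuasiconvexity

variable {p α β : ℝ} {f : Euc 3 → Cols 3 → ℝ} {T : Submodule ℝ (Euc 3)}

/-- The centres of the `n²` squares of side `R / n` which tile the square of side `R`. -/
noncomputable def gridCentre (R : ℝ) (n : ℕ) (i : Fin 2 → Fin n) : Euc 2 :=
  WithLp.toLp 2 fun j => -(R / 2) + ((i j : ℕ) + 1 / 2) * (R / n)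

theorem sqAt_gridCentre_subset {R : ℝ} (hR : 0 < R) {n : ℕ} (i : Fin 2 → Fin n) :
    sqAt (gridCentre R n i) (R / n) ⊆ sqAt 0 R := by
  intro y hy j
  have h := abs_lt.1 (hy j)
  have hn : (0 : ℝ) < n := by exact_mod_cast (i j).pos
  have h1 : ((i j : ℕ) : ℝ) + 1 ≤ n := by exact_mod_cast (i j).2
  have h0 : (0 : ℝ) ≤ (i j : ℕ) := Nat.cast_nonneg _
  simp only [gridCentre] at h
  set s := R / n with hs
  have hs0 : 0 < s := by positivity
  have hns : n * s = R := by rw [hs]; field_simp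
  have h2 : ((i j : ℕ) + 1) * s ≤ R := by rw [← hns]; gcongr
  have h3 : 0 ≤ ((i j : ℕ) : ℝ) * s := by positivity
  rw [PiLp.zero_apply, sub_zero, abs_lt]
  constructor <;> nlinarith

theorem pairwise_disjoint_gridCentre {R : ℝ} (hR : 0 < R) (n : ℕ) :
    Pairwise (Function.onFun Disjoint fun i => sqAt (gridCentre R n i) (R / n)) := by
  intro i i' hii
  refine Set.disjoint_left.2 fun y hy hy' => ?_
  obtain ⟨j, hj⟩ := Function.ne_iff.1 hii
  have h1 := abs_lt.1 (hy j)
  have h2 := abs_lt.1 (hy' j)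
  have hn : (0 : ℝ) < n := by exact_mod_cast (i j).pos
  simp only [gridCentre] at h1 h2
  set s := R / n with hs
  have hs0 : 0 < s := by positivity
  have hne : (i j : ℕ) ≠ (i' j : ℕ) := fun h => hj (Fin.ext h)
  rcases lt_or_gt_of_ne hne with h | h
  · have : ((i j : ℕ) : ℝ) + 1 ≤ (i' j : ℕ) := by exact_mod_cast h
    nlinarith
  · have : ((i' j : ℕ) : ℝ) + 1 ≤ (i j : ℕ) := by exact_mod_cast h
    nlinarith

theorem convex_sqAt (c : Euc 2) (l : ℝ) : Convex ℝ (sqAt c l) := by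
  intro x hx y hy a b ha hb hab i
  have h1 := abs_lt.1 (hx i)
  have h2 := abs_lt.1 (hy i)
  simp only [PiLp.add_apply, PiLp.smul_apply, smul_eq_mul]
  have e : a * x i + b * y i - c i = a * (x i - c i) + b * (y i - c i) := by
    linear_combination c i * hab
  rw [e, abs_lt]
  have e2 : l / 2 = a * (l / 2) + b * (l / 2) := by rw [← add_mul, hab, one_mul]
  rcases ha.eq_or_lt with rfl | ha'
  · have hb1 : b = 1 := by linarith
    subst hb1; constructor <;> linarith
  · constructor <;> nlinarith

theorem exists_uniform_modulus {E : Type*} [NormedAddCommGroup E] {F : Euc 2 → E}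
    (hF : Continuous F) (hs : HasCompactSupport F) {ε : ℝ} (hε : 0 < ε) :
    ∃ δ > 0, ∀ x y, ‖x - y‖ < δ → ‖F x - F y‖ < ε := by
  have hu := hs.uniformContinuous_of_continuous hF
  obtain ⟨δ, hδ, h⟩ := Metric.uniformContinuous_iff.1 hu ε hε
  exact ⟨δ, hδ, fun x y hxy => by
    have := @h x y (by rwa [dist_eq_norm])
    rwa [dist_eq_norm] at this⟩

/-- On each cell of a fine grid, `ψ` is replaced by its Taylor polynomial at the centre, on a
concentric square smaller by the factor `1 - ρ`. The sum of the patch energies is a Riemann sum for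
the integral, up to `R ^ 2 * ρ`, and the collars have total area at most `R ^ 2 * (2 * ρ)`. -/
theorem cellHom_quasiconvex_approx (hf : IsIntegrand p α β f) {ξ : Cols 2} (hξ : ColsIn T ξ)
    {R : ℝ} (hR : 0 < R) {ψ : Euc 2 → Euc 3} (hψ : ContDiff ℝ ∞ ψ) (hψs : tsupport ψ ⊆ sqAt 0 R)
    (hψT : ∀ y, ψ y ∈ T) {L : ℝ} (hL : ∀ y, ‖ξ + colGrad ψ y‖ ≤ L) {ρ : ℝ} (hρ : 0 < ρ)
    (hρ1 : ρ < 1) :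
    R ^ 2 * cellHom f T ξ ≤ (∫ y in sqAt 0 R, cellHom f T (ξ + colGrad ψ y)) + R ^ 2 * ρ +
      β * (1 + (L + 2 * (1 + 4 * cutoffConst)) ^ p) * (R ^ 2 * (2 * ρ)) := by
  have hC := cutoffConst_pos
  have hβ := hf.beta_pos
  have hp := hf.one_le
  have hL0 : 0 ≤ L := (norm_nonneg _).trans (hL 0)
  have hcs : HasCompactSupport ψ := hasCompactSupport_of_tsupport_subset hψs
  have hψ1 : ContDiff ℝ 1 ψ := hψ.of_le (by exact_mod_cast le_top)
  have hψd : Differentiable ℝ ψ := hψ.differentiable (by simp)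
  set g : Euc 2 → ℝ := fun y => cellHom f T (ξ + colGrad ψ y) with hg
  have hgc : Continuous g := continuous_cellHom_colGrad hf hξ hψ hψT
  have hg0 : ∀ y, 0 ≤ g y := fun y => cellHom_nonneg hf _
  have hcolz : ∀ y, y ∉ tsupport ψ → colGrad ψ y = 0 := fun y hy => by
    ext j : 1
    exact fderiv_apply_eq_zero_of_notMem_tsupport hy _
  -- Off the support of `ψ` the function `g` is the constant `cellHom f T ξ`; subtracting it gives
  -- compact support and hence uniform continuity.
  have hgs : HasCompactSupport fun y => g y - cellHom f T ξ := by
    refine hcs.mono' fun y hy => ?_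
    by_contra h
    exact hy (by simp [hg, hcolz y h])
  obtain ⟨δ₁, hδ₁, hm₁⟩ := exists_uniform_modulus (hψ1.continuous_fderiv (by simp))
    (hcs.fderiv ℝ) hρ
  obtain ⟨δ₂, hδ₂, hm₂⟩ := exists_uniform_modulus (hgc.sub continuous_const) hgs hρ
  obtain ⟨n, hn⟩ := exists_nat_gt (R / min δ₁ δ₂)
  have hδ : 0 < min δ₁ δ₂ := lt_min hδ₁ hδ₂
  have hn0 : (0 : ℝ) < n := lt_trans (by positivity) hn
  set s := R / n with hs
  have hs0 : 0 < s := by positivity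
  have hsδ : s < min δ₁ δ₂ := by
    rw [hs, div_lt_iff₀ hn0]
    rw [div_lt_iff₀ hδ] at hn
    linarith
  set c := gridCentre R n with hc
  set r := (1 - ρ) * s with hr
  have hr0 : 0 < r := mul_pos (by linarith) hs0
  have hd0 : 0 < ρ * s / 4 := by positivity
  -- The collar parameter is chosen so that each patch is exactly one grid cell.
  have e : r + 4 * (ρ * s / 4) = s := by rw [hr]; ring
  have key := cellHom_le_of_patches (T := T) hf (ξ := ξ) hR hψ hψs hψT (ctr := c) hr0 hd0
    (fun i => by rw [e]; exact sqAt_gridCentre_subset hR i)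
    (by rw [e]; exact pairwise_disjoint_gridCentre hR n)
    (A := fun i => fderiv ℝ ψ (c i)) (fun i v => fderiv_apply_mem hψd hψT _ _)
    (b := fun i => ψ (c i)) (fun i => hψT _) (κ := ρ * s) (μ := ρ) (L := L)
    (by positivity) hρ.le
    (fun i y hy => by
      rw [e] at hy
      have hci : c i ∈ sqAt (c i) s := fun j => by simpa using hs0
      have h1 := (convex_sqAt (c i) s).norm_image_sub_le_of_norm_fderiv_le' (𝕜 := ℝ) (f := ψ)
        (φ := fderiv ℝ ψ (c i)) (C := ρ) (fun z _ => hψd z) (fun z hz => (hm₁ z (c i)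
          ((norm_sub_le_of_mem_sqAt hz).trans_lt (hsδ.trans_le (min_le_left _ _)))).le) hci hy
      rw [norm_sub_rev]
      calc _ = ‖ψ y - ψ (c i) - fderiv ℝ ψ (c i) (y - c i)‖ := by congr 1; abel
        _ ≤ ρ * ‖y - c i‖ := h1
        _ ≤ ρ * s := by gcongr; exact norm_sub_le_of_mem_sqAt hy)
    (fun i y hy => by
      rw [e] at hy
      rw [norm_sub_rev]
      exact (hm₁ y (c i)
        ((norm_sub_le_of_mem_sqAt hy).trans_lt (hsδ.trans_le (min_le_left _ _)))).le)
    hL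
  have hrs : ∀ i, sqAt (c i) r ⊆ sqAt (c i) s := fun i y hy j => (hy j).trans (by
    rw [hr]; nlinarith)
  have hvol : ∀ i, volume.real (sqAt (c i) r) = r ^ 2 := fun i => by
    rw [measureReal_def, volume_sqAt _ hr0.le, ENNReal.toReal_ofReal (by positivity)]
  have hfin : ∀ (c : Euc 2) {l : ℝ}, 0 ≤ l → volume (sqAt c l) ≠ ⊤ := fun c l hl => by
    rw [volume_sqAt c hl]; exact ENNReal.ofReal_ne_top
  have hgi : IntegrableOn g (sqAt 0 R) := by
    refine (hgc.continuousOn.integrableOn_compact (isCompact_closedBall (0 : Euc 2) R)).mono_set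
      fun y hy => ?_
    rw [mem_closedBall_iff_norm]
    exact norm_sub_le_of_mem_sqAt hy
  have hsub : ∀ i, sqAt (c i) r ⊆ sqAt 0 R := fun i =>
    (hrs i).trans (sqAt_gridCentre_subset hR i)
  have hterm : ∀ i, r ^ 2 * cellHom f T (ξ + linCols (fderiv ℝ ψ (c i))) ≤
      (∫ y in sqAt (c i) r, g y) + r ^ 2 * ρ := fun i => by
    have h1 : ∫ y in sqAt (c i) r, (g (c i) - ρ) ≤ ∫ y in sqAt (c i) r, g y := by
      refine setIntegral_mono_on (integrableOn_const (hfin _ hr0.le)) (hgi.mono_set (hsub i))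
        (isOpen_sqAt _ _).measurableSet fun y hy => ?_
      have := hm₂ y (c i) ((norm_sub_le_of_mem_sqAt (hrs i hy)).trans_lt
        (hsδ.trans_le (min_le_right _ _)))
      rw [Pi.sub_apply, Pi.sub_apply, sub_sub_sub_cancel_right, Real.norm_eq_abs, abs_lt] at this
      linarith
    rw [setIntegral_const, hvol, smul_eq_mul] at h1
    have h2 : cellHom f T (ξ + linCols (fderiv ℝ ψ (c i))) = g (c i) := rfl
    rw [h2]
    linarith
  have hdis : Pairwise (Function.onFun Disjoint fun i => sqAt (c i) r) := fun i j hij =>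
    (pairwise_disjoint_gridCentre hR n hij).mono (hrs i) (hrs j)
  have hsum : ∑ i, (∫ y in sqAt (c i) r, g y) ≤ ∫ y in sqAt 0 R, g y := by
    rw [← integral_iUnion_fintype (fun i => (isOpen_sqAt _ _).measurableSet) hdis
      fun i => hgi.mono_set (hsub i)]
    exact setIntegral_mono_set hgi (Eventually.of_forall hg0)
      (Set.iUnion_subset hsub).eventuallyLE
  have hcard : (Fintype.card (Fin 2 → Fin n) : ℝ) * r ^ 2 = (1 - ρ) ^ 2 * R ^ 2 := by
    simp only [Fintype.card_pi, Fintype.card_fin, Finset.prod_const, Finset.card_univ]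
    push_cast
    rw [hr, hs]
    field_simp
  rw [hcard] at key
  -- The Taylor error `ρ * s` and the collar parameter `ρ * s / 4` have a fixed ratio, so the
  -- gradient in the collars is bounded independently of `ρ` and of the grid.
  have hK : L + 2 * (ρ + cutoffConst / (ρ * s / 4) * (ρ * s)) ≤
      L + 2 * (1 + 4 * cutoffConst) := by
    have : cutoffConst / (ρ * s / 4) * (ρ * s) = 4 * cutoffConst := by field_simp
    rw [this]
    linarith
  refine key.trans (add_le_add ?_ ?_)
  · calc _ ≤ ∑ i, ((∫ y in sqAt (c i) r, g y) + r ^ 2 * ρ) := Finset.sum_le_sum fun i _ => hterm i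
      _ = ∑ i, (∫ y in sqAt (c i) r, g y) + (Fintype.card (Fin 2 → Fin n) * r ^ 2) * ρ := by
        rw [Finset.sum_add_distrib, Finset.sum_const, Finset.card_univ, nsmul_eq_mul]; ring
      _ ≤ _ := by
        rw [hcard]
        have : (1 - ρ) ^ 2 ≤ 1 := by nlinarith
        have : (1 - ρ) ^ 2 * R ^ 2 * ρ ≤ R ^ 2 * ρ := by
          gcongr
          exact mul_le_of_le_one_left (by positivity) this
        linarith
  · have h1 : 0 ≤ L + 2 * (ρ + cutoffConst / (ρ * s / 4) * (ρ * s)) := by positivity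
    have h2 : (L + 2 * (ρ + cutoffConst / (ρ * s / 4) * (ρ * s))) ^ p ≤
      (L + 2 * (1 + 4 * cutoffConst)) ^ p := Real.rpow_le_rpow h1 hK (by linarith)
    have h3 : R ^ 2 - (1 - ρ) ^ 2 * R ^ 2 ≤ R ^ 2 * (2 * ρ) := by nlinarith [sq_nonneg (R * ρ)]
    have h4 : 0 ≤ R ^ 2 - (1 - ρ) ^ 2 * R ^ 2 := by
      have : (1 - ρ) ^ 2 ≤ 1 := by nlinarith
      nlinarith [sq_nonneg R]
    gcongr

/-- Quasiconvexity of the homogenized density, tested with smooth compactly supported fields. -/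
theorem cellHom_quasiconvex_smooth (hf : IsIntegrand p α β f) {ξ : Cols 2} (hξ : ColsIn T ξ)
    {R : ℝ} (hR : 0 < R) {ψ : Euc 2 → Euc 3} (hψ : ContDiff ℝ ∞ ψ) (hψs : tsupport ψ ⊆ sqAt 0 R)
    (hψT : ∀ y, ψ y ∈ T) :
    R ^ 2 * cellHom f T ξ ≤ ∫ y in sqAt 0 R, cellHom f T (ξ + colGrad ψ y) := by
  have hcs : HasCompactSupport ψ := hasCompactSupport_of_tsupport_subset hψs
  have hψ1 : ContDiff ℝ 1 ψ := hψ.of_le (by exact_mod_cast le_top)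
  obtain ⟨B, hB⟩ := (continuous_colGrad hψ1).bounded_above_of_compact_support
    (hcs.mono' fun y hy => by
      by_contra h
      refine hy ?_
      ext j : 1
      exact fderiv_apply_eq_zero_of_notMem_tsupport h _)
  have hL : ∀ y, ‖ξ + colGrad ψ y‖ ≤ ‖ξ‖ + B := fun y =>
    (norm_add_le _ _).trans (add_le_add le_rfl (hB y))
  set I := ∫ y in sqAt 0 R, cellHom f T (ξ + colGrad ψ y)
  have hlim : Tendsto (fun ρ : ℝ => I + R ^ 2 * ρ +
      β * (1 + (‖ξ‖ + B + 2 * (1 + 4 * cutoffConst)) ^ p) * (R ^ 2 * (2 * ρ))) (𝓝[>] 0) (𝓝 I) := by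
    have : Tendsto (fun ρ : ℝ => I + R ^ 2 * ρ + β * (1 + (‖ξ‖ + B +
        2 * (1 + 4 * cutoffConst)) ^ p) * (R ^ 2 * (2 * ρ))) (𝓝 0)
        (𝓝 (I + R ^ 2 * 0 + β * (1 + (‖ξ‖ + B +
        2 * (1 + 4 * cutoffConst)) ^ p) * (R ^ 2 * (2 * 0)))) :=
      Continuous.tendsto (by fun_prop) 0
    simp only [mul_zero, add_zero] at this
    exact this.mono_left nhdsWithin_le_nhds
  refine ge_of_tendsto hlim ?_
  filter_upwards [Ioo_mem_nhdsGT (zero_lt_one' ℝ)] with ρ hρ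
  exact cellHom_quasiconvex_approx hf hξ hR hψ hψs hψT hL hρ.1 hρ.2

end smoothQuasiconvexity

/-! ### Mollification -/

section mollification

open scoped Convolution

variable {k : ℕ}

/-- The mollification of `ψ` by a normalized bump function. -/
noncomputable def mollify {E : Type*} [NormedAddCommGroup E] [NormedSpace ℝ E]
    (ρ : ContDiffBump (0 : Euc k)) (ψ : Euc k → E) : Euc k → E :=
  ρ.normed volume ⋆[ContinuousLinearMap.lsmul ℝ ℝ, volume] ψ

variable {E : Type*} [NormedAddCommGroup E] [NormedSpace ℝ E] (ρ : ContDiffBump (0 : Euc k))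

theorem mollify_apply (ψ : Euc k → E) (y : Euc k) :
    mollify ρ ψ y = ∫ t, ρ.normed volume (y - t) • ψ t := by
  rw [mollify, convolution_eq_swap]
  simp

theorem contDiff_mollify [CompleteSpace E] {ψ : Euc k → E} (hψ : LocallyIntegrable ψ) :
    ContDiff ℝ ∞ (mollify ρ ψ) :=
  ρ.hasCompactSupport_normed.contDiff_convolution_left _ ρ.contDiff_normed hψ

theorem contDiff_normed_sub (y : Euc k) : ContDiff ℝ ∞ fun t => ρ.normed volume (y - t) :=
  ρ.contDiff_normed.comp (contDiff_const.sub contDiff_id)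

theorem hasCompactSupport_normed_sub (y : Euc k) :
    HasCompactSupport fun t => ρ.normed volume (y - t) :=
  ρ.hasCompactSupport_normed.comp_homeomorph (Homeomorph.subLeft y)

theorem norm_mollify_le {ψ : Euc k → E} {B : ℝ} (hB : ∀ᵐ t, ‖ψ t‖ ≤ B) (y : Euc k) :
    ‖mollify ρ ψ y‖ ≤ B := by
  rw [mollify_apply]
  have hi : Integrable fun t => ρ.normed volume (y - t) * B :=
    ((contDiff_normed_sub ρ y).continuous.integrable_of_hasCompactSupport
      (hasCompactSupport_normed_sub ρ y)).mul_const B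
  refine (norm_integral_le_of_norm_le hi ?_).trans (le_of_eq ?_)
  · filter_upwards [hB] with t ht
    rw [norm_smul, Real.norm_eq_abs, abs_of_nonneg (ρ.nonneg_normed _)]
    exact mul_le_mul_of_nonneg_left ht (ρ.nonneg_normed _)
  · rw [integral_mul_const, integral_sub_left_eq_self, ρ.integral_normed, one_mul]

theorem mollify_mem {T : Submodule ℝ (Euc 3)} {ψ : Euc k → Euc 3}
    (hψ : MemLp ψ ⊤ volume) (hT : ∀ t, ψ t ∈ T) (y : Euc k) : mollify ρ ψ y ∈ T := by
  rw [mollify_apply]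
  have hi := integrable_smul_of_hasCompactSupport (U := Set.univ)
    (contDiff_normed_sub ρ y).continuous (hasCompactSupport_normed_sub ρ y)
    (φ := ψ) (by rwa [Measure.restrict_univ])
  rw [IntegrableOn, Measure.restrict_univ] at hi
  rw [← Submodule.starProjection_eq_self_iff, ← T.starProjection.integral_comp_comm hi]
  refine integral_congr_ae (Eventually.of_forall fun t => ?_)
  exact Submodule.starProjection_eq_self_iff.2 (T.smul_mem _ (hT t))

/-- The derivative falls on the kernel, and `t ↦ ρ (y - t)` is an admissible test function on the
whole space. The sign from differentiating in `t` cancels that of the weak gradient identity. -/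
theorem colGrad_mollify {ψ : Euc k → Euc 3} {G : Euc k → Cols k}
    (h : MemW1Infty Set.univ ψ G) (hψ : LocallyIntegrable ψ) (y : Euc k) (j : Fin k) :
    colGrad (mollify ρ ψ) y j = mollify ρ (fun t => G t j) y := by
  have hd := (ρ.hasCompactSupport_normed (μ := volume)).hasFDerivAt_convolution_left
    (ContinuousLinearMap.lsmul ℝ ℝ) (μ := volume) (ρ.contDiff_normed (n := 1)) hψ y
  set e : Euc k := EuclideanSpace.single j 1 with he
  have h1 : colGrad (mollify ρ ψ) y j =
      ∫ t, fderiv ℝ (ρ.normed volume) (y - t) e • ψ t := by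
    rw [colGrad_apply, mollify, hd.fderiv, convolution_eq_swap]
    have hi : Integrable fun t => (ContinuousLinearMap.precompL (Euc k)
        (ContinuousLinearMap.lsmul ℝ ℝ : ℝ →L[ℝ] Euc 3 →L[ℝ] Euc 3))
        (fderiv ℝ (ρ.normed volume) (y - t)) (ψ t) := by
      have := (ρ.hasCompactSupport_normed (μ := volume)).fderiv ℝ
      exact (this.convolutionExists_left (ContinuousLinearMap.precompL (Euc k)
        (ContinuousLinearMap.lsmul ℝ ℝ : ℝ →L[ℝ] Euc 3 →L[ℝ] Euc 3))
        ((ρ.contDiff_normed (n := 1)).continuous_fderiv (by simp)) hψ y).integrable_swap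
    rw [ContinuousLinearMap.integral_apply hi]
    simp [ContinuousLinearMap.precompL_apply, he]
  have h2 := h.2.2 _ (contDiff_normed_sub ρ y) (hasCompactSupport_normed_sub ρ y)
    (Set.subset_univ _) j
  rw [Measure.restrict_univ, ← he] at h2
  have h3 : ∀ t, fderiv ℝ (fun t => ρ.normed volume (y - t)) t e =
      -fderiv ℝ (ρ.normed volume) (y - t) e := fun t => by
    have h4 := ((ρ.contDiff_normed (μ := volume) (n := 1)).differentiable (by simp)
      (y - t)).hasFDerivAt.comp t ((hasFDerivAt_id t).const_sub y)
    have h5 : fderiv ℝ (fun t => ρ.normed volume (y - t)) t = _ := h4.fderiv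
    rw [h5]
    simp
  rw [h1, mollify_apply]
  simp only [h3, neg_smul, integral_neg, neg_inj] at h2
  exact h2

end mollification

/-! ### Quasiconvexity for Lipschitz test fields -/

section quasiconvexity

variable {p α β : ℝ} {f : Euc 3 → Cols 3 → ℝ} {T : Submodule ℝ (Euc 3)}

theorem tsupport_mollify_subset {k : ℕ} (ρ : ContDiffBump (0 : Euc k)) {E : Type*}
    [NormedAddCommGroup E] [NormedSpace ℝ E] {ψ : Euc k → E} {a : ℝ}
    (hψ : ∀ y, ψ y ≠ 0 → ∀ i, |y i| ≤ a) :
    tsupport (mollify ρ ψ) ⊆ {y | ∀ i, |y i| ≤ a + ρ.rOut} := by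
  refine closure_minimal (fun y hy i => ?_) ?_
  · by_contra! hlt
    refine hy ?_
    rw [mollify_apply]
    refine integral_eq_zero_of_ae (Eventually.of_forall fun t => ?_)
    by_cases ht : ψ t = 0
    · simp [ht]
    · have h1 := hψ t ht i
      have h2 : ρ.normed volume (y - t) = 0 := by
        have : y - t ∉ Function.support (ρ.normed volume) := by
          rw [ρ.support_normed_eq, Metric.mem_ball, dist_zero_right, not_lt]
          have h3 : |(y - t) i| ≤ ‖y - t‖ := PiLp.norm_apply_le (y - t) i
          rw [PiLp.sub_apply] at h3
          have h4 := abs_sub_abs_le_abs_sub (y i) (t i)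
          linarith
        simpa using this
      simp [h2]
  · simp only [Set.ofPred_forall]
    exact isClosed_iInter fun i => isClosed_le (by fun_prop) continuous_const

theorem IsTestField.memW1Infty_indicator {ψ : Euc 2 → Euc 3} {G : Euc 2 → Cols 2}
    (h : IsTestField (square 1) (frontier (square 1)) T ψ G) :
    MemW1Infty Set.univ ((square 1).indicator ψ) ((square 1).indicator G) := by
  have hs : IsOpen (square 1) := by rw [square_eq_sqAt]; exact isOpen_sqAt _ _
  have hc : ContinuousOn ((square 1).indicator ψ) Set.univ :=
    continuousOn_indicator_of_frontier hs (by simp) h.2.2.1 h.2.2.2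
  have e1 : openBox (k := 2) Finset.univ (fun _ => 1 / 2) = square 1 := by
    ext x; simp [openBox, square]
  have e2 : openBox (k := 2) (Finset.univ)ᶜ (fun _ => 1 / 2) = Set.univ := by
    ext x; simp [openBox]
  have hW := MemW1Infty.indicator (J := Finset.univ) (a := fun _ : Fin 2 => (1 / 2 : ℝ))
    (φ := ψ) (G := G)
  rw [e1, e2] at hW
  exact hW h.1 hc

/-- Quasiconvexity of the homogenized density, together with the integrability of the right-hand
side. -/
theorem isTangentiallyQuasiconvex_cellHom (hf : IsIntegrand p α β f) :
    IsTangentiallyQuasiconvex T (cellHom f T) := by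
  intro ξ hξ ψ G h
  have hp := hf.one_le
  have hβ := hf.beta_pos
  have hs : IsOpen (square 1) := by rw [square_eq_sqAt]; exact isOpen_sqAt _ _
  set ψ' := (square 1).indicator ψ with hψ'
  set G' := (square 1).indicator G with hG'
  have hW := h.memW1Infty_indicator
  have hψL : MemLp ψ' ⊤ volume := by simpa using hW.1
  have hGL : MemLp G' ⊤ volume := by simpa using hW.2.1
  have hψT : ∀ y, ψ' y ∈ T := fun y => by
    by_cases hy : y ∈ square 1
    · rw [hψ', Set.indicator_of_mem hy]; exact h.2.1 y hy
    · rw [hψ', Set.indicator_of_notMem hy]; exact T.zero_mem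
  have hGT : ∀ᵐ y ∂volume.restrict (square 1), ColsIn T (G y) :=
    (ae_restrict_iff' hs.measurableSet).2 (h.1.ae_colsIn hs h.2.1)
  set P := colsMap (k := 2) T.starProjection
  have hPc : Continuous fun ξ => cellHom f T (P ξ) := continuous_cellHom_proj hf
  obtain ⟨B, hB⟩ : ∃ B : ℝ, ∀ᵐ y, ‖G' y‖ ≤ B := ⟨_, ae_le_lpNorm_exponent_top hGL⟩
  have hvol : volume (square 1) = 1 := by
    rw [square_eq_sqAt, volume_sqAt _ zero_le_one]; simp
  have : IsFiniteMeasure (volume.restrict (square 1)) := ⟨by simp [hvol]⟩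
  -- The mollified gradients are bounded column by column, which gives `2 * B` and not `B`; `M`
  -- dominates all integrands at once.
  set M := β * (1 + (‖ξ‖ + 2 * B) ^ p) with hM
  have hB0 : 0 ≤ B := by
    obtain ⟨y, hy⟩ := hB.exists
    exact (norm_nonneg _).trans hy
  have hbound : ∀ ζ : Cols 2, ‖ζ‖ ≤ 2 * B → ‖cellHom f T (ξ + ζ)‖ ≤ M := fun ζ hζ => by
    rw [Real.norm_eq_abs, abs_of_nonneg (cellHom_nonneg hf _)]
    refine (cellHom_le hf _).trans ?_
    have : ‖ξ + ζ‖ ≤ ‖ξ‖ + 2 * B := (norm_add_le _ _).trans (by linarith)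
    rw [hM]
    gcongr
  have hproj : ∀ ζ : Cols 2, ColsIn T ζ → cellHom f T (P (ξ + ζ)) = cellHom f T (ξ + ζ) :=
    fun ζ hζ => by
      rw [show P (ξ + ζ) = ξ + ζ from
        colsMap_starProjection_eq fun j => T.add_mem (hξ j) (hζ j)]
  have hint : IntegrableOn (fun y => cellHom f T (ξ + G y)) (square 1) := by
    refine Integrable.of_bound (C := M) ?_ ?_
    · have h1 : AEStronglyMeasurable (fun y => cellHom f T (P (ξ + G y)))
          (volume.restrict (square 1)) :=
        (hPc.comp (continuous_const.add continuous_id)).comp_aestronglyMeasurable h.1.2.1.1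
      refine h1.congr ?_
      filter_upwards [hGT] with y hy using hproj _ hy
    · filter_upwards [ae_restrict_of_ae hB, ae_restrict_mem hs.measurableSet] with y hy hys
      rw [hG', Set.indicator_of_mem hys] at hy
      exact hbound _ (by linarith)
  refine ⟨hint, ?_⟩
  -- mollification
  set r : ℕ → ℝ := fun n => 1 / ((n : ℝ) + 1) with hr
  have hr0 : ∀ n, 0 < r n := fun n => Nat.one_div_pos_of_nat
  have hrlim : Tendsto r atTop (𝓝 0) := tendsto_one_div_add_atTop_nhds_zero_nat
  -- The fixed ratio `2` of outer to inner radius is what the a.e. convergence of mollifications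
  -- requires.
  set ρ : ℕ → ContDiffBump (0 : Euc 2) := fun n =>
    ⟨r n / 2, r n, by have := hr0 n; positivity, by have := hr0 n; linarith⟩ with hρ
  set ψn : ℕ → Euc 2 → Euc 3 := fun n => mollify (ρ n) ψ' with hψn
  have hψloc : LocallyIntegrable ψ' := hψL.locallyIntegrable le_top
  have hψs : ∀ n, ContDiff ℝ ∞ (ψn n) := fun n => contDiff_mollify _ hψloc
  have hψnT : ∀ n y, ψn n y ∈ T := fun n y => mollify_mem _ hψL hψT y
  have hcol : ∀ n y j, colGrad (ψn n) y j = mollify (ρ n) (fun t => G' t j) y :=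
    fun n y j => colGrad_mollify _ hW hψloc y j
  have hcolb : ∀ n y, ‖colGrad (ψn n) y‖ ≤ 2 * B := fun n y => norm_cols_le fun j => by
    rw [hcol]
    refine norm_mollify_le _ ?_ y
    filter_upwards [hB] with t ht using (norm_col_le _ j).trans ht
  -- Mollification enlarges the support to `|y i| ≤ 1/2 + r n`, strictly inside the open square of
  -- half-side `1/2 + 2 * r n`.
  set R : ℕ → ℝ := fun n => 1 + 4 * r n with hR
  have hR1 : ∀ n, 1 ≤ R n := fun n => by have := hr0 n; simp only [hR]; linarith
  have hRlim : Tendsto R atTop (𝓝 1) := by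
    have := (hrlim.const_mul 4).const_add 1
    simpa [hR] using this
  have hsupp : ∀ n, tsupport (ψn n) ⊆ sqAt 0 (R n) := fun n y hy i => by
    have h1 := tsupport_mollify_subset (ρ n) (ψ := ψ') (a := 1 / 2) (fun y hy i => by
      by_contra! hlt
      exact hy (Set.indicator_of_notMem (fun hys : y ∈ square 1 => absurd (hys i) (not_lt.2 hlt.le)) _)) hy i
    have h2 := hr0 n
    change |y i| ≤ 1 / 2 + r n at h1
    rw [PiLp.zero_apply, sub_zero]
    simp only [hR]
    linarith
  have hq : ∀ n, R n ^ 2 * cellHom f T ξ ≤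
      ∫ y in sqAt 0 (R n), cellHom f T (ξ + colGrad (ψn n) y) := fun n =>
    cellHom_quasiconvex_smooth hf hξ (by linarith [hR1 n]) (hψs n) (hsupp n) (hψnT n)
  have hcont : ∀ n, Continuous fun y => cellHom f T (ξ + colGrad (ψn n) y) := fun n =>
    continuous_cellHom_colGrad hf hξ (hψs n) (hψnT n)
  -- The part of the enlarged square outside the unit square has area `R n ^ 2 - 1`, which tends to
  -- zero.
  have hsplit : ∀ n, ∫ y in sqAt 0 (R n), cellHom f T (ξ + colGrad (ψn n) y) ≤
      (∫ y in square 1, cellHom f T (ξ + colGrad (ψn n) y)) + M * (R n ^ 2 - 1) := fun n => by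
    have hR0 : 0 ≤ R n := by linarith [hR1 n]
    have hvR : volume (sqAt 0 (R n)) = ENNReal.ofReal (R n ^ 2) := volume_sqAt _ hR0
    have hfin : volume (sqAt 0 (R n)) ≠ ⊤ := by rw [hvR]; exact ENNReal.ofReal_ne_top
    have hsub : square 1 ⊆ sqAt 0 (R n) := fun y hy i => by
      rw [PiLp.zero_apply, sub_zero]
      exact (hy i).trans_le (by linarith [hR1 n])
    have hi : IntegrableOn (fun y => cellHom f T (ξ + colGrad (ψn n) y)) (sqAt 0 (R n)) := by
      have : IsFiniteMeasure (volume.restrict (sqAt (0 : Euc 2) (R n))) :=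
        ⟨by simpa using hfin.lt_top⟩
      exact Integrable.of_bound (hcont n).aestronglyMeasurable M
        (Eventually.of_forall fun y => hbound _ (hcolb n y))
    rw [← integral_inter_add_sdiff hs.measurableSet hi, Set.inter_eq_self_of_subset_right hsub]
    refine add_le_add le_rfl ?_
    have h1 : volume (sqAt 0 (R n) \ square 1) < ⊤ :=
      (measure_ne_top_of_subset Set.sdiff_subset hfin).lt_top
    have h2 := norm_setIntegral_le_of_norm_le_const h1
      (f := fun y => cellHom f T (ξ + colGrad (ψn n) y)) fun y _ => hbound _ (hcolb n y)
    rw [measureReal_sdiff hsub hs.measurableSet hfin, measureReal_def, measureReal_def, hvR, hvol,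
      ENNReal.toReal_ofReal (sq_nonneg _), ENNReal.toReal_one] at h2
    exact (le_abs_self _).trans h2
  have hlim1 : Tendsto (fun n => ∫ y in square 1, cellHom f T (ξ + colGrad (ψn n) y)) atTop
      (𝓝 (∫ y in square 1, cellHom f T (ξ + G y))) := by
    refine tendsto_integral_of_dominated_convergence (fun _ => M)
      (fun n => (hcont n).aestronglyMeasurable) (integrable_const _)
      (fun n => Eventually.of_forall fun y => hbound _ (hcolb n y)) ?_
    have hconv : ∀ j, ∀ᵐ y ∂volume.restrict (square 1),
        Tendsto (fun n => colGrad (ψn n) y j) atTop (𝓝 (G' y j)) := fun j => by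
      have h1 : LocallyIntegrable fun t => G' t j := (memLp_top_col hGL j).locallyIntegrable le_top
      have h2 := ContDiffBump.ae_convolution_tendsto_right_of_locallyIntegrable (φ := ρ)
        (l := atTop) (K := 2) hrlim (Eventually.of_forall fun n => by
          change r n ≤ 2 * (r n / 2); linarith) h1
      filter_upwards [ae_restrict_of_ae h2] with y hy
      simp only [hcol]
      exact hy
    filter_upwards [ae_all_iff.2 hconv, hGT, ae_restrict_mem hs.measurableSet] with y hy hyT hys
    have h3 : Tendsto (fun n => colGrad (ψn n) y) atTop (𝓝 (G' y)) :=
      ((PiLp.continuous_toLp 2 _).tendsto _).comp (tendsto_pi_nhds.2 hy)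
    have h4 : G' y = G y := Set.indicator_of_mem hys _
    rw [h4] at h3
    have h5 := (hPc.tendsto (ξ + G y)).comp (h3.const_add ξ)
    rw [hproj _ hyT] at h5
    refine h5.congr fun n => ?_
    exact hproj _ (colsIn_colGrad ((hψs n).differentiable (by simp)) (hψnT n) y)
  have hlim2 : Tendsto (fun n => (∫ y in square 1, cellHom f T (ξ + colGrad (ψn n) y)) +
      M * (R n ^ 2 - 1)) atTop (𝓝 (∫ y in square 1, cellHom f T (ξ + G y))) := by
    have := hlim1.add (((hRlim.pow 2).sub_const 1).const_mul M)
    simpa using this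
  have hlim3 : Tendsto (fun n => R n ^ 2 * cellHom f T ξ) atTop (𝓝 (cellHom f T ξ)) := by
    have := (hRlim.pow 2).mul_const (cellHom f T ξ)
    simpa using this
  exact le_of_tendsto_of_tendsto' hlim3 hlim2 fun n => (hq n).trans (hsplit n)

end quasiconvexity

/-! ### Rank-one convexity by plane waves -/

section rankOne

/-- A continuous function which lies below all its averages over `τ ↦ x + A cos τ` lies below its
chords. -/
theorem le_chord_of_le_cos_average {g : ℝ → ℝ} (hg : Continuous g)
    (h : ∀ x A : ℝ, 2 * Real.pi * g x ≤ ∫ τ in (0 : ℝ)..2 * Real.pi, g (x + A * Real.cos τ))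
    {r : ℝ} (h0 : 0 ≤ r) (h1 : r ≤ 1) : g r ≤ r * g 1 + (1 - r) * g 0 := by
  -- Subtracting the chord gives `u 0 = u 1 = 0` and preserves the averaging inequality, because the
  -- cosine has mean zero over a period.
  set u : ℝ → ℝ := fun s => g s - (g 0 + s * (g 1 - g 0)) with hu
  have huc : Continuous u := by fun_prop
  have hpi := Real.pi_pos
  have hmean : ∀ x A : ℝ,
      2 * Real.pi * u x ≤ ∫ τ in (0 : ℝ)..2 * Real.pi, u (x + A * Real.cos τ) := by
    intro x A
    have e : ∫ τ in (0 : ℝ)..2 * Real.pi, u (x + A * Real.cos τ) =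
        (∫ τ in (0 : ℝ)..2 * Real.pi, g (x + A * Real.cos τ)) -
          2 * Real.pi * (g 0 + x * (g 1 - g 0)) := by
      simp only [hu]
      have e2 : ∀ τ : ℝ, g (x + A * Real.cos τ) - (g 0 + (x + A * Real.cos τ) * (g 1 - g 0)) =
          g (x + A * Real.cos τ) - ((g 0 + x * (g 1 - g 0)) +
            (A * (g 1 - g 0)) * Real.cos τ) := fun τ => by ring
      simp only [e2]
      rw [intervalIntegral.integral_sub (Continuous.intervalIntegrable (by fun_prop) _ _)
        (Continuous.intervalIntegrable (by fun_prop) _ _),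
        intervalIntegral.integral_add (Continuous.intervalIntegrable (by fun_prop) _ _)
        (Continuous.intervalIntegrable (by fun_prop) _ _),
        intervalIntegral.integral_const_mul, integral_cos]
      simp
      ring
    rw [e]
    have := h x A
    simp only [hu]
    linarith
  obtain ⟨x, hx, hmax⟩ := (isCompact_Icc (a := (0 : ℝ)) (b := 1)).exists_isMaxOn
    ⟨0, by simp⟩ huc.continuousOn
  have hu0 : u 0 = 0 := by simp [hu]
  have hu1 : u 1 = 0 := by simp [hu]
  by_contra! hcon
  have hur : 0 < u r := by simp only [hu]; nlinarith
  have hux : 0 < u x := hur.trans_le (hmax ⟨h0, h1⟩)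
  have hx0 : 0 < x := lt_of_le_of_ne hx.1 fun h => by rw [← h, hu0] at hux; exact hux.false
  have hx1 : x < 1 := lt_of_le_of_ne hx.2 fun h => by rw [h, hu1] at hux; exact hux.false
  -- At a positive interior maximum `x`, this amplitude keeps `x + A cos τ` in `[0, 1]` and makes it
  -- reach an endpoint, where `u` is zero. The average is then strictly below `u x`, a
  -- contradiction.
  set A := min x (1 - x) with hA
  have hA0 : 0 < A := lt_min hx0 (by linarith)
  have hmem : ∀ τ, x + A * Real.cos τ ∈ Set.Icc (0 : ℝ) 1 := fun τ => by
    have h2 := Real.neg_one_le_cos τ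
    have h3 := Real.cos_le_one τ
    have h4 : A ≤ x := min_le_left _ _
    have h5 : A ≤ 1 - x := min_le_right _ _
    constructor <;> nlinarith
  have hlt : ∫ τ in (0 : ℝ)..2 * Real.pi, u (x + A * Real.cos τ) <
      ∫ τ in (0 : ℝ)..2 * Real.pi, u x := by
    refine intervalIntegral.integral_lt_integral_of_continuousOn_of_le_of_exists_lt
      (by positivity) (by fun_prop) continuousOn_const (fun τ _ => hmax (hmem τ)) ?_
    rcases min_choice x (1 - x) with hc | hc
    · refine ⟨Real.pi, ⟨hpi.le, by linarith⟩, ?_⟩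
      rw [hA, hc, Real.cos_pi]
      simpa [hu0] using hux
    · refine ⟨0, ⟨le_rfl, by positivity⟩, ?_⟩
      rw [hA, hc, Real.cos_zero]
      simpa [hu1] using hux
  rw [intervalIntegral.integral_const, sub_zero, smul_eq_mul] at hlt
  exact absurd (hmean x A) (not_le.2 hlt)

variable {p α β : ℝ} {f : Euc 3 → Cols 3 → ℝ} {T : Submodule ℝ (Euc 3)}

/-- The rank-one matrix with columns `b j • a`. -/
noncomputable def outer (a : Euc 3) (b : Euc 2) : Cols 2 := WithLp.toLp 2 fun j => b j • a

/-- An oscillating field in direction `a`, cut off by `χ`. -/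
noncomputable def wave (χ : Euc 2 → ℝ) (a : Euc 3) (b : Euc 2) (A ν τ : ℝ) (y : Euc 2) : Euc 3 :=
  (χ y * (A / ν * Real.sin (ν * inner ℝ b y + τ))) • a

theorem contDiff_wave {χ : Euc 2 → ℝ} (hχ : ContDiff ℝ ∞ χ) (a : Euc 3) (b : Euc 2)
    (A ν τ : ℝ) : ContDiff ℝ ∞ (wave χ a b A ν τ) := by
  unfold wave
  refine (hχ.mul (contDiff_const.mul (Real.contDiff_sin.comp ?_))).smul contDiff_const
  exact (contDiff_const.mul (contDiff_const.inner ℝ contDiff_id)).add contDiff_const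

theorem colGrad_wave {χ : Euc 2 → ℝ} (hχ : ContDiff ℝ ∞ χ) (a : Euc 3) (b : Euc 2)
    (A τ : ℝ) {ν : ℝ} (hν : ν ≠ 0) (y : Euc 2) (j : Fin 2) :
    colGrad (wave χ a b A ν τ) y j =
      (fderiv ℝ χ y (EuclideanSpace.single j 1) * (A / ν * Real.sin (ν * inner ℝ b y + τ)) +
        χ y * (A * Real.cos (ν * inner ℝ b y + τ) * b j)) • a := by
  have h1 : HasFDerivAt (fun y => ν * inner ℝ b y + τ) (ν • innerSL ℝ b) y :=
    ((innerSL ℝ b).hasFDerivAt.const_mul ν).add_const τ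
  have h2 : HasFDerivAt (fun y => Real.sin (ν * inner ℝ b y + τ))
      (Real.cos (ν * inner ℝ b y + τ) • (ν • innerSL ℝ b)) y :=
    (Real.hasDerivAt_sin _).comp_hasFDerivAt y h1
  have h3 := (((hχ.differentiable (by simp) y).hasFDerivAt.fun_mul
    (h2.const_mul (A / ν))).smul_const a)
  have h4 : fderiv ℝ (wave χ a b A ν τ) y = _ := h3.fderiv
  rw [colGrad_apply, h4]
  simp only [ContinuousLinearMap.smulRight_apply, add_apply, smul_apply, smul_eq_mul,
    innerSL_apply_apply]
  congr 1
  have e : inner ℝ b (EuclideanSpace.single j (1 : ℝ)) = b j := by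
    simp [EuclideanSpace.inner_single_right]
  rw [e]
  field_simp
  ring

theorem continuous_phase {F : ℝ → ℝ} (hF : Continuous F) (ν : ℝ) (b : Euc 2) :
    Continuous fun q : ℝ × Euc 2 => F (ν * inner ℝ b q.2 + q.1) :=
  hF.comp ((continuous_const.mul (continuous_const.inner continuous_snd)).add continuous_fst)

theorem continuous_integral_phase {F : ℝ → ℝ} (hF : Continuous F) {N : ℝ} (hN : ∀ θ, ‖F θ‖ ≤ N)
    (ν : ℝ) (b : Euc 2) (S : Set (Euc 2)) [IsFiniteMeasure (volume.restrict S)] :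
    Continuous fun τ => ∫ y in S, F (ν * inner ℝ b y + τ) := by
  have hj := continuous_phase hF ν b
  refine continuous_of_dominated (bound := fun _ => N) (fun τ => ?_)
    (fun τ => Eventually.of_forall fun y => hN _) (integrable_const _)
    (Eventually.of_forall fun y => ?_)
  · exact (hj.comp (Continuous.prodMk_right τ)).aestronglyMeasurable
  · exact hj.comp (Continuous.prodMk_left y)

/-- By Fubini, the integral over a full period of phases does not depend on `y`. The average over
`τ` is thus exact at a fixed frequency, and no weak limit of oscillating functions is needed. -/
theorem integral_phase_average {F : ℝ → ℝ} (hF : Continuous F) {N : ℝ} (hN : ∀ θ, ‖F θ‖ ≤ N)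
    {P : ℝ} (hP : 0 ≤ P) (hper : Function.Periodic F P) (ν : ℝ) (b : Euc 2) (S : Set (Euc 2))
    [IsFiniteMeasure (volume.restrict S)] :
    ∫ τ in (0 : ℝ)..P, (∫ y in S, F (ν * inner ℝ b y + τ)) =
      volume.real S * ∫ τ in (0 : ℝ)..P, F τ := by
  rw [intervalIntegral.integral_of_le hP, integral_integral_swap]
  · have e : ∀ y : Euc 2, ∫ τ in Set.Ioc 0 P, F (ν * inner ℝ b y + τ) =
        ∫ τ in (0 : ℝ)..P, F τ := fun y => by
      rw [← intervalIntegral.integral_of_le hP, intervalIntegral.integral_comp_add_left F,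
        add_zero, hper.intervalIntegral_add_eq (ν * inner ℝ b y) 0, zero_add]
    simp only [e]
    rw [setIntegral_const, smul_eq_mul]
  · exact Integrable.of_bound (continuous_phase hF ν b).aestronglyMeasurable N
      (Eventually.of_forall fun q => hN _)

/-- Where the cutoff equals `1`, the wave has gradient `A cos(ν b·y + τ)` times `a ⊗ b`.
Quasiconvexity is applied for each phase `τ` and then averaged over `τ`; finally the collar shrinks.
-/
theorem cellHom_le_cos_average (hf : IsIntegrand p α β f) {ξ : Cols 2} (hξ : ColsIn T ξ)
    {a : Euc 3} (ha : a ∈ T) (b : Euc 2) (A : ℝ) :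
    2 * Real.pi * cellHom f T ξ ≤
      ∫ τ in (0 : ℝ)..2 * Real.pi, cellHom f T (ξ + (A * Real.cos τ) • outer a b) := by
  have hp := hf.one_le
  have hβ := hf.beta_pos
  have hC := cutoffConst_pos
  have hpi := Real.pi_pos
  set g : ℝ → ℝ := fun s => cellHom f T (ξ + s • outer a b) with hg
  have hgin : ∀ s : ℝ, ColsIn T (ξ + s • outer a b) := fun s j =>
    T.add_mem (hξ j) (T.smul_mem _ (T.smul_mem _ ha))
  have hgc : Continuous g := by
    have : g = fun s => cellHom f T (colsMap T.starProjection (ξ + s • outer a b)) := by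
      funext s
      rw [colsMap_starProjection_eq (hgin s)]
    rw [this]
    exact (continuous_cellHom_proj hf).comp (by fun_prop)
  have hg0 : ∀ s, 0 ≤ g s := fun s => cellHom_nonneg hf _
  set J := ∫ τ in (0 : ℝ)..2 * Real.pi, g (A * Real.cos τ) with hJ
  set K := ‖ξ‖ + 2 * ((cutoffConst * |A| + |A| * ‖b‖) * ‖a‖) with hK
  set M := β * (1 + K ^ p) with hM
  have hM0 : 0 ≤ M := by positivity
  have hJ0 : 0 ≤ J := intervalIntegral.integral_nonneg (by positivity) fun τ _ => hg0 _
  have step : ∀ ε : ℝ, 0 < ε → ε < 1 → 2 * Real.pi * g 0 ≤ J + 2 * Real.pi * (M * (2 * ε)) := by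
    intro ε hε hε1
    set d := ε / 4 with hd
    have hd0 : 0 < d := by positivity
    have hr0 : 0 < 1 - ε := by linarith
    set χ := squareCutoff 0 (1 - ε) d with hχ
    have hχs : ContDiff ℝ ∞ χ := squareCutoff_contDiff _ _ _
    have hχt : tsupport χ ⊆ sqAt 0 1 := by
      have := tsupport_squareCutoff_subset (c := 0) (r := 1 - ε) hd0
      rwa [show 1 - ε + 4 * d = 1 by rw [hd]; ring] at this
    -- The amplitude `A / ν = A * d` compensates the factor `cutoffConst / d` from the cutoff, so
    -- the gradient bound `K` does not depend on `ε`.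
    set ν := 1 / d with hν
    have hν0 : ν ≠ 0 := by positivity
    set S := sqAt (0 : Euc 2) (1 - ε) with hS
    have hSm : MeasurableSet S := (isOpen_sqAt _ _).measurableSet
    have hvS : volume S = ENNReal.ofReal ((1 - ε) ^ 2) := volume_sqAt _ hr0.le
    have hv1 : volume (sqAt (0 : Euc 2) 1) = 1 := by rw [volume_sqAt _ zero_le_one]; simp
    have hS1 : S ⊆ sqAt 0 1 := fun y hy i => (hy i).trans (by linarith)
    have hSf : IsFiniteMeasure (volume.restrict S) := ⟨by simp [hvS]⟩
    have h1f : IsFiniteMeasure (volume.restrict (sqAt (0 : Euc 2) 1)) := ⟨by simp [hv1]⟩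
    have hSr : volume.real S = (1 - ε) ^ 2 := by
      rw [measureReal_def, hvS, ENNReal.toReal_ofReal (sq_nonneg _)]
    have hτ : ∀ τ : ℝ, g 0 ≤
        (∫ y in S, g (A * Real.cos (ν * inner ℝ b y + τ))) + M * (2 * ε) := by
      intro τ
      set ψ := wave χ a b A ν τ with hψ
      have hψs : ContDiff ℝ ∞ ψ := contDiff_wave hχs _ _ _ _ _
      have hψt : tsupport ψ ⊆ sqAt 0 1 := by
        refine (closure_mono (Function.support_subset_iff'.2 fun y hy => ?_)).trans hχt
        rw [Function.notMem_support] at hy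
        simp [hψ, wave, hy]
      have hψT : ∀ y, ψ y ∈ T := fun y => T.smul_mem _ ha
      have hq := cellHom_quasiconvex_smooth hf hξ zero_lt_one hψs hψt hψT
      rw [one_pow, one_mul] at hq
      have hgrad : ∀ y, ‖colGrad ψ y‖ ≤ 2 * ((cutoffConst * |A| + |A| * ‖b‖) * ‖a‖) := by
        refine fun y => norm_cols_le fun j => ?_
        rw [colGrad_wave hχs a b A τ hν0, norm_smul]
        gcongr
        refine (norm_add_le _ _).trans (add_le_add ?_ ?_)
        · rw [norm_mul, norm_mul]
          have e1 : ‖fderiv ℝ χ y (EuclideanSpace.single j 1)‖ ≤ cutoffConst / d :=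
            abs_fderiv_squareCutoff_le hd0 j
          have e2 : ‖Real.sin (ν * inner ℝ b y + τ)‖ ≤ 1 := Real.abs_sin_le_one _
          have e3 : ‖A / ν‖ = |A| * d := by
            rw [hν, div_div_eq_mul_div, div_one, Real.norm_eq_abs, abs_mul, abs_of_pos hd0]
          rw [e3]
          calc _ ≤ cutoffConst / d * (|A| * d * 1) := by gcongr
            _ = cutoffConst * |A| := by field_simp
        · rw [norm_mul, norm_mul, norm_mul]
          have e1 : ‖χ y‖ ≤ 1 := by
            rw [Real.norm_eq_abs, abs_le]
            exact ⟨by linarith [show 0 ≤ χ y from boxCutoff_nonneg], boxCutoff_le_one⟩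
          have e2 : ‖Real.cos (ν * inner ℝ b y + τ)‖ ≤ 1 := Real.abs_cos_le_one _
          have e3 : ‖b j‖ ≤ ‖b‖ := PiLp.norm_apply_le b j
          calc _ ≤ 1 * (|A| * 1 * ‖b‖) := by
                rw [Real.norm_eq_abs A]
                gcongr
            _ = _ := by ring
      have hbd : ∀ y, ‖cellHom f T (ξ + colGrad ψ y)‖ ≤ M := fun y => by
        rw [Real.norm_eq_abs, abs_of_nonneg (cellHom_nonneg hf _)]
        refine (cellHom_le hf _).trans ?_
        have : ‖ξ + colGrad ψ y‖ ≤ K := (norm_add_le _ _).trans (add_le_add le_rfl (hgrad y))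
        rw [hM]
        gcongr
      have hi : IntegrableOn (fun y => cellHom f T (ξ + colGrad ψ y)) (sqAt 0 1) :=
        Integrable.of_bound (continuous_cellHom_colGrad hf hξ hψs hψT).aestronglyMeasurable M
          (Eventually.of_forall hbd)
      have e0 : g 0 = cellHom f T ξ := by simp [hg]
      rw [e0]
      refine hq.trans ?_
      rw [← integral_inter_add_sdiff hSm hi, Set.inter_eq_self_of_subset_right hS1]
      refine add_le_add (le_of_eq (setIntegral_congr_fun hSm fun y hy => ?_)) ?_
      · simp only [hg]
        congr 2
        ext j : 1
        rw [colGrad_wave hχs a b A τ hν0, fderiv_squareCutoff_eq_zero hd0 hy,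
          show χ y = 1 from squareCutoff_eq_one hd0 hy]
        simp [outer, smul_smul]
      · have h1 : volume (sqAt 0 1 \ S) < ⊤ :=
          (measure_ne_top_of_subset Set.sdiff_subset (by rw [hv1]; simp)).lt_top
        have h2 := norm_setIntegral_le_of_norm_le_const h1
          (f := fun y => cellHom f T (ξ + colGrad ψ y)) fun y _ => hbd y
        rw [measureReal_sdiff hS1 hSm (by rw [hv1]; simp), hSr, measureReal_def, hv1,
          ENNReal.toReal_one] at h2
        refine (le_abs_self _).trans (h2.trans ?_)
        gcongr
        nlinarith
    obtain ⟨N, hN⟩ := (isCompact_Icc (a := -|A|) (b := |A|)).exists_bound_of_continuousOn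
      hgc.continuousOn
    have hNb : ∀ θ : ℝ, ‖g (A * Real.cos θ)‖ ≤ N := fun θ => hN _ (by
      rw [Set.mem_Icc, ← abs_le, abs_mul]
      exact mul_le_of_le_one_right (abs_nonneg _) (Real.abs_cos_le_one _))
    have hFc : Continuous fun θ => g (A * Real.cos θ) := by fun_prop
    have hper : Function.Periodic (fun θ => g (A * Real.cos θ)) (2 * Real.pi) :=
      fun θ => by simp only [Real.cos_add_two_pi]
    have hc := continuous_integral_phase hFc hNb ν b S
    have hfub := integral_phase_average hFc hNb Real.two_pi_pos.le hper ν b S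
    have hint := intervalIntegral.integral_mono_on (μ := volume) (a := 0) (b := 2 * Real.pi)
      (by positivity) intervalIntegrable_const
      ((hc.intervalIntegrable _ _).add intervalIntegrable_const) fun τ _ => hτ τ
    rw [intervalIntegral.integral_add (hc.intervalIntegrable _ _) intervalIntegrable_const, hfub,
      hSr] at hint
    simp only [intervalIntegral.integral_const, sub_zero, smul_eq_mul] at hint
    refine hint.trans (add_le_add ?_ le_rfl)
    exact mul_le_of_le_one_left hJ0 (by nlinarith)
  have e0 : g 0 = cellHom f T ξ := by simp [hg]
  rw [← e0]
  have hlim : Tendsto (fun ε : ℝ => J + 2 * Real.pi * (M * (2 * ε))) (𝓝[>] 0) (𝓝 J) := by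
    have : Tendsto (fun ε : ℝ => J + 2 * Real.pi * (M * (2 * ε))) (𝓝 0)
        (𝓝 (J + 2 * Real.pi * (M * (2 * 0)))) := Continuous.tendsto (by fun_prop) 0
    simp only [mul_zero, add_zero] at this
    exact this.mono_left nhdsWithin_le_nhds
  refine ge_of_tendsto hlim ?_
  filter_upwards [Ioo_mem_nhdsGT (zero_lt_one' ℝ)] with ε hε
  exact step ε hε.1 hε.2

/-- The wave must take values in `T`, that is `a ∈ T`. This follows from any column with `b j ≠ 0`,
where `b j • a` is a difference of vectors of `T`; if `b = 0` the endpoints coincide. -/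
theorem isRankOneConvex_cellHom (hf : IsIntegrand p α β f) :
    IsRankOneConvex T (cellHom f T) := by
  rintro ξ ξ' hξ hξ' ⟨a, b, hab⟩ r h0 h1
  have hout : ξ - ξ' = outer a b := by
    ext j : 1
    exact hab j
  by_cases hb : b = 0
  · have : ξ = ξ' := by
      rw [← sub_eq_zero, hout, hb]
      ext j : 1
      simp [outer]
    subst this
    rw [← add_smul, ← add_mul]
    simp
  obtain ⟨j, hj⟩ : ∃ j, b j ≠ 0 := by
    by_contra! h
    exact hb (by ext j; exact h j)
  have ha : a ∈ T := by
    have : b j • a ∈ T := by rw [← hab j]; exact T.sub_mem (hξ j) (hξ' j)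
    exact (T.smul_mem_iff hj).1 this
  have hgin : ∀ s : ℝ, ColsIn T (ξ' + s • outer a b) := fun s j =>
    T.add_mem (hξ' j) (T.smul_mem _ (T.smul_mem _ ha))
  have hgc : Continuous fun s : ℝ => cellHom f T (ξ' + s • outer a b) := by
    have : (fun s : ℝ => cellHom f T (ξ' + s • outer a b)) =
        fun s => cellHom f T (colsMap T.starProjection (ξ' + s • outer a b)) := by
      funext s
      rw [colsMap_starProjection_eq (hgin s)]
    rw [this]
    exact (continuous_cellHom_proj hf).comp (by fun_prop)
  have key := le_chord_of_le_cos_average hgc (fun x A => by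
    have := cellHom_le_cos_average hf (hgin x) ha b A
    simpa only [add_smul, add_assoc] using this) h0 h1
  simp only [one_smul, zero_smul, add_zero] at key
  rw [← hout] at key
  have e1 : ξ' + r • (ξ - ξ') = r • ξ + (1 - r) • ξ' := by module
  rwa [e1, add_sub_cancel] at key

end rankOne

/-! ### Coercivity -/

section coercivity

variable {p α β : ℝ} {f : Euc 3 → Cols 3 → ℝ} {T : Submodule ℝ (Euc 3)}

/-- The in-plane part `∇_α φ` of the gradient of a field which vanishes on the lateral boundary
has mean zero. -/
theorem IsStripField.integral_col_eq_zero {t : ℝ} {φ : Euc 3 → Euc 3} {G : Euc 3 → Cols 3}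
    (h : IsStripField T (sqAt 0 t) φ G) {j : Fin 3} (hj : j ≠ 2) :
    ∫ x in prism (sqAt 0 t), G x j = 0 := by
  set S := prism (sqAt 0 t) with hS
  have hSm : MeasurableSet S := (isOpen_prism (isOpen_sqAt _ _)).measurableSet
  have hSfin : IsFiniteMeasure (volume.restrict S) :=
    ⟨by simpa using (volume_prism_sqAt_ne_top 0 t).lt_top⟩
  have hGi : IntegrableOn (fun x => G x j) S :=
    (memLp_top_col (h.memLp_grad _) j).integrable le_top
  set δ : ℕ → ℝ := fun n => 1 / ((n : ℝ) + 1) with hδ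
  have hδ0 : ∀ n, 0 < δ n := fun n => Nat.one_div_pos_of_nat
  have hδlim : Tendsto δ atTop (𝓝 0) := tendsto_one_div_add_atTop_nhds_zero_nat
  -- The cutoff acts near `x_3 = ±1/2`, where the field need not vanish. In the plane it equals `1`
  -- on the square and decays only where `φ` and `G` are zero, so the term with its in-plane
  -- derivative drops out.
  set η : ℕ → Euc 3 → ℝ := fun n =>
    boxCutoff Finset.univ ![t / 2, t / 2, 1 / 2 - 2 * δ n] ![1, 1, δ n] with hη
  have hd : ∀ n i, 0 < (![1, 1, δ n] : Fin 3 → ℝ) i := fun n i => by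
    fin_cases i
    · exact one_pos
    · exact one_pos
    · exact hδ0 n
  have hηs : ∀ n, ContDiff ℝ ∞ (η n) := fun n => boxCutoff_contDiff _ _ _
  have habs : ∀ x ∈ S, |x 0| < t / 2 ∧ |x 1| < t / 2 := fun x hx =>
    ⟨by simpa using! hx.1 0, by simpa using! hx.1 1⟩
  have hz : ∀ n, ∫ x in S, η n x • G x j = 0 := by
    intro n
    have hsup := tsupport_boxCutoff_subset (J := Finset.univ)
      (b := ![t / 2, t / 2, 1 / 2 - 2 * δ n]) (hd n)
    have hcs : HasCompactSupport (η n) := by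
      refine HasCompactSupport.of_support_subset_isCompact
        (isCompact_closedBall (0 : Euc 3) (3 * (|t / 2| + 2))) fun x hx => ?_
      have h1 := hsup (subset_tsupport _ hx)
      have h2 := hδ0 n
      have h3 : ∀ i, ‖x i‖ ≤ |t / 2| + 2 := fun i => by
        refine (h1 i (Finset.mem_univ i)).trans ?_
        have h4 := le_abs_self (t / 2)
        fin_cases i
        · simp only [Fin.zero_eta, Matrix.cons_val_zero]; linarith
        · simp only [Fin.mk_one, Matrix.cons_val_one, Matrix.cons_val_zero]; linarith
        · simp only [Fin.reduceFinMk, Matrix.cons_val]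
          have := abs_nonneg (t / 2)
          linarith
      rw [mem_closedBall_zero_iff, EuclideanSpace.norm_eq, Fin.sum_univ_three,
        Real.sqrt_le_left (by positivity)]
      have h5 := fun i => pow_le_pow_left₀ (norm_nonneg (x i)) (h3 i) 2
      nlinarith [h5 0, h5 1, h5 2]
    have ht : tsupport (η n) ⊆ layer := fun x hx => by
      have h1 := hsup hx 2 (Finset.mem_univ _)
      have h2 := hδ0 n
      simp only [Matrix.cons_val] at h1
      show |x 2| < 1 / 2
      linarith
    have hw := h.1.2.2 (η n) (hηs n) hcs ht j
    have hl : ∫ x in layer, fderiv ℝ (η n) x (EuclideanSpace.single j 1) • φ x = 0 := by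
      rw [setIntegral_congr_fun (g := fun _ => 0) isOpen_layer.measurableSet fun x hx => ?_]
      · simp
      · by_cases hxS : inPlane x ∈ sqAt 0 t
        · have hab := habs x ⟨hxS, hx⟩
          have : fderiv ℝ (η n) x (EuclideanSpace.single j 1) = 0 :=
            fderiv_boxCutoff_single_eq_zero (hd n) fun _ => Or.inl (by
              fin_cases j
              · exact hab.1.le
              · exact hab.2.le
              · exact absurd rfl hj)
          simp only [this, zero_smul]
        · simp only [h.eq_zero x hxS, smul_zero]
    rw [hl, eq_comm, neg_eq_zero] at hw
    rw [← hw]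
    symm
    refine setIntegral_eq_of_subset_of_forall_sdiff_eq_zero isOpen_layer.measurableSet
      (prism_subset_layer _) fun x hx => ?_
    rw [h.grad_eq_zero x fun hxS => hx.2 ⟨hxS, hx.1⟩]
    simp
  have hlim : Tendsto (fun n => ∫ x in S, η n x • G x j) atTop (𝓝 (∫ x in S, G x j)) := by
    refine tendsto_integral_of_dominated_convergence (fun x => ‖G x j‖)
      (fun n => (hηs n).continuous.aestronglyMeasurable.smul hGi.aestronglyMeasurable) hGi.norm
      (fun n => Eventually.of_forall fun x => ?_) ?_
    · rw [norm_smul, Real.norm_eq_abs, abs_of_nonneg boxCutoff_nonneg]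
      exact mul_le_of_le_one_left (norm_nonneg _) boxCutoff_le_one
    · refine (ae_restrict_iff' hSm).2 (Eventually.of_forall fun x hx => ?_)
      refine tendsto_const_nhds.congr' ?_
      have h0 : Tendsto (fun n => 1 / 2 - 2 * δ n) atTop (𝓝 (1 / 2 - 2 * 0)) :=
        tendsto_const_nhds.sub (hδlim.const_mul 2)
      have h1 : |x 2| < 1 / 2 - 2 * 0 := by simpa using hx.2
      filter_upwards [h0.eventually_const_lt h1] with n hn
      have h2 : η n x = 1 := boxCutoff_eq_one (hd n) fun i _ => by
        have hab := habs x hx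
        fin_cases i
        · exact hab.1.le
        · exact hab.2.le
        · exact hn.le
      rw [h2, one_smul]
  simp only [hz] at hlim
  exact (tendsto_nhds_unique hlim tendsto_const_nhds)

/-- The first two columns of a matrix. -/
noncomputable def inPlaneCols : Cols 3 →L[ℝ] Cols 2 :=
  (PiLp.continuousLinearEquiv 2 ℝ fun _ : Fin 2 => Euc 3).symm.toContinuousLinearMap.comp
    (ContinuousLinearMap.pi fun j : Fin 2 =>
      PiLp.proj (𝕜 := ℝ) 2 (fun _ : Fin 3 => Euc 3) j.castSucc)

theorem inPlaneCols_apply (H : Cols 3) (j : Fin 2) : inPlaneCols H j = H j.castSucc := rfl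

theorem norm_inPlaneCols_le (H : Cols 3) : ‖inPlaneCols H‖ ≤ ‖H‖ := by
  rw [PiLp.norm_eq_of_L2, PiLp.norm_eq_of_L2, Fin.sum_univ_three, Fin.sum_univ_two]
  refine Real.sqrt_le_sqrt ?_
  simp only [inPlaneCols_apply]
  simp

theorem inPlaneCols_shiftedGradient (ξ : Cols 2) (G : Cols 3) :
    inPlaneCols (shiftedGradient ξ G) = ξ + inPlaneCols G := by
  ext j : 1
  fin_cases j <;> rfl

/-- The in-plane columns of the shifted gradient have mean `ξ`. Discarding the third column
decreases the norm, and Jensen's inequality for the `p`-th power gives the bound. -/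
theorem IsStripField.rpow_norm_le (hf : IsIntegrand p α β f) {t : ℝ} (ht : 0 < t) (ξ : Cols 2)
    {φ : Euc 3 → Euc 3} {G : Euc 3 → Cols 3} (h : IsStripField T (sqAt 0 t) φ G) :
    t ^ 2 * (α * ‖ξ‖ ^ p) ≤ ∫ x in prism (sqAt 0 t), f x (shiftedGradient ξ (G x)) := by
  have hp := hf.one_le
  have hα := hf.alpha_pos
  set S := prism (sqAt 0 t) with hS
  have hv : volume S = ENNReal.ofReal (t ^ 2) := volume_prism_sqAt 0 ht.le
  have hvr : volume.real S = t ^ 2 := by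
    rw [measureReal_def, hv, ENNReal.toReal_ofReal (sq_nonneg _)]
  have hfin : volume S ≠ ⊤ := volume_prism_sqAt_ne_top 0 t
  have hSf : IsFiniteMeasure (volume.restrict S) := ⟨by simpa using hfin.lt_top⟩
  have hSG : MemLp G ⊤ (volume.restrict S) := h.memLp_grad _
  set v : Euc 3 → Cols 2 := fun x => inPlaneCols (shiftedGradient ξ (G x)) with hvdef
  have hvL : MemLp v ⊤ (volume.restrict S) :=
    inPlaneCols.comp_memLp' (memLp_shiftedGradient hfin ξ hSG)
  have hvi : IntegrableOn v S := hvL.integrable le_top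
  have hvp : IntegrableOn (fun x => ‖v x‖ ^ p) S := by
    obtain ⟨B, hB⟩ : ∃ B : ℝ, ∀ᵐ x ∂volume.restrict S, ‖v x‖ ≤ B :=
      ⟨_, ae_le_lpNorm_exponent_top hvL⟩
    refine Integrable.of_bound (C := B ^ p)
      (hvL.1.norm.aemeasurable.pow_const p).aestronglyMeasurable ?_
    filter_upwards [hB] with x hx
    rw [Real.norm_eq_abs, abs_of_nonneg (by positivity)]
    gcongr
  have hmean : ∫ x in S, v x = t ^ 2 • ξ := by
    ext j : 1
    have e : (∫ x in S, v x) j = ∫ x in S, v x j :=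
      ((PiLp.proj (𝕜 := ℝ) 2 (fun _ : Fin 2 => Euc 3) j).integral_comp_comm hvi).symm
    rw [e]
    have e2 : ∀ x, v x j = ξ j + G x j.castSucc := fun x => by
      simp only [hvdef, inPlaneCols_shiftedGradient]
      rfl
    simp only [e2]
    rw [integral_add (integrable_const _) ((memLp_top_col hSG _).integrable le_top),
      h.integral_col_eq_zero (by fin_cases j <;> simp), setIntegral_const, hvr, add_zero]
    rfl
  have hnorm : ‖ξ‖ ≤ ⨍ x in S, ‖v x‖ := by
    rw [setAverage_eq, hvr, smul_eq_mul, le_inv_mul_iff₀ (by positivity)]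
    calc t ^ 2 * ‖ξ‖ = ‖∫ x in S, v x‖ := by
          rw [hmean, norm_smul, Real.norm_eq_abs, abs_of_nonneg (sq_nonneg t)]
      _ ≤ _ := norm_integral_le_integral_norm _
  have hJ := (convexOn_rpow hp).map_set_average_le (μ := volume) (t := S)
    (f := fun x => ‖v x‖) (fun x _ => (Real.continuousAt_rpow_const x p
      (Or.inr (by linarith))).continuousWithinAt) isClosed_Ici
    (by rw [hv]; simpa using ht.ne') hfin (Eventually.of_forall fun x => norm_nonneg _) hvi.norm hvp
  have h1 : ‖ξ‖ ^ p ≤ ⨍ x in S, ‖v x‖ ^ p :=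
    (Real.rpow_le_rpow (norm_nonneg _) hnorm (by linarith)).trans hJ
  rw [setAverage_eq, hvr, smul_eq_mul, le_inv_mul_iff₀ (by positivity)] at h1
  calc t ^ 2 * (α * ‖ξ‖ ^ p) = α * (t ^ 2 * ‖ξ‖ ^ p) := by ring
    _ ≤ α * ∫ x in S, ‖v x‖ ^ p := by gcongr
    _ = ∫ x in S, α * ‖v x‖ ^ p := (integral_const_mul _ _).symm
    _ ≤ _ := by
      refine integral_mono_ae (hvp.const_mul α) (hf.integrableOn ξ h 0 t) ?_
      filter_upwards [ae_restrict_of_ae hf.growth] with x hx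
      refine le_trans ?_ (hx _).1
      gcongr
      exact norm_inPlaneCols_le _

theorem rpow_norm_le_cellInf (hf : IsIntegrand p α β f) {t : ℝ} (ht : 0 < t) (ξ : Cols 2) :
    α * ‖ξ‖ ^ p ≤ cellInf f T t ξ := by
  by_contra! hlt
  obtain ⟨φ, G, h, hE⟩ := exists_field_lt hlt
  rw [one_div, inv_mul_lt_iff₀ (by positivity)] at hE
  exact absurd (h.rpow_norm_le hf ht ξ) (not_le.2 hE)

theorem rpow_norm_le_cellHom (hf : IsIntegrand p α β f) (ξ : Cols 2) :
    α * ‖ξ‖ ^ p ≤ cellHom f T ξ :=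
  ge_of_tendsto (tendsto_cellInf hf ξ) (by
    filter_upwards [eventually_gt_atTop 0] with t ht using rpow_norm_le_cellInf hf ht ξ)

end coercivity

/-! ### The penalized problem -/

section penalization

variable {p α β : ℝ} {f : Euc 3 → Cols 3 → ℝ}

theorem colsProj_shiftedGradient {T : Submodule ℝ (Euc 3)} {ξ : Cols 2} (hξ : ColsIn T ξ)
    (G : Cols 3) :
    colsProj T (shiftedGradient ξ G) = shiftedGradient ξ (colsMap T.starProjection G) := by
  have h : ∀ j, T.starProjection (ξ j) = ξ j := fun j =>
    Submodule.starProjection_eq_self_iff.2 (hξ j)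
  ext j : 1
  fin_cases j
  · simp [colsProj, shiftedGradient, colsMap_apply, h]
  · simp [colsProj, shiftedGradient, colsMap_apply, h]
  · simp [colsProj, shiftedGradient, colsMap_apply]

theorem measurableSet_box (t : ℝ) : MeasurableSet (box t) := by
  rw [box_eq_prism]; exact (isOpen_prism (isOpen_sqAt _ _)).measurableSet

theorem isOpen_box (t : ℝ) : IsOpen (box t) := by
  rw [box_eq_prism]; exact isOpen_prism (isOpen_sqAt _ _)

theorem volume_box_ne_top (t : ℝ) : volume (box t) ≠ ⊤ := by
  rw [box_eq_prism]; exact volume_prism_sqAt_ne_top _ _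

theorem penalized_ae_nonneg (hf : IsIntegrand p α β f) (M : Set (Euc 3)) (s : Euc 3) :
    ∀ᵐ x ∂volume, ∀ ξ, 0 ≤ penalized p f M s x ξ := by
  filter_upwards [hf.ae_nonneg] with x hx ξ
  exact add_nonneg (hx _) (Real.rpow_nonneg (norm_nonneg _) _)

/-- Penalizing the normal components does not change the cell infima at tangential matrices. -/
theorem penalizedCellInf_eq (hf : IsIntegrand p α β f) (M : Set (Euc 3)) (s : Euc 3)
    {ξ : Cols 2} (hξ : ColsIn (tangentSpaceAt M s) ξ) (t : ℝ) :
    penalizedCellInf p f M s ξ t = cellInf f (tangentSpaceAt M s) t ξ := by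
  have hp := hf.one_le
  have hbdd : BddBelow {r | ∃ (φ : Euc 3 → Euc 3) (G : Euc 3 → Cols 3),
      IsTestField (box t) (lateralBdry t) ⊤ φ G ∧
        r = 1 / t ^ 2 * ∫ x in box t, penalized p f M s x (shiftedGradient ξ (G x))} := by
    refine ⟨0, ?_⟩
    rintro r ⟨φ, G, -, rfl⟩
    refine mul_nonneg (by positivity) (integral_nonneg_of_ae (ae_restrict_of_ae ?_))
    filter_upwards [penalized_ae_nonneg hf M s] with x hx using hx _
  set T := tangentSpaceAt M s with hT
  -- For `≤`, a `T`-valued field competes in the penalized problem with zero penalty. For `≥`, the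
  -- projection of an arbitrary field is `T`-valued and still vanishes on the lateral boundary, and
  -- its energy is that of the field without the penalty.
  refine le_antisymm ?_ ?_
  · refine le_csInf ⟨_, _, _, (isStripField_zero (square t)).isTestField, rfl⟩ ?_
    rintro r ⟨φ, G, h, rfl⟩
    refine csInf_le hbdd ⟨φ, G, ⟨h.1, fun x _ => Submodule.mem_top, h.2.2.1, h.2.2.2⟩, ?_⟩
    congr 1
    refine setIntegral_congr_ae (measurableSet_box t) ?_
    filter_upwards [h.1.ae_colsIn (isOpen_box t) h.2.1] with x hx hxb
    have e : colsProj T (shiftedGradient ξ (G x)) = shiftedGradient ξ (G x) := by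
      rw [colsProj_shiftedGradient hξ, colsMap_starProjection_eq (hx hxb)]
    rw [penalized, ← hT, e, sub_self, norm_zero, Real.zero_rpow (by linarith), add_zero]
  · refine le_csInf ⟨_, _, _, (isStripField_zero (square t)).isTestField, rfl⟩ ?_
    rintro r ⟨φ, G, h, rfl⟩
    have hPf : IsTestField (box t) (lateralBdry t) T (fun x => T.starProjection (φ x))
        (fun x => colsMap T.starProjection (G x)) :=
      ⟨h.1.clm _, fun x _ => T.starProjection_apply_mem _,
        T.starProjection.continuous.comp_continuousOn h.2.2.1,
        fun x hx => by simp only [h.2.2.2 x hx, map_zero]⟩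
    refine (csInf_le (cellInf_bddBelow hf t ξ) ⟨_, _, hPf, rfl⟩).trans ?_
    refine mul_le_mul_of_nonneg_left ?_ (by positivity)
    have hfin := volume_box_ne_top t
    have hbf : IsFiniteMeasure (volume.restrict (box t)) := ⟨by simpa using hfin.lt_top⟩
    have hi1 := integrableOn_of_growth hf hfin (memLp_shiftedGradient hfin ξ hPf.1.2.1)
    have hHL := memLp_shiftedGradient hfin ξ h.1.2.1
    have hDL : MemLp (fun x => shiftedGradient ξ (G x) -
        colsMap T.starProjection (shiftedGradient ξ (G x))) ⊤ (volume.restrict (box t)) :=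
      hHL.sub ((colsMap T.starProjection).comp_memLp' hHL)
    have hi2 : IntegrableOn (fun x => ‖shiftedGradient ξ (G x) -
        colsMap T.starProjection (shiftedGradient ξ (G x))‖ ^ p) (box t) := by
      refine Integrable.of_bound
        (C := (lpNorm (fun x => shiftedGradient ξ (G x) -
          colsMap T.starProjection (shiftedGradient ξ (G x))) ⊤ (volume.restrict (box t))) ^ p)
        (hDL.1.norm.aemeasurable.pow_const p).aestronglyMeasurable ?_
      filter_upwards [ae_le_lpNorm_exponent_top hDL] with x hx
      rw [Real.norm_eq_abs, abs_of_nonneg (by positivity)]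
      exact Real.rpow_le_rpow (norm_nonneg _) hx (by linarith)
    have e : ∀ x, penalized p f M s x (shiftedGradient ξ (G x)) =
        f x (shiftedGradient ξ (colsMap T.starProjection (G x))) + ‖shiftedGradient ξ (G x) -
          colsMap T.starProjection (shiftedGradient ξ (G x))‖ ^ p := fun x => by
      rw [penalized, ← hT, colsProj_shiftedGradient hξ, ← colsProj_shiftedGradient hξ]
      rfl
    simp only [e]
    refine integral_mono hi1 (hi1.add hi2) fun x => ?_
    exact le_add_of_nonneg_right (Real.rpow_nonneg (norm_nonneg _) _)

end penalization

/-! ### Assembly of the proposition -/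

theorem proposition2p1 (p : ℝ) (hp : 1 ≤ p) (d : ℕ) (M : Set (Euc 3))
    (hM : IsSmoothSubmanifold d M) (f : Euc 3 → Cols 3 → ℝ) (hf : IsCaratheodoryFun f)
    (hper : IsInPlanePeriodic f) (hgrowth : HasPGrowth p f) :
    -- (i) the limit exists, and the two densities agree
    (∀ s ∈ M, ∀ ξ : Cols 2, ColsIn (tangentSpaceAt M s) ξ →
      Tendsto (penalizedCellInf p f M s ξ) atTop (𝓝 (penalizedHom p f M s ξ)) ∧
        tangentialHom f M s ξ = penalizedHom p f M s ξ) ∧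
    -- (ii) tangential quasiconvexity and rank-one convexity
    (∀ s ∈ M, IsTangentiallyQuasiconvex (tangentSpaceAt M s) (tangentialHom f M s) ∧
      IsRankOneConvex (tangentSpaceAt M s) (tangentialHom f M s)) ∧
    -- (iii) coercivity, growth and the local Lipschitz estimate, uniformly in `s`
    (∃ C : ℝ, 0 < C ∧ ∀ s ∈ M, ∀ ξ : Cols 2, ColsIn (tangentSpaceAt M s) ξ →
      1 / C * ‖ξ‖ ^ p ≤ tangentialHom f M s ξ ∧
        tangentialHom f M s ξ ≤ C * (1 + ‖ξ‖ ^ p)) ∧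
    (∃ C : ℝ, 0 < C ∧ ∀ s ∈ M, ∀ ξ ξ' : Cols 2,
      ColsIn (tangentSpaceAt M s) ξ → ColsIn (tangentSpaceAt M s) ξ' →
      |tangentialHom f M s ξ - tangentialHom f M s ξ'| ≤
        C * ‖ξ - ξ'‖ * (1 + ‖ξ‖ ^ (p - 1) + ‖ξ'‖ ^ (p - 1))) := by
  obtain ⟨α, β, hα, hβ, hg⟩ := hgrowth
  have hI : IsIntegrand p α β f := ⟨hp, hα, hβ, hf, hper, hg⟩
  -- `tangentialHom f M s` unfolds to `cellHom f (tangentSpaceAt M s)`. The constant `1 / α + β`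
  -- serves both bounds: it is at least `β`, and its inverse is at most `α`.
  refine ⟨fun s _ ξ hξ => ?_, fun s _ => ⟨isTangentiallyQuasiconvex_cellHom hI,
    isRankOneConvex_cellHom hI⟩, ⟨1 / α + β, by positivity, fun s _ ξ _ => ⟨?_, ?_⟩⟩,
    ⟨lipConst p β, lipConst_pos hβ, fun s _ ξ ξ' h h' => abs_cellHom_sub_le hI h h'⟩⟩
  · have h1 : Tendsto (penalizedCellInf p f M s ξ) atTop (𝓝 (tangentialHom f M s ξ)) :=
      (tendsto_cellInf hI ξ).congr fun t => (penalizedCellInf_eq hI M s hξ t).symm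
    have h2 : penalizedHom p f M s ξ = tangentialHom f M s ξ := h1.limUnder_eq
    rw [h2]
    exact ⟨h1, rfl⟩
  · have h1 : 1 / (1 / α + β) ≤ α := by
      rw [div_le_iff₀ (by positivity), mul_add, mul_one_div_cancel hα.ne']
      have := mul_pos hα hβ
      linarith
    exact (mul_le_mul_of_nonneg_right h1 (by positivity)).trans (rpow_norm_le_cellHom hI ξ)
  · refine (cellHom_le hI ξ).trans ?_
    have : β ≤ 1 / α + β := le_add_of_nonneg_left (by positivity)
    gcongr
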